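/- Let $k$ be a field with $\operatorname{char} k\neq 2$ and let $\mathfrak g=\mathfrak g_0\oplus\mathfrak g_1$ be a finite-dimensional Lie superalgebra over $k$ with $[\mathfrak g_1,\mathfrak g_1]=0$ and $\mathfrak g_1\neq 0$. Let $\mathcal M(\mathfrak g)$ be the category of $\mathbb Z$-graded $\mathfrak g$-modules $V=\bigoplus_{j}V^j$ with $\mathfrak g_0V^j\subseteq V^j$ and $\mathfrak g_1V^j\subseteq V^{j+1}$, with degree-preserving homomorphisms. Let $X=\mathcal P(\mathfrak g_1)=\operatorname{Proj}\operatorname{Sym}(\mathfrak g_1^*)$, so that $\Gamma(\mathscr O_X(1))=\mathfrak g_1^*$. The Lie algebra $\mathfrak g_0$ acts on $\mathfrak g_1^*$ by $(x\cdot f)(y)=-f([x,y])$, and hence by derivations on $\operatorname{Sym}(\mathfrak g_1^*)$, on $\mathscr O_X$ and on the sheaves $\mathscr O_X(j)$. A $\mathfrak g_0$-equivariant sheaf on $X$ is a sheaf of $\mathscr O_X$-modules $\mathscr M$ with a $k$-linear action of the Lie algebra $\mathfrak g_0$ on its sections, compatible with restrictions, such that $x(rm)=x(r)m+r\,x(m)$;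 morphisms are the $\mathscr O_X$-linear morphisms that commute with $\mathfrak g_0$. Tensor products of equivariant sheaves, and $W\otimes\mathscr O_X(j)$ for a representation $W$ of $\mathfrak g_0$, carry the action $x(m\otimes n)=xm\otimes n+m\otimes xn$; put $\mathscr M(n)=\mathscr M\otimes_{\mathscr O_X}\mathscr O_X(n)$. A complex $L$ of quasi-coherent $\mathfrak g_0$-equivariant sheaves on $X$, indexed by $\mathbb Z$, is called rigid if it is isomorphic to a complex $$\cdots\to V^{j}\otimes\mathscr O_X(j)\xrightarrow{\,d^j\,}V^{j+1}\otimes\mathscr O_X(j+1)\to\cdots$$ with representations $V^j$ of $\mathfrak g_0$ (of any dimension) and arbitrary $\mathfrak g_0$-equivariant differentials; it is called a finite rigid complex if it is bounded and the $V^j$ can all be taken finite-dimensional. Let $\mathfrak g_0\mathrm{Rig}$ be the full subcategory of rigid complexes in the category of complexes of $\mathfrak g_0$-equivariant sheaves. For $V\in\mathcal M(\mathfrak g)$ let $L(V)$ be the complex with terms $V^j\otimes\mathscr O_X(j)$ and differentials $d^j(v\otimes f)=\sum_i e_iv\otimes e_i^*f$, where $(e_i)$ is a basis of $\mathfrak g_1$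 and $(e_i^*)$ the dual basis. For a rigid complex $L$ let $V(L)=\bigoplus_j V(L)^j$ with $V(L)^j=\Gamma(L^j(-j))$, with the induced action of $\mathfrak g_0$, and with $x\in\mathfrak g_1$ acting on $v\in V(L)^j$ by $$xv=(-1)^j(\mathrm{id}\otimes s_x)\,\Gamma(d^j(-j))(v),$$ where $\Gamma(L^{j+1}(-j))$ is identified with $V(L)^{j+1}\otimes\mathfrak g_1^*$ through the multiplication map $\Gamma(L^{j+1}(-j-1))\otimes\Gamma(\mathscr O_X(1))\to\Gamma(L^{j+1}(-j))$ and $s_x:\mathfrak g_1^*\to k$ is evaluation at $x$. Then: 1. For every $V\in\mathcal M(\mathfrak g)$ the complex $L(V)$ is a well-defined rigid complex. For every rigid complex $L$ the above multiplication maps are bijective and $V(L)$ is a graded $\mathfrak g$-module. Both constructions are functorial. 2. The functors $L:\mathcal M(\mathfrak g)\to\mathfrak g_0\mathrm{Rig}$ and $V:\mathfrak g_0\mathrm{Rig}\to\mathcal M(\mathfrak g)$ are mutually inverse up to natural isomorphism, $V(L(-))\cong\mathrm{id}$ and $L(V(-))\cong\mathrm{id}$; in particular they are equivalences of categories. 3.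 Finite-dimensional modules correspond to finite rigid complexes: $V\in\mathcal M(\mathfrak g)$ is finite-dimensional if and only if $L(V)$ is a finite rigid complex, and for a rigid complex $L$ the module $V(L)$ is finite-dimensional if and only if $L$ is finite. A rigid complex is finite if and only if it is bounded and its terms are coherent over $\mathscr O_X$ (quasi-coherent, and $X$ is covered by affine open subsets $U$ over which the sections are a finitely generated $\mathscr O_X(U)$-module). In particular the terms of a finite rigid complex are coherent as $\mathfrak g_0$-equivariant sheaves, i.e. quasi-coherent and, over the members $U$ of an affine open covering, finitely generated under the joint action of $\mathscr O_X(U)$ and $\mathfrak g_0$. -/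

import Mathlib

open scoped DirectSum TensorProduct
set_option linter.unusedSectionVars false
set_option linter.unusedVariables false
set_option linter.unusedTactic false
universe u

noncomputable section

namespace GZeroGeometry

/-! ## The symmetric algebra as a graded algebra, and derivations -/

section SymmetricAlgebra
variable (k M : Type u) [Field k] [AddCommGroup M] [Module k M]

/-- The degree `n` part `Sⁿ(M)` of the symmetric algebra. -/
def symDeg (n : ℕ) : Submodule k (SymmetricAlgebra k M) :=
  LinearMap.range (SymmetricAlgebra.ι k M) ^ n

/-- The inclusion of `M` into the direct sum of the graded pieces. -/
def symGradedι : M →ₗ[k] ⨁ n : ℕ, symDeg k M n :=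
  DirectSum.lof k ℕ (fun n => symDeg k M n) 1 ∘ₗ
    (SymmetricAlgebra.ι k M).codRestrict (symDeg k M 1) fun m => by
      simpa only [symDeg, pow_one] using LinearMap.mem_range_self _ m

instance symDeg_gradedMonoid : SetLike.GradedMonoid (symDeg k M) :=
  inferInstanceAs (SetLike.GradedMonoid (fun n : ℕ => LinearMap.range (SymmetricAlgebra.ι k M) ^ n))

instance symGradedAlgebra : GradedAlgebra (symDeg k M) :=
  GradedAlgebra.ofAlgHom _ (SymmetricAlgebra.lift (symGradedι k M))
    (by
      apply SymmetricAlgebra.algHom_ext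
      ext m
      simp [symGradedι, DirectSum.lof_eq_of, DirectSum.coeAlgHom_of])
    (fun i x => by
      obtain ⟨x, hx⟩ := x
      dsimp only [Subtype.coe_mk]
      unfold symDeg at hx
      induction hx using Submodule.pow_induction_on_left' with
      | algebraMap r =>
        rw [AlgHom.commutes, DirectSum.algebraMap_apply]; rfl
      | add x y i hx hy ihx ihy =>
        rw [map_add, ihx, ihy, ← map_add]
        rfl
      | mem_mul m hm i x hx ih =>
        obtain ⟨_, rfl⟩ := hm
        rw [map_mul, ih, SymmetricAlgebra.lift_ι_apply, symGradedι, LinearMap.comp_apply,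
          DirectSum.lof_eq_of, DirectSum.of_mul_of]
        exact DirectSum.of_eq_of_gradedMonoid_eq (Sigma.subtype_ext (add_comm _ _) rfl))

variable {k M}

/-- The derivation `snd ∘ φ` attached to an algebra map `φ : B → B[ε]` with `φ ≡ id mod ε`. -/
def derivationOfDual {B : Type u} [CommRing B] [Algebra k B] (φ : B →ₐ[k] DualNumber B)
    (hφ : ∀ b, (φ b).fst = b) : Derivation k B B :=
  Derivation.mk' ((TrivSqZeroExt.sndHom B B).restrictScalars k ∘ₗ φ.toLinearMap) (fun a b => by
    simp [hφ, mul_comm b])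

/-- The unique derivation of `S(M)` that extends a linear endomorphism of `M`. -/
def symDerivation (f : M →ₗ[k] M) :
    Derivation k (SymmetricAlgebra k M) (SymmetricAlgebra k M) :=
  derivationOfDual
    (SymmetricAlgebra.lift
      ((TrivSqZeroExt.inlAlgHom k (SymmetricAlgebra k M) (SymmetricAlgebra k M)).toLinearMap ∘ₗ
          SymmetricAlgebra.ι k M +
        (TrivSqZeroExt.inrHom (SymmetricAlgebra k M) (SymmetricAlgebra k M)).restrictScalars k ∘ₗ
          SymmetricAlgebra.ι k M ∘ₗ f))
    (fun b => by
      have : (TrivSqZeroExt.fstHom k (SymmetricAlgebra k M) (SymmetricAlgebra k M)).comp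
          (SymmetricAlgebra.lift
      ((TrivSqZeroExt.inlAlgHom k (SymmetricAlgebra k M) (SymmetricAlgebra k M)).toLinearMap ∘ₗ
          SymmetricAlgebra.ι k M +
        (TrivSqZeroExt.inrHom (SymmetricAlgebra k M) (SymmetricAlgebra k M)).restrictScalars k ∘ₗ
          SymmetricAlgebra.ι k M ∘ₗ f)) = AlgHom.id k _ := by
        apply SymmetricAlgebra.algHom_ext
        ext m
        simp
      exact congrArg (fun ψ => ψ b) this)

@[simp] theorem symDerivation_ι (f : M →ₗ[k] M) (m : M) :
    symDerivation f (SymmetricAlgebra.ι k M m) = SymmetricAlgebra.ι k M (f m) := by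
  simp [symDerivation, derivationOfDual]

theorem symDerivation_ext {D E : Derivation k (SymmetricAlgebra k M) (SymmetricAlgebra k M)}
    (h : ∀ m, D (SymmetricAlgebra.ι k M m) = E (SymmetricAlgebra.ι k M m)) : D = E := by
  ext a
  induction a using SymmetricAlgebra.induction with
  | algebraMap r => simp
  | ι x => exact h x
  | mul a b ha hb => simp [ha, hb]
  | add a b ha hb => simp [ha, hb]

theorem symDerivation_mem (f : M →ₗ[k] M) (n : ℕ) {a : SymmetricAlgebra k M}
    (ha : a ∈ symDeg k M n) : symDerivation f a ∈ symDeg k M n := by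
  unfold symDeg at ha ⊢
  induction ha using Submodule.pow_induction_on_left' with
  | algebraMap r => simp
  | add x y i hx hy ihx ihy => rw [map_add]; exact add_mem ihx ihy
  | mem_mul m hm i x hx ih =>
    obtain ⟨m, rfl⟩ := hm
    rw [Derivation.leibniz, smul_eq_mul, smul_eq_mul, symDerivation_ι, pow_succ']
    refine add_mem (Submodule.mul_mem_mul ⟨m, rfl⟩ ih) ?_
    rw [mul_comm x]
    exact Submodule.mul_mem_mul ⟨f m, rfl⟩ hx

/-- The action by derivations of a Lie algebra `g₀` on `S(M)` induced by a representation `M`. -/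
def symLieAction (g₀ : Type u) [LieRing g₀] [LieAlgebra k g₀] [LieRingModule g₀ M]
    [LieModule k g₀ M] :
    g₀ →ₗ⁅k⁆ Derivation k (SymmetricAlgebra k M) (SymmetricAlgebra k M) where
  toFun x := symDerivation (LieModule.toEnd k g₀ M x)
  map_add' x y := symDerivation_ext fun m => by simp
  map_smul' c x := symDerivation_ext fun m => by simp
  map_lie' {x y} := symDerivation_ext fun m => by
    simp [Derivation.commutator_apply]

end SymmetricAlgebra

section Localization
variable {k A : Type u} [Field k] [CommRing A] [Algebra k A]

/-- The algebra map `a ↦ a + ε d(a)` from `A` to the dual numbers over a localization of `A`. -/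
def dualOfDerivation (d : Derivation k A A) (S : Submonoid A) :
    A →ₐ[k] DualNumber (Localization S) where
  toFun a := (algebraMap A (Localization S) a, algebraMap A (Localization S) (d a))
  map_one' := by
    refine TrivSqZeroExt.ext (map_one _) ?_
    change algebraMap A (Localization S) (d 1) = 0
    rw [d.map_one_eq_zero, map_zero]
  map_mul' a b := by
    refine TrivSqZeroExt.ext (map_mul _ _ _) ?_
    change algebraMap A (Localization S) (d (a * b)) =
      algebraMap A (Localization S) a * algebraMap A (Localization S) (d b) +
        algebraMap A (Localization S) (d a) * algebraMap A (Localization S) b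
    rw [d.leibniz, smul_eq_mul, smul_eq_mul, map_add, map_mul, map_mul,
      mul_comm (algebraMap A (Localization S) b)]
  map_zero' := by
    refine TrivSqZeroExt.ext (map_zero _) ?_
    change algebraMap A (Localization S) (d 0) = 0
    rw [map_zero, map_zero]
  map_add' a b := by
    refine TrivSqZeroExt.ext (map_add _ _ _) ?_
    change algebraMap A (Localization S) (d (a + b)) =
      algebraMap A (Localization S) (d a) + algebraMap A (Localization S) (d b)
    rw [map_add, map_add]
  commutes' c := by
    refine TrivSqZeroExt.ext ?_ ?_
    · change algebraMap A (Localization S) (algebraMap k A c) = algebraMap k (Localization S) c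
      rw [IsScalarTower.algebraMap_apply k A (Localization S)]
    · change algebraMap A (Localization S) (d (algebraMap k A c)) = 0
      rw [d.map_algebraMap, map_zero]

theorem isUnit_dualOfDerivation (d : Derivation k A A) (S : Submonoid A) (s : S) :
    IsUnit (dualOfDerivation d S s) := by
  rw [TrivSqZeroExt.isUnit_iff_isUnit_fst]
  exact IsLocalization.map_units (Localization S) s

/-- The extension of a derivation to a localization (the quotient rule). -/
def locDerivation (d : Derivation k A A) (S : Submonoid A) :
    Derivation k (Localization S) (Localization S) :=
  derivationOfDual (IsLocalization.liftAlgHom (M := S) (f := dualOfDerivation d S)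
      (isUnit_dualOfDerivation d S)) (fun b => by
    have : (TrivSqZeroExt.fstHom k (Localization S) (Localization S)).comp
        (IsLocalization.liftAlgHom (M := S) (f := dualOfDerivation d S)
          (isUnit_dualOfDerivation d S)) = AlgHom.id k (Localization S) := by
      apply IsLocalization.algHom_ext (W := S)
      ext a
      change (IsLocalization.lift (isUnit_dualOfDerivation d S)
        (algebraMap A (Localization S) a)).fst = algebraMap A (Localization S) a
      rw [IsLocalization.lift_eq]
      rfl
    exact congrArg (fun φ => φ b) this)

@[simp] theorem locDerivation_algebraMap (d : Derivation k A A) (S : Submonoid A) (a : A) :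
    locDerivation d S (algebraMap A (Localization S) a) = algebraMap A (Localization S) (d a) := by
  change (IsLocalization.lift (isUnit_dualOfDerivation d S)
        (algebraMap A (Localization S) a)).snd = _
  rw [IsLocalization.lift_eq]
  rfl

theorem locDerivation_ext {S : Submonoid A}
    {D E : Derivation k (Localization S) (Localization S)}
    (h : ∀ a : A, D (algebraMap A _ a) = E (algebraMap A _ a)) : D = E := by
  ext z
  obtain ⟨⟨a, s⟩, hz⟩ := IsLocalization.surj S z
  have h1 := congrArg D hz
  have h2 := congrArg E hz
  simp only [Derivation.leibniz, h] at h1 h2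
  have h3 := h1.trans h2.symm
  have h4 := add_left_cancel h3
  exact (IsLocalization.map_units (Localization S) s).mul_left_cancel h4

theorem locDerivation_mk (d : Derivation k A A) (S : Submonoid A) (a : A) (s : S) :
    locDerivation d S (Localization.mk a s) =
      Localization.mk (s * d a - a * d s) (s * s) := by
  have hu := IsLocalization.map_units (Localization S) (s * s)
  apply hu.mul_left_cancel
  have e0 : algebraMap A (Localization S) s * Localization.mk a s = algebraMap A _ a := by
    rw [Localization.mk_eq_mk', IsLocalization.mk'_spec']
  have e1 := congrArg (locDerivation d S) e0
  simp only [Derivation.leibniz, locDerivation_algebraMap, smul_eq_mul] at e1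
  have e2 : algebraMap A (Localization S) ↑(s * s) *
      Localization.mk (s * d a - a * d s) (s * s) = algebraMap A _ (s * d a - a * d s) := by
    rw [Localization.mk_eq_mk', IsLocalization.mk'_spec']
  rw [e2]
  simp only [Submonoid.coe_mul, map_mul, map_sub]
  rw [← e1, ← e0]
  ring

/-- The action of a Lie algebra by derivations extends to localizations. -/
def locLieAction {g₀ : Type u} [LieRing g₀] [LieAlgebra k g₀]
    (δ : g₀ →ₗ⁅k⁆ Derivation k A A) (S : Submonoid A) :
    g₀ →ₗ⁅k⁆ Derivation k (Localization S) (Localization S) where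
  toFun x := locDerivation (δ x) S
  map_add' x y := locDerivation_ext fun a => by simp
  map_smul' c x := locDerivation_ext fun a => by
    simp [Algebra.smul_def, IsScalarTower.algebraMap_apply k A (Localization S)]
  map_lie' {x y} := locDerivation_ext fun a => by simp [Derivation.commutator_apply]

end Localization
open CategoryTheory AlgebraicGeometry TopologicalSpace Opposite

/-! ## Sheaves of modules with an action of a Lie algebra -/

section Equivariant
variable (k g₀ : Type u) [Field k] [LieRing g₀] [LieAlgebra k g₀]

/-- A `k`-scheme structure on `X`, together with an action of the Lie algebra `g₀` on the sections
of `𝒪_X` by `k`-linear derivations that is compatible with restrictions. -/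
structure SchemeAction (X : Scheme.{u}) where
  scalar (U : X.Opens) : k →+* Γ(X, U)
  scalar_res {U V : X.Opens} (i : U ⟶ V) (c : k) :
    X.presheaf.map i.op (scalar V c) = scalar U c
  act (x : g₀) (U : X.Opens) : Γ(X, U) →+ Γ(X, U)
  act_res (x : g₀) {U V : X.Opens} (i : U ⟶ V) (r : Γ(X, V)) :
    X.presheaf.map i.op (act x V r) = act x U (X.presheaf.map i.op r)
  act_mul (x : g₀) (U : X.Opens) (r s : Γ(X, U)) :
    act x U (r * s) = act x U r * s + r * act x U s
  act_scalar (x : g₀) (U : X.Opens) (c : k) : act x U (scalar U c) = 0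
  add_act (x y : g₀) (U : X.Opens) (r : Γ(X, U)) : act (x + y) U r = act x U r + act y U r
  smul_act (c : k) (x : g₀) (U : X.Opens) (r : Γ(X, U)) : act (c • x) U r = scalar U c * act x U r
  lie_act (x y : g₀) (U : X.Opens) (r : Γ(X, U)) :
    act ⁅x, y⁆ U r = act x U (act y U r) - act y U (act x U r)

variable {k g₀} {X : Scheme.{u}}

/-- A sheaf of `g₀𝒪_X`-modules: a sheaf of `𝒪_X`-modules with an action of the Lie algebra `g₀` on
sections that is compatible with restrictions and satisfies the Leibniz rule. -/
structure EquivModule (α : SchemeAction k g₀ X) where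
  sheaf : X.Modules
  act (x : g₀) (U : X.Opens) : Γ(sheaf, U) →+ Γ(sheaf, U)
  act_res (x : g₀) {U V : X.Opens} (i : U ⟶ V) (m : Γ(sheaf, V)) :
    sheaf.presheaf.map i.op (act x V m) = act x U (sheaf.presheaf.map i.op m)
  act_smul (x : g₀) (U : X.Opens) (r : Γ(X, U)) (m : Γ(sheaf, U)) :
    act x U (r • m) = α.act x U r • m + r • act x U m
  add_act (x y : g₀) (U : X.Opens) (m : Γ(sheaf, U)) : act (x + y) U m = act x U m + act y U m
  smul_act (c : k) (x : g₀) (U : X.Opens) (m : Γ(sheaf, U)) :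
    act (c • x) U m = α.scalar U c • act x U m
  lie_act (x y : g₀) (U : X.Opens) (m : Γ(sheaf, U)) :
    act ⁅x, y⁆ U m = act x U (act y U m) - act y U (act x U m)

namespace EquivModule
variable {α : SchemeAction k g₀ X}

/-- Morphisms of `g₀𝒪_X`-modules: `𝒪_X`-linear morphisms commuting with `g₀`. -/
@[ext] structure Hom (M N : EquivModule α) where
  hom : M.sheaf ⟶ N.sheaf
  comm (x : g₀) (U : X.Opens) (m : Γ(M.sheaf, U)) :
    hom.app U (M.act x U m) = N.act x U (hom.app U m)

instance : Category (EquivModule α) where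
  Hom := Hom
  id M := ⟨𝟙 _, fun _ _ _ => rfl⟩
  comp f g := ⟨f.hom ≫ g.hom, fun x U m => by
    change g.hom.app U (f.hom.app U _) = _
    rw [f.comm, g.comm]; rfl⟩
  id_comp f := Hom.ext (Category.id_comp _)
  comp_id f := Hom.ext (Category.comp_id _)
  assoc f g h := Hom.ext (Category.assoc _ _ _)

@[ext] theorem hom_ext {M N : EquivModule α} {f g : M ⟶ N} (h : Hom.hom f = Hom.hom g) : f = g :=
  Hom.ext h

instance : Limits.HasZeroMorphisms (EquivModule α) where
  zero M N := ⟨⟨0, fun x U m => by simp⟩⟩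
  comp_zero f K := hom_ext (Limits.comp_zero (f := Hom.hom f))
  zero_comp K {M N} f := hom_ext (Limits.zero_comp (f := Hom.hom f))

@[simp] theorem comp_hom {M N K : EquivModule α} (f : M ⟶ N) (g : N ⟶ K) :
    Hom.hom (f ≫ g) = Hom.hom f ≫ Hom.hom g := rfl
@[simp] theorem id_hom (M : EquivModule α) : Hom.hom (𝟙 M) = 𝟙 M.sheaf := rfl
@[simp] theorem zero_hom (M N : EquivModule α) : Hom.hom (0 : M ⟶ N) = 0 := rfl

end EquivModule
end Equivariant
/-! ## The action on `Proj` of a graded algebra induced by derivations of degree zero -/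

section ProjAction
variable {k g₀ A : Type u} [Field k] [LieRing g₀] [LieAlgebra k g₀] [CommRing A] [Algebra k A]
  (𝒜 : ℕ → Submodule k A) [GradedAlgebra 𝒜]

/-- The localization `A_p` at a homogeneous prime ideal `p`. -/
abbrev Loc (p : ProjectiveSpectrum 𝒜) : Type u :=
  Localization p.asHomogeneousIdeal.toIdeal.primeCompl

theorem mul_notMem (p : ProjectiveSpectrum 𝒜) {a b : A} (ha : a ∉ p.asHomogeneousIdeal)
    (hb : b ∉ p.asHomogeneousIdeal) : a * b ∉ p.asHomogeneousIdeal :=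
  p.asHomogeneousIdeal.toIdeal.primeCompl.mul_mem ha hb

theorem one_notMem (p : ProjectiveSpectrum 𝒜) : (1 : A) ∉ p.asHomogeneousIdeal :=
  p.asHomogeneousIdeal.toIdeal.primeCompl.one_mem

/-- The degree zero part `A_(p)` of `A_p`. -/
abbrev HLoc (p : ProjectiveSpectrum 𝒜) : Type u :=
  HomogeneousLocalization.AtPrime 𝒜 p.asHomogeneousIdeal.toIdeal

/-- The value in `A_(p)` of a section of the structure sheaf at the point `p`. -/
def secVal {U : (Proj 𝒜).Opens} (s : Γ(Proj 𝒜, U)) (p : ProjectiveSpectrum 𝒜) (hp : p ∈ U) :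
    HLoc 𝒜 p := Subtype.val s ⟨p, hp⟩

theorem sec_ext {U : (Proj 𝒜).Opens} {s t : Γ(Proj 𝒜, U)}
    (h : ∀ p hp, (secVal 𝒜 s p hp).val = (secVal 𝒜 t p hp).val) : s = t :=
  Subtype.ext (funext fun p => HomogeneousLocalization.val_injective _ (h p.1 p.2))

variable {𝒜}

/-- The quotient rule on the degree zero part of a localization, for a derivation of degree zero. -/
def hlocDerivation (d : Derivation k A A) (hd : ∀ n, ∀ a ∈ 𝒜 n, d a ∈ 𝒜 n) (S : Submonoid A)
    (z : HomogeneousLocalization 𝒜 S) : HomogeneousLocalization 𝒜 S :=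
  HomogeneousLocalization.mk
    { deg := z.deg + z.deg
      num := ⟨z.den * d z.num - z.num * d z.den,
        sub_mem (SetLike.mul_mem_graded z.den_mem_deg (hd _ _ z.num_mem_deg))
          (SetLike.mul_mem_graded z.num_mem_deg (hd _ _ z.den_mem_deg))⟩
      den := ⟨z.den * z.den, SetLike.mul_mem_graded z.den_mem_deg z.den_mem_deg⟩
      den_mem := S.mul_mem z.den_mem z.den_mem }

theorem hlocDerivation_val (d : Derivation k A A) (hd : ∀ n, ∀ a ∈ 𝒜 n, d a ∈ 𝒜 n)
    (S : Submonoid A) (z : HomogeneousLocalization 𝒜 S) :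
    (hlocDerivation d hd S z).val = locDerivation d S z.val := by
  rw [z.eq_num_div_den, locDerivation_mk]
  rfl

variable (δ : g₀ →ₗ⁅k⁆ Derivation k A A) (hδ : ∀ x n, ∀ a ∈ 𝒜 n, δ x a ∈ 𝒜 n)

/-- The action of `x : g₀` on a section of the structure sheaf of `Proj 𝒜`. -/
def projAct (x : g₀) (U : (Proj 𝒜).Opens) (s : Γ(Proj 𝒜, U)) : Γ(Proj 𝒜, U) :=
  ⟨fun p => hlocDerivation (δ x) (hδ x) _ (secVal 𝒜 s p.1 p.2), by
    intro p
    obtain ⟨V, hpV, i, n, a, b, hb, e⟩ := s.2 p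
    refine ⟨V, hpV, i, n + n,
      ⟨b.1 * δ x a.1 - a.1 * δ x b.1,
        sub_mem (SetLike.mul_mem_graded b.2 (hδ x _ _ a.2))
          (SetLike.mul_mem_graded a.2 (hδ x _ _ b.2))⟩,
      ⟨b.1 * b.1, SetLike.mul_mem_graded b.2 b.2⟩,
      fun q => mul_notMem 𝒜 q.1 (hb q) (hb q),
      fun q => ?_⟩
    apply HomogeneousLocalization.val_injective
    have e1 : (secVal 𝒜 s q.1 (i.le q.2)).val = Localization.mk a.1 ⟨b.1, hb q⟩ :=
      congrArg HomogeneousLocalization.val (e q)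
    refine (hlocDerivation_val (δ x) (hδ x) _ (secVal 𝒜 s q.1 (i.le q.2))).trans ?_
    rw [e1, locDerivation_mk]
    rfl⟩

theorem projAct_val (x : g₀) (U : (Proj 𝒜).Opens) (s : Γ(Proj 𝒜, U)) (p) (hp) :
    (secVal 𝒜 (projAct δ hδ x U s) p hp).val =
      locDerivation (δ x) _ (secVal 𝒜 s p hp).val :=
  hlocDerivation_val (δ x) (hδ x) _ _

theorem secVal_add {U : (Proj 𝒜).Opens} (s t : Γ(Proj 𝒜, U)) (p) (hp) :
    (secVal 𝒜 (s + t) p hp).val = (secVal 𝒜 s p hp).val + (secVal 𝒜 t p hp).val :=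
  HomogeneousLocalization.val_add _ _

theorem secVal_sub {U : (Proj 𝒜).Opens} (s t : Γ(Proj 𝒜, U)) (p) (hp) :
    (secVal 𝒜 (s - t) p hp).val = (secVal 𝒜 s p hp).val - (secVal 𝒜 t p hp).val :=
  HomogeneousLocalization.val_sub _ _

theorem secVal_mul {U : (Proj 𝒜).Opens} (s t : Γ(Proj 𝒜, U)) (p) (hp) :
    (secVal 𝒜 (s * t) p hp).val = (secVal 𝒜 s p hp).val * (secVal 𝒜 t p hp).val :=
  HomogeneousLocalization.val_mul _ _

/-- The image of a scalar in `A_(p)`. -/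
def hlocScalar (p : ProjectiveSpectrum 𝒜) (c : k) : HLoc 𝒜 p :=
  HomogeneousLocalization.mk
    { deg := 0
      num := ⟨algebraMap k A c, SetLike.algebraMap_mem_graded 𝒜 c⟩
      den := ⟨1, SetLike.one_mem_graded 𝒜⟩
      den_mem := p.asHomogeneousIdeal.toIdeal.primeCompl.one_mem }

theorem hlocScalar_val (p : ProjectiveSpectrum 𝒜) (c : k) :
    (hlocScalar p c).val = algebraMap k (Loc 𝒜 p) c := by
  rw [IsScalarTower.algebraMap_apply k A (Loc 𝒜 p), ← Localization.mk_one_eq_algebraMap]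
  rfl

/-- The constant section attached to a scalar. -/
def projScalarSec (U : (Proj 𝒜).Opens) (c : k) : Γ(Proj 𝒜, U) :=
  ⟨fun p => hlocScalar p.1 c, fun p =>
    ⟨U, p.2, 𝟙 _, 0, ⟨algebraMap k A c, SetLike.algebraMap_mem_graded 𝒜 c⟩,
      ⟨1, SetLike.one_mem_graded 𝒜⟩,
      fun q => one_notMem 𝒜 q.1,
      fun _ => rfl⟩⟩

theorem projScalarSec_val (U : (Proj 𝒜).Opens) (c : k) (p) (hp) :
    (secVal 𝒜 (projScalarSec U c) p hp).val = algebraMap k (Loc 𝒜 p) c :=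
  hlocScalar_val p c

/-- The `k`-algebra structure of the sections of the structure sheaf of `Proj 𝒜`. -/
def projScalar (U : (Proj 𝒜).Opens) : k →+* Γ(Proj 𝒜, U) where
  toFun := projScalarSec U
  map_one' := sec_ext 𝒜 fun p hp => by
    rw [projScalarSec_val, map_one]; exact HomogeneousLocalization.val_one.symm
  map_mul' a b := sec_ext 𝒜 fun p hp => by
    rw [secVal_mul, projScalarSec_val, projScalarSec_val, projScalarSec_val, map_mul]
  map_zero' := sec_ext 𝒜 fun p hp => by
    rw [projScalarSec_val, map_zero]; exact HomogeneousLocalization.val_zero.symm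
  map_add' a b := sec_ext 𝒜 fun p hp => by
    rw [secVal_add, projScalarSec_val, projScalarSec_val, projScalarSec_val, map_add]

theorem projScalar_val (U : (Proj 𝒜).Opens) (c : k) (p) (hp) :
    (secVal 𝒜 (projScalar U c) p hp).val = algebraMap k (Loc 𝒜 p) c :=
  hlocScalar_val p c

/-- The action of `g₀` on the scheme `Proj 𝒜` induced by an action on `𝒜` by derivations of
degree zero. -/
def projAction : SchemeAction k g₀ (Proj 𝒜) where
  scalar := projScalar
  scalar_res i c := Subtype.ext rfl
  act x U := AddMonoidHom.mk' (projAct δ hδ x U) fun s t => sec_ext 𝒜 fun p hp => by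
    rw [secVal_add, projAct_val, projAct_val, projAct_val, secVal_add, map_add]
  act_res x U V i r := Subtype.ext rfl
  act_mul x U r s := sec_ext 𝒜 fun p hp => by
    simp only [AddMonoidHom.mk'_apply, secVal_add, secVal_mul, projAct_val, Derivation.leibniz,
      smul_eq_mul]
    ring
  act_scalar x U c := sec_ext 𝒜 fun p hp => by
    simp only [AddMonoidHom.mk'_apply, projAct_val, projScalar_val, Derivation.map_algebraMap]
    exact HomogeneousLocalization.val_zero.symm
  add_act x y U r := sec_ext 𝒜 fun p hp => by
    simp only [AddMonoidHom.mk'_apply, secVal_add, projAct_val]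
    exact DFunLike.congr_fun (map_add (locLieAction δ
      p.asHomogeneousIdeal.toIdeal.primeCompl) x y) _
  smul_act c x U r := sec_ext 𝒜 fun p hp => by
    simp only [AddMonoidHom.mk'_apply, secVal_mul, projAct_val, projScalar_val]
    rw [← Algebra.smul_def]
    exact DFunLike.congr_fun (map_smul (locLieAction δ
      p.asHomogeneousIdeal.toIdeal.primeCompl) c x) _
  lie_act x y U r := sec_ext 𝒜 fun p hp => by
    simp only [AddMonoidHom.mk'_apply, secVal_sub, projAct_val]
    rw [← Derivation.commutator_apply]
    exact DFunLike.congr_fun (LieHom.map_lie (locLieAction δ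
      p.asHomogeneousIdeal.toIdeal.primeCompl) x y) _

end ProjAction
/-! ## The sheaves `W ⊗ 𝒪(j)` on `Proj` -/

section TensorAction
variable {k B g₀ W : Type u} [Field k] [CommRing B] [Algebra k B] [LieRing g₀] [LieAlgebra k g₀]
  [AddCommGroup W] [Module k W] [LieRingModule g₀ W] [LieModule k g₀ W]

/-- The endomorphism `b ⊗ w ↦ D(b) ⊗ w + b ⊗ x w` of `B ⊗ W`. -/
def tensorAct (D : Derivation k B B) (x : g₀) : B ⊗[k] W →ₗ[k] B ⊗[k] W :=
  LinearMap.rTensor W (D : B →ₗ[k] B) + LinearMap.lTensor B (LieModule.toEnd k g₀ W x)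

@[simp] theorem tensorAct_tmul (D : Derivation k B B) (x : g₀) (b : B) (w : W) :
    tensorAct D x (b ⊗ₜ[k] w) = D b ⊗ₜ w + b ⊗ₜ ⁅x, w⁆ := by
  simp [tensorAct]

theorem tensorAct_smul (D : Derivation k B B) (x : g₀) (b : B) (z : B ⊗[k] W) :
    tensorAct D x (b • z) = D b • z + b • tensorAct D x z := by
  induction z with
  | zero => simp
  | add y z hy hz => simp only [smul_add, map_add, hy, hz]; abel
  | tmul c w =>
    simp only [TensorProduct.smul_tmul', smul_eq_mul, tensorAct_tmul, Derivation.leibniz,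
      TensorProduct.add_tmul, smul_add]
    rw [mul_comm c]
    abel

theorem tensorAct_add (D E : Derivation k B B) (x y : g₀) (z : B ⊗[k] W) :
    tensorAct (D + E) (x + y) z = tensorAct D x z + tensorAct E y z := by
  induction z with
  | zero => simp
  | add y z hy hz => simp only [map_add, hy, hz]; abel
  | tmul c w =>
    simp only [tensorAct_tmul, Derivation.add_apply, add_lie, TensorProduct.add_tmul,
      TensorProduct.tmul_add]
    abel

theorem tensorAct_csmul (c : k) (D : Derivation k B B) (x : g₀) (z : B ⊗[k] W) :
    tensorAct (c • D) (c • x) z = algebraMap k B c • tensorAct D x z := by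
  induction z with
  | zero => simp
  | add y z hy hz => simp only [map_add, smul_add, hy, hz]
  | tmul b w =>
    simp only [tensorAct_tmul, Derivation.smul_apply, smul_lie, TensorProduct.tmul_smul,
      algebraMap_smul, smul_add, TensorProduct.smul_tmul']

theorem tensorAct_lie (D E : Derivation k B B) (x y : g₀) (z : B ⊗[k] W) :
    tensorAct ⁅D, E⁆ ⁅x, y⁆ z =
      tensorAct D x (tensorAct E y z) - tensorAct E y (tensorAct D x z) := by
  induction z with
  | zero => simp
  | add y z hy hz => simp only [map_add, hy, hz]; abel
  | tmul b w =>
    simp only [tensorAct_tmul, Derivation.commutator_apply, lie_lie, TensorProduct.sub_tmul,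
      TensorProduct.tmul_sub, map_add]
    abel

end TensorAction

section Twist
variable {k g₀ A : Type u} [Field k] [LieRing g₀] [LieAlgebra k g₀] [CommRing A] [Algebra k A]
  (𝒜 : ℕ → Submodule k A) [GradedAlgebra 𝒜]
  (W : Type u) [AddCommGroup W] [Module k W] [LieRingModule g₀ W] [LieModule k g₀ W]

/-- The degree `i` part `𝒜ᵢ ⊗ W` of `A ⊗ W`. -/
def numDeg (i : ℕ) : Submodule k (A ⊗[k] W) :=
  Submodule.span k {z | ∃ a ∈ 𝒜 i, ∃ w : W, z = a ⊗ₜ[k] w}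

/-- The localization map `A ⊗ W → A_p ⊗ W`. -/
def numMap (p : ProjectiveSpectrum 𝒜) : A ⊗[k] W →ₗ[k] Loc 𝒜 p ⊗[k] W :=
  LinearMap.rTensor W (IsScalarTower.toAlgHom k A (Loc 𝒜 p)).toLinearMap

variable {𝒜 W}

theorem smul_mem_numDeg {m i l : ℕ} (h : m + i = l) {c : A} (hc : c ∈ 𝒜 m) {z : A ⊗[k] W}
    (hz : z ∈ numDeg 𝒜 W i) : c • z ∈ numDeg 𝒜 W l := by
  subst h
  induction hz using Submodule.span_induction with
  | zero => simp
  | add x y _ _ hx hy => rw [smul_add]; exact add_mem hx hy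
  | smul a x _ hx => rw [smul_comm]; exact Submodule.smul_mem _ _ hx
  | mem x hx =>
    obtain ⟨a, ha, w, rfl⟩ := hx
    exact Submodule.subset_span ⟨c * a, SetLike.mul_mem_graded hc ha, w, rfl⟩

theorem numMap_smul (p : ProjectiveSpectrum 𝒜) (c : A) (z : A ⊗[k] W) :
    numMap 𝒜 W p (c • z) = algebraMap A (Loc 𝒜 p) c • numMap 𝒜 W p z := by
  induction z with
  | zero => simp
  | add y z hy hz => simp only [smul_add, map_add, hy, hz]
  | tmul a w => simp [numMap, TensorProduct.smul_tmul', Algebra.smul_def]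

theorem tensorAct_mem_numDeg (d : Derivation k A A) (hd : ∀ n, ∀ a ∈ 𝒜 n, d a ∈ 𝒜 n) (x : g₀)
    {i : ℕ} {z : A ⊗[k] W} (hz : z ∈ numDeg 𝒜 W i) : tensorAct d x z ∈ numDeg 𝒜 W i := by
  induction hz using Submodule.span_induction with
  | zero => simp
  | add x y _ _ hx hy => rw [map_add]; exact add_mem hx hy
  | smul a x _ hx => rw [map_smul]; exact Submodule.smul_mem _ _ hx
  | mem x hx =>
    obtain ⟨a, ha, w, rfl⟩ := hx
    rw [tensorAct_tmul]
    exact add_mem (Submodule.subset_span ⟨_, hd _ _ ha, _, rfl⟩)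
      (Submodule.subset_span ⟨_, ha, _, rfl⟩)

theorem numMap_tensorAct (d : Derivation k A A) (x : g₀) (p : ProjectiveSpectrum 𝒜)
    (z : A ⊗[k] W) :
    numMap 𝒜 W p (tensorAct d x z) =
      tensorAct (locDerivation d _) x (numMap 𝒜 W p z) := by
  induction z with
  | zero => simp
  | add y z hy hz => simp only [map_add, hy, hz]
  | tmul a w => simp [numMap]

variable (𝒜 W)

/-- The element `y` of `A_p ⊗ W` equals `a / b`. -/
def IsFracAt (p : ProjectiveSpectrum 𝒜) (a : A ⊗[k] W) (b : A) (y : Loc 𝒜 p ⊗[k] W) : Prop :=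
  b ∉ p.asHomogeneousIdeal ∧ algebraMap A (Loc 𝒜 p) b • y = numMap 𝒜 W p a

section IsFracAt
variable {𝒜 W} {p : ProjectiveSpectrum 𝒜} {a a' : A ⊗[k] W} {b b' : A} {y y' : Loc 𝒜 p ⊗[k] W}

theorem IsFracAt.zero (hb : b ∉ p.asHomogeneousIdeal) : IsFracAt 𝒜 W p 0 b 0 :=
  ⟨hb, by rw [smul_zero, map_zero]⟩

theorem IsFracAt.add (h : IsFracAt 𝒜 W p a b y) (h' : IsFracAt 𝒜 W p a' b' y') :
    IsFracAt 𝒜 W p (b' • a + b • a') (b' * b) (y + y') := by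
  refine ⟨mul_notMem 𝒜 p h'.1 h.1, ?_⟩
  rw [map_add, numMap_smul, numMap_smul, ← h.2, ← h'.2, smul_smul, smul_smul, ← map_mul,
    ← map_mul, mul_comm b b', ← smul_add]

theorem IsFracAt.neg (h : IsFracAt 𝒜 W p a b y) : IsFracAt 𝒜 W p (-a) b (-y) :=
  ⟨h.1, by rw [map_neg, ← h.2, smul_neg]⟩

theorem IsFracAt.smul (h : IsFracAt 𝒜 W p a b y) {c d : A} {r : HLoc 𝒜 p}
    (hd : d ∉ p.asHomogeneousIdeal) (hr : r.val = Localization.mk c ⟨d, hd⟩) :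
    IsFracAt 𝒜 W p (c • a) (d * b) (r.val • y) := by
  refine ⟨mul_notMem 𝒜 p hd h.1, ?_⟩
  have e4 : algebraMap A (Loc 𝒜 p) d * r.val = algebraMap A (Loc 𝒜 p) c := by
    rw [hr, Localization.mk_eq_mk']
    exact IsLocalization.mk'_spec' (Loc 𝒜 p) c
      (⟨d, hd⟩ : p.asHomogeneousIdeal.toIdeal.primeCompl)
  rw [numMap_smul, ← h.2, ← e4, map_mul, smul_smul, smul_smul]
  congr 1
  ring

theorem IsFracAt.act (h : IsFracAt 𝒜 W p a b y) (d : Derivation k A A) (x : g₀) :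
    IsFracAt 𝒜 W p (b • tensorAct d x a - d b • a) (b * b)
      (tensorAct (locDerivation d _) x y) := by
  refine ⟨mul_notMem 𝒜 p h.1 h.1, ?_⟩
  have e := congrArg (tensorAct (locDerivation d _) x) h.2
  rw [tensorAct_smul, locDerivation_algebraMap, ← numMap_tensorAct] at e
  rw [map_sub, numMap_smul, numMap_smul, ← e, ← h.2, smul_add, smul_smul, smul_smul, smul_smul,
    mul_comm (algebraMap A (Loc 𝒜 p) b) (algebraMap A (Loc 𝒜 p) (d b)), map_mul]
  abel

end IsFracAt

/-- A family of elements of `A_p ⊗ W` is a fraction of degree `j` if it is of the form `a / b` with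
`a` in `𝒜ᵢ ⊗ W`, `b` in `𝒜ₙ` and `i - n = j`. -/
def IsTwistFraction (j : ℤ) {U : Opens (ProjectiveSpectrum.top 𝒜)}
    (s : ∀ p : U, Loc 𝒜 p.1 ⊗[k] W) : Prop :=
  ∃ (i n : ℕ) (a : A ⊗[k] W) (b : A), (i : ℤ) = n + j ∧ a ∈ numDeg 𝒜 W i ∧ b ∈ 𝒜 n ∧
    ∀ p : U, IsFracAt 𝒜 W p.1 a b (s p)

/-- The sections of `W ⊗ 𝒪(j)` are the families of elements of `A_p ⊗ W` which are locally
fractions of degree `j`. -/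
def isLocallyTwistFraction (j : ℤ) :
    TopCat.LocalPredicate fun p : ProjectiveSpectrum.top 𝒜 => Loc 𝒜 p ⊗[k] W :=
  TopCat.PrelocalPredicate.sheafify
    { pred := fun s => IsTwistFraction 𝒜 W j s
      res := fun i _ ⟨l, n, a, b, h, ha, hb, e⟩ => ⟨l, n, a, b, h, ha, hb, fun p => e (i p)⟩ }

/-- The sections of `W ⊗ 𝒪(j)` over `U`. -/
def twistSections (j : ℤ) (U : Opens (ProjectiveSpectrum.top 𝒜)) :
    AddSubgroup (∀ p : U, Loc 𝒜 p.1 ⊗[k] W) where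
  carrier := {s | (isLocallyTwistFraction 𝒜 W j).pred s}
  zero_mem' p := by
    obtain ⟨n, b, hb, hp⟩ : ∃ (n : ℕ) (b : A), b ∈ 𝒜 n ∧ b ∉ p.1.asHomogeneousIdeal ∧
        0 ≤ n + j := by
      obtain ⟨f, m, hf, hm, hx⟩ : ∃ (f : A) (m : ℕ) (_ : f ∈ 𝒜 m) (_ : 0 < m),
          f ∉ p.1.asHomogeneousIdeal := by
        classical
        by_contra! H
        refine p.1.not_irrelevant_le fun z hz ↦ ?_
        rw [← DirectSum.sum_support_decompose 𝒜 z]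
        exact p.1.1.toIdeal.sum_mem fun k hk ↦ H _ k (SetLike.coe_mem _) <| by_contra <| by aesop
      refine ⟨j.natAbs • m, f ^ j.natAbs, SetLike.pow_mem_graded _ hf, ?_, ?_⟩
      · exact fun h => hx (p.1.isPrime.mem_of_pow_mem _ h)
      · have : (j.natAbs : ℤ) ≤ (j.natAbs • m : ℕ) := by
          exact_mod_cast Nat.le_mul_of_pos_right _ hm
        omega
    refine ⟨U ⊓ ProjectiveSpectrum.basicOpen 𝒜 b, ⟨p.2, hp.1⟩, Opens.infLELeft _ _,
      (n + j).toNat, n, 0, b, by omega, zero_mem _, hb, fun q => IsFracAt.zero q.2.2⟩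
  add_mem' {s t} hs ht p := by
    obtain ⟨V, hV, i, l, n, a, b, h, ha, hb, e⟩ := hs p
    obtain ⟨V', hV', i', l', n', a', b', h', ha', hb', e'⟩ := ht p
    refine ⟨V ⊓ V', ⟨hV, hV'⟩, Opens.infLELeft _ _ ≫ i, n' + l, n' + n, b' • a + b • a', b' * b,
      by push_cast; omega, add_mem (smul_mem_numDeg rfl hb' ha) (smul_mem_numDeg (by omega) hb ha'),
      SetLike.mul_mem_graded hb' hb, fun q => (e ⟨q.1, q.2.1⟩).add (e' ⟨q.1, q.2.2⟩)⟩
  neg_mem' {s} hs p := by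
    obtain ⟨V, hV, i, l, n, a, b, h, ha, hb, e⟩ := hs p
    refine ⟨V, hV, i, l, n, -a, b, h, neg_mem ha, hb, fun q => (e q).neg⟩

theorem smul_mem_twistSections (j : ℤ) {U : (Proj 𝒜).Opens} (r : Γ(Proj 𝒜, U))
    {s : ∀ p : U, Loc 𝒜 p.1 ⊗[k] W} (hs : s ∈ twistSections 𝒜 W j U) :
    (fun p : U => (secVal 𝒜 r p.1 p.2).val • s p) ∈ twistSections 𝒜 W j U := fun p => by
  obtain ⟨V, hV, i, l, n, a, b, h, ha, hb, e⟩ := hs p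
  obtain ⟨V', hV', i', n', ⟨c, hc⟩, ⟨d, hd⟩, hd', e'⟩ := r.2 p
  refine ⟨V ⊓ V', ⟨hV, hV'⟩, Opens.infLELeft _ _ ≫ i, n' + l, n' + n, c • a, d * b,
      by push_cast; omega, smul_mem_numDeg rfl hc ha, SetLike.mul_mem_graded hd hb,
      fun q => (e ⟨q.1, q.2.1⟩).smul (hd' ⟨q.1, q.2.2⟩)
        (congrArg HomogeneousLocalization.val (e' ⟨q.1, q.2.2⟩))⟩

/-- The sheaf of sets underlying `W ⊗ 𝒪(j)`. -/
def twistInType (j : ℤ) : TopCat.Sheaf (Type u) (ProjectiveSpectrum.top 𝒜) :=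
  TopCat.subsheafToTypes (isLocallyTwistFraction 𝒜 W j)

/-- The abelian presheaf underlying `W ⊗ 𝒪(j)`. -/
def twistAb (j : ℤ) : TopCat.Presheaf Ab.{u} (Proj 𝒜) where
  obj U := AddCommGrpCat.of (twistSections 𝒜 W j U.unop)
  map {U V} i := AddCommGrpCat.ofHom
    { toFun := fun s => ⟨fun p => s.1 (i.unop p), (isLocallyTwistFraction 𝒜 W j).res i.unop _ s.2⟩
      map_zero' := rfl
      map_add' := fun _ _ => rfl }

instance twistModule (j : ℤ) (U : (Proj 𝒜).Opensᵒᵖ) :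
    Module ((Proj 𝒜).ringCatSheaf.obj.obj U) ((twistAb 𝒜 W j).obj U) :=
  letI M : Module Γ(Proj 𝒜, U.unop) (twistSections 𝒜 W j U.unop) :=
    { smul := fun r s => ⟨_, smul_mem_twistSections 𝒜 W j r s.2⟩
      one_smul := fun s => Subtype.ext (funext fun p =>
        (congrArg (· • s.1 p) HomogeneousLocalization.val_one).trans (one_smul _ _))
      mul_smul := fun r t s => Subtype.ext (funext fun p =>
        (congrArg (· • s.1 p) (secVal_mul r t p.1 p.2)).trans (mul_smul _ _ _))
      smul_zero := fun r => Subtype.ext (funext fun p => smul_zero _)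
      smul_add := fun r s t => Subtype.ext (funext fun p => smul_add _ _ _)
      add_smul := fun r t s => Subtype.ext (funext fun p =>
        (congrArg (· • s.1 p) (secVal_add r t p.1 p.2)).trans (add_smul _ _ _))
      zero_smul := fun s => Subtype.ext (funext fun p =>
        (congrArg (· • s.1 p) HomogeneousLocalization.val_zero).trans (zero_smul _ _)) }
  M

/-- The sheaf of modules `W ⊗ 𝒪(j)` on `Proj 𝒜`, i.e. the sheaf associated to the graded
`A`-module `W ⊗ A(j)`. -/
def twistSheaf (j : ℤ) : (Proj 𝒜).Modules where
  val := PresheafOfModules.ofPresheaf (twistAb 𝒜 W j) fun _ _ _ _ _ => rfl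
  isSheaf := (TopCat.Presheaf.isSheaf_iff_isSheaf_comp (forget AddCommGrpCat) _).2
    (twistInType 𝒜 W j).2

end Twist
section TwistEquivariant
variable {k g₀ A : Type u} [Field k] [LieRing g₀] [LieAlgebra k g₀] [CommRing A] [Algebra k A]
  {𝒜 : ℕ → Submodule k A} [GradedAlgebra 𝒜]
  {W : Type u} [AddCommGroup W] [Module k W] [LieRingModule g₀ W] [LieModule k g₀ W]
  {W' : Type u} [AddCommGroup W'] [Module k W'] [LieRingModule g₀ W'] [LieModule k g₀ W']
  {W'' : Type u} [AddCommGroup W''] [Module k W'']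

/-- The value in `A_p ⊗ W` of a section of `W ⊗ 𝒪(j)` at the point `p`. -/
def twVal {j : ℤ} {U : (Proj 𝒜).Opens} (s : Γ(twistSheaf 𝒜 W j, U)) (p : ProjectiveSpectrum 𝒜)
    (hp : p ∈ U) : Loc 𝒜 p ⊗[k] W := Subtype.val s ⟨p, hp⟩

theorem tw_ext {j : ℤ} {U : (Proj 𝒜).Opens} {s t : Γ(twistSheaf 𝒜 W j, U)}
    (h : ∀ p hp, twVal s p hp = twVal t p hp) : s = t :=
  Subtype.ext (funext fun p => h p.1 p.2)

theorem twVal_add {j : ℤ} {U : (Proj 𝒜).Opens} (s t : Γ(twistSheaf 𝒜 W j, U)) (p) (hp) :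
    twVal (s + t) p hp = twVal s p hp + twVal t p hp := rfl

theorem twVal_sub {j : ℤ} {U : (Proj 𝒜).Opens} (s t : Γ(twistSheaf 𝒜 W j, U)) (p) (hp) :
    twVal (s - t) p hp = twVal s p hp - twVal t p hp := rfl

theorem twVal_smul {j : ℤ} {U : (Proj 𝒜).Opens} (r : Γ(Proj 𝒜, U)) (s : Γ(twistSheaf 𝒜 W j, U))
    (p) (hp) : twVal (r • s) p hp = (secVal 𝒜 r p hp).val • twVal s p hp := rfl

/-- A morphism of sheaves of modules `W ⊗ 𝒪(j) → W' ⊗ 𝒪(j')` given by linear maps on the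
`A_p ⊗ W` that preserve fractions. -/
def twistHom {j j' : ℤ} (T : ∀ p, Loc 𝒜 p ⊗[k] W →ₗ[Loc 𝒜 p] Loc 𝒜 p ⊗[k] W')
    (hT : ∀ (U : Opens (ProjectiveSpectrum.top 𝒜)) (s : ∀ p : U, Loc 𝒜 p.1 ⊗[k] W),
      IsTwistFraction 𝒜 W j s → IsTwistFraction 𝒜 W' j' (fun p => T p.1 (s p))) :
    twistSheaf 𝒜 W j ⟶ twistSheaf 𝒜 W' j' where
  val := PresheafOfModules.homMk
    { app := fun U => AddCommGrpCat.ofHom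
        { toFun := fun s => ⟨fun p => T p.1 (s.1 p), fun p =>
            let ⟨V, hV, i, h⟩ := s.2 p
            ⟨V, hV, i, hT V _ h⟩⟩
          map_zero' := Subtype.ext (funext fun p => map_zero (T p.1))
          map_add' := fun _ _ => Subtype.ext (funext fun p => map_add (T p.1) _ _) }
      naturality := fun _ _ _ => rfl }
    (fun _ _ _ => Subtype.ext (funext fun p => map_smul (T p.1) _ _))

theorem twVal_twistHom {j j' : ℤ} (T : ∀ p, Loc 𝒜 p ⊗[k] W →ₗ[Loc 𝒜 p] Loc 𝒜 p ⊗[k] W')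
    (hT) {U : (Proj 𝒜).Opens} (s : Γ(twistSheaf 𝒜 W j, U)) (p) (hp) :
    twVal ((twistHom (j := j) (j' := j') T hT).app U s) p hp = T p (twVal s p hp) := rfl

variable (δ : g₀ →ₗ⁅k⁆ Derivation k A A) (hδ : ∀ x n, ∀ a ∈ 𝒜 n, δ x a ∈ 𝒜 n)

/-- The action of `x : g₀` on a section of `W ⊗ 𝒪(j)`. -/
def twistAct (j : ℤ) (x : g₀) (U : (Proj 𝒜).Opens) (s : Γ(twistSheaf 𝒜 W j, U)) :
    Γ(twistSheaf 𝒜 W j, U) :=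
  ⟨fun p => tensorAct (locDerivation (δ x) _) x (twVal s p.1 p.2), fun p => by
    obtain ⟨V, hV, i, l, n, a, b, h, ha, hb, e⟩ := s.2 p
    exact ⟨V, hV, i, n + l, n + n, b • tensorAct (δ x) x a - δ x b • a, b * b,
      by push_cast; omega,
      sub_mem (smul_mem_numDeg rfl hb (tensorAct_mem_numDeg _ (hδ x) x ha))
        (smul_mem_numDeg rfl (hδ x _ _ hb) ha),
      SetLike.mul_mem_graded hb hb, fun q => (e q).act (δ x) x⟩⟩

theorem twVal_twistAct (j : ℤ) (x : g₀) (U : (Proj 𝒜).Opens) (s : Γ(twistSheaf 𝒜 W j, U))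
    (p) (hp) : twVal (twistAct δ hδ j x U s) p hp =
      tensorAct (locDerivation (δ x) _) x (twVal s p hp) := rfl

theorem tensorAct_loc_csmul (c : k) (x : g₀) (p : ProjectiveSpectrum 𝒜) (z : Loc 𝒜 p ⊗[k] W) :
    tensorAct (locDerivation (δ (c • x)) p.asHomogeneousIdeal.toIdeal.primeCompl) (c • x) z =
      algebraMap k (Loc 𝒜 p) c • tensorAct (locDerivation (δ x) _) x z := by
  change tensorAct (locLieAction δ _ (c • x)) (c • x) z = _
  rw [map_smul, tensorAct_csmul]
  rfl

theorem tensorAct_loc_lie (x y : g₀) (p : ProjectiveSpectrum 𝒜) (z : Loc 𝒜 p ⊗[k] W) :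
    tensorAct (locDerivation (δ ⁅x, y⁆) p.asHomogeneousIdeal.toIdeal.primeCompl) ⁅x, y⁆ z =
      tensorAct (locDerivation (δ x) _) x (tensorAct (locDerivation (δ y) _) y z) -
        tensorAct (locDerivation (δ y) _) y (tensorAct (locDerivation (δ x) _) x z) := by
  rw [← tensorAct_lie (locDerivation (δ x) _) (locDerivation (δ y) _) x y z]
  exact congrArg (fun D => tensorAct D ⁅x, y⁆ z)
    (LieHom.map_lie (locLieAction δ p.asHomogeneousIdeal.toIdeal.primeCompl) x y)

theorem twistAct_csmul (j : ℤ) (c : k) (x : g₀) (U : (Proj 𝒜).Opens)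
    (s : Γ(twistSheaf 𝒜 W j, U)) :
    twistAct δ hδ j (c • x) U s = projScalar U c • twistAct δ hδ j x U s :=
  tw_ext fun p hp => by
    rw [twVal_smul, twVal_twistAct, twVal_twistAct, projScalar_val, tensorAct_loc_csmul]

theorem twistAct_smul (j : ℤ) (x : g₀) (U : (Proj 𝒜).Opens) (r : Γ(Proj 𝒜, U))
    (s : Γ(twistSheaf 𝒜 W j, U)) :
    twistAct δ hδ j x U (r • s) = projAct δ hδ x U r • s + r • twistAct δ hδ j x U s :=
  tw_ext fun p hp => by
    rw [twVal_add, twVal_smul, twVal_smul, twVal_twistAct, twVal_twistAct, twVal_smul, projAct_val,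
      tensorAct_smul]

variable (W) in
/-- The `g₀`-equivariant sheaf `W ⊗ 𝒪(j)` on `Proj 𝒜`, for a representation `W` of `g₀`. -/
def twist (j : ℤ) : EquivModule (projAction δ hδ) where
  sheaf := twistSheaf 𝒜 W j
  act x U := AddMonoidHom.mk' (twistAct δ hδ j x U) fun s t => tw_ext fun p hp => by
    rw [twVal_add, twVal_twistAct, twVal_twistAct, twVal_twistAct, twVal_add, map_add]
  act_res _ _ _ _ _ := Subtype.ext rfl
  act_smul x U r s := twistAct_smul δ hδ j x U r s
  add_act x y U s := tw_ext fun p hp => by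
    change tensorAct (locLieAction δ _ (x + y)) (x + y) (twVal s p hp) = _
    rw [map_add, tensorAct_add]
    rfl
  smul_act c x U s := twistAct_csmul δ hδ j c x U s
  lie_act x y U s := tw_ext fun p hp => tensorAct_loc_lie δ x y p (twVal s p hp)

section FamilyMap
variable {ι : Type*} [Fintype ι]

variable (B : Type u) [CommRing B] [Algebra k B] [Algebra A B] [IsScalarTower k A B] in
/-- The `B`-linear map `∑ᵢ cᵢ ⊗ fᵢ : B ⊗ W → B ⊗ W'` for `cᵢ` in `A` and `fᵢ : W → W'`. -/
def famMap (c : ι → A) (f : ι → W →ₗ[k] W') : B ⊗[k] W →ₗ[B] B ⊗[k] W' :=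
  ∑ i, algebraMap A B (c i) • (f i).baseChange B

section
variable (B : Type u) [CommRing B] [Algebra k B] [Algebra A B] [IsScalarTower k A B]

theorem famMap_tmul (c : ι → A) (f : ι → W →ₗ[k] W') (b : B) (w : W) :
    famMap B c f (b ⊗ₜ[k] w) = ∑ i, (algebraMap A B (c i) * b) ⊗ₜ[k] f i w := by
  simp [famMap, TensorProduct.smul_tmul', Algebra.smul_def]

end

theorem numMap_famMap (c : ι → A) (f : ι → W →ₗ[k] W') (p : ProjectiveSpectrum 𝒜)
    (z : A ⊗[k] W) :
    numMap 𝒜 W' p (famMap A c f z) = famMap (Loc 𝒜 p) c f (numMap 𝒜 W p z) := by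
  induction z with
  | zero => simp
  | add y z hy hz => simp only [map_add, hy, hz]
  | tmul a w => simp [numMap, famMap_tmul]

theorem famMap_mem_numDeg {c : ι → A} {m : ℕ} (hc : ∀ i, c i ∈ 𝒜 m) (f : ι → W →ₗ[k] W') {i : ℕ}
    {z : A ⊗[k] W} (hz : z ∈ numDeg 𝒜 W i) : famMap A c f z ∈ numDeg 𝒜 W' (m + i) := by
  induction hz using Submodule.span_induction with
  | zero => simp
  | add x y _ _ hx hy => rw [map_add]; exact add_mem hx hy
  | smul a x _ hx =>
    rw [← algebraMap_smul A a x, map_smul, algebraMap_smul]; exact Submodule.smul_mem _ _ hx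
  | mem x hx =>
    obtain ⟨a, ha, w, rfl⟩ := hx
    rw [famMap_tmul]
    exact Submodule.sum_mem _ fun l _ =>
      Submodule.subset_span ⟨_, SetLike.mul_mem_graded (hc l) ha, _, rfl⟩

theorem IsFracAt.famMap {p : ProjectiveSpectrum 𝒜} {a : A ⊗[k] W} {b : A} {y : Loc 𝒜 p ⊗[k] W}
    (h : IsFracAt 𝒜 W p a b y) (c : ι → A) (f : ι → W →ₗ[k] W') :
    IsFracAt 𝒜 W' p (famMap A c f a) b (famMap (Loc 𝒜 p) c f y) :=
  ⟨h.1, by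
    rw [numMap_famMap, ← h.2, map_smul]⟩

/-- The morphism `∑ᵢ cᵢ ⊗ fᵢ : W ⊗ 𝒪(j) → W' ⊗ 𝒪(j + m)` for `cᵢ` of degree `m`. -/
def famHom (c : ι → A) (f : ι → W →ₗ[k] W') (m : ℕ) (hc : ∀ i, c i ∈ 𝒜 m) {j j' : ℤ}
    (hj : j' = j + m) : twistSheaf 𝒜 W j ⟶ twistSheaf 𝒜 W' j' :=
  twistHom (fun p => famMap (Loc 𝒜 p) c f) fun _ _ ⟨l, n, a, b, h, ha, hb, e⟩ =>
    ⟨m + l, n, famMap A c f a, b, by push_cast; omega, famMap_mem_numDeg hc f ha, hb, fun p =>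
      (e p).famMap c f⟩

/-- `∑ᵢ cᵢ ⊗ fᵢ` commutes with the action of `g₀` if the element `∑ᵢ cᵢ ⊗ fᵢ` is invariant. -/
theorem famMap_tensorAct {c : ι → A} {f : ι → W →ₗ[k] W'} (x : g₀) (d : Derivation k A A)
    (h : ∀ w : W, ∑ i, (d (c i) ⊗ₜ[k] f i w + c i ⊗ₜ[k] ⁅x, f i w⁆) =
      ∑ i, c i ⊗ₜ[k] f i ⁅x, w⁆)
    (p : ProjectiveSpectrum 𝒜) (z : Loc 𝒜 p ⊗[k] W) :
    famMap (Loc 𝒜 p) c f (tensorAct (locDerivation d _) x z) =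
      tensorAct (locDerivation d _) x (famMap (Loc 𝒜 p) c f z) := by
  induction z with
  | zero => simp
  | add y z hy hz => simp only [map_add, hy, hz]
  | tmul b w =>
    have h' := congrArg (fun t => b • numMap 𝒜 W' p t) (h w)
    simp only [map_sum, map_add, numMap, LinearMap.rTensor_tmul, Finset.smul_sum, smul_add,
      TensorProduct.smul_tmul', smul_eq_mul, AlgHom.toLinearMap_apply,
      IsScalarTower.coe_toAlgHom'] at h'
    simp only [tensorAct_tmul, map_add, famMap_tmul, map_sum, Derivation.leibniz, smul_eq_mul,
      locDerivation_algebraMap, TensorProduct.add_tmul]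
    simp only [mul_comm _ b]
    rw [← h', ← Finset.sum_add_distrib]
    refine Finset.sum_congr rfl fun i _ => ?_
    abel

end FamilyMap
end TwistEquivariant

/-! ## Tensor products of equivariant sheaves and their global sections -/

section Tensor
variable {k g₀ : Type u} [Field k] [LieRing g₀] [LieAlgebra k g₀] {X : Scheme.{u}}
  (α : SchemeAction k g₀ X)

/-- The tensor product `M(U) ⊗ N(U)` over `𝒪_X(U)`. -/
def TensorSec (_ : SchemeAction k g₀ X) (M N : X.Modules) (U : X.Opens) : Type u :=
  Γ(M, U) ⊗[X.presheaf.obj (op U)] Γ(N, U)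

instance (M N : X.Modules) (U : X.Opens) : AddCommGroup (TensorSec α M N U) :=
  inferInstanceAs (AddCommGroup (Γ(M, U) ⊗[X.presheaf.obj (op U)] Γ(N, U)))

instance (M N : X.Modules) (U : X.Opens) : Module Γ(X, U) (TensorSec α M N U) :=
  inferInstanceAs (Module Γ(X, U) (Γ(M, U) ⊗[X.presheaf.obj (op U)] Γ(N, U)))

instance (M N : X.Modules) (U : X.Opens) : Module k (TensorSec α M N U) :=
  Module.compHom _ (α.scalar U)

namespace TensorSec
variable {α} {M N M' N' : X.Modules} {U V : X.Opens}

/-- The element `m ⊗ n`. -/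
def tmul (m : Γ(M, U)) (n : Γ(N, U)) : TensorSec α M N U := m ⊗ₜ[X.presheaf.obj (op U)] n

theorem csmul_def (c : k) (t : TensorSec α M N U) : c • t = α.scalar U c • t := rfl

theorem smul_tmul' (r : Γ(X, U)) (m : Γ(M, U)) (n : Γ(N, U)) :
    r • (tmul m n : TensorSec α M N U) = tmul (r • m) n := rfl

theorem tmul_smul (r : Γ(X, U)) (m : Γ(M, U)) (n : Γ(N, U)) :
    (tmul m (r • n) : TensorSec α M N U) = tmul (r • m) n :=
  (TensorProduct.smul_tmul r m n).symm

theorem add_tmul (m m' : Γ(M, U)) (n : Γ(N, U)) :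
    (tmul (m + m') n : TensorSec α M N U) = tmul m n + tmul m' n := TensorProduct.add_tmul _ _ _

theorem tmul_add (m : Γ(M, U)) (n n' : Γ(N, U)) :
    (tmul m (n + n') : TensorSec α M N U) = tmul m n + tmul m n' := TensorProduct.tmul_add _ _ _

theorem zero_tmul (n : Γ(N, U)) : (tmul 0 n : TensorSec α M N U) = 0 := TensorProduct.zero_tmul _ _

theorem tmul_zero (m : Γ(M, U)) : (tmul m 0 : TensorSec α M N U) = 0 := TensorProduct.tmul_zero _ _

@[elab_as_elim] theorem ind {p : TensorSec α M N U → Prop} (t : TensorSec α M N U) (zero : p 0)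
    (tmul : ∀ m n, p (tmul m n)) (add : ∀ s t, p s → p t → p (s + t)) : p t :=
  TensorProduct.induction_on t zero tmul add

/-- The additive map out of `M(U) ⊗ N(U)` given by a balanced biadditive map. -/
def lift {P : Type u} [AddCommGroup P] (f : Γ(M, U) →+ Γ(N, U) →+ P)
    (hf : ∀ (r : Γ(X, U)) m n, f (r • m) n = f m (r • n)) : TensorSec α M N U →+ P :=
  TensorProduct.liftAddHom f hf

@[simp] theorem lift_tmul {P : Type u} [AddCommGroup P] (f : Γ(M, U) →+ Γ(N, U) →+ P) (hf) (m n) :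
    lift (α := α) f hf (tmul m n) = f m n := rfl

/-- The restriction maps `m ⊗ n ↦ m|_U ⊗ n|_U`. -/
def res (i : U ⟶ V) : TensorSec α M N V →ₗ[k] TensorSec α M N U where
  toFun := lift (AddMonoidHom.mk' (fun m => AddMonoidHom.mk'
      (fun n => tmul (M.presheaf.map i.op m) (N.presheaf.map i.op n))
      fun n n' => by rw [map_add, tmul_add])
      fun m m' => by ext n; exact (congrArg (tmul · _) (map_add _ _ _)).trans (add_tmul _ _ _))
    fun r m n => by
      change tmul (M.presheaf.map i.op (r • m)) _ = tmul _ (N.presheaf.map i.op (r • n))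
      rw [Scheme.Modules.map_smul, Scheme.Modules.map_smul, tmul_smul]
  map_add' := map_add _
  map_smul' c t := by
    induction t using ind with
    | zero => simp only [smul_zero, map_zero]
    | add s t hs ht => simp only [smul_add, map_add, hs, ht]
    | tmul m n =>
      change tmul (M.presheaf.map i.op (α.scalar V c • m)) _ = tmul (α.scalar U c • _) _
      rw [Scheme.Modules.map_smul]
      exact congrArg (fun r => tmul (r • _) _) (α.scalar_res i c)

@[simp] theorem res_tmul (i : U ⟶ V) (m : Γ(M, V)) (n : Γ(N, V)) :
    res (α := α) i (tmul m n) = tmul (M.presheaf.map i.op m) (N.presheaf.map i.op n) := rfl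

theorem linearMap_ext {P : Type u} [AddCommGroup P] [Module k P] {f g : TensorSec α M N U →ₗ[k] P}
    (h : ∀ m n, f (tmul m n) = g (tmul m n)) : f = g := by
  ext t
  induction t using ind with
  | zero => simp
  | add s t hs ht => simp [hs, ht]
  | tmul m n => exact h m n

/-- The map `m ⊗ n ↦ f m ⊗ g n`. -/
def map (f : M ⟶ M') (g : N ⟶ N') (U : X.Opens) : TensorSec α M N U →ₗ[k] TensorSec α M' N' U where
  toFun := lift (AddMonoidHom.mk' (fun m => AddMonoidHom.mk'
      (fun n => tmul (f.app U m) (g.app U n))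
      fun n n' => by rw [map_add, tmul_add])
      fun m m' => by ext n; exact (congrArg (tmul · _) (map_add _ _ _)).trans (add_tmul _ _ _))
    fun r m n => by
      change tmul (f.app U (r • m)) _ = tmul _ (g.app U (r • n))
      rw [Scheme.Modules.Hom.app_smul, Scheme.Modules.Hom.app_smul, tmul_smul]
  map_add' := map_add _
  map_smul' c t := by
    induction t using ind with
    | zero => simp only [smul_zero, map_zero]
    | add s t hs ht => simp only [smul_add, map_add, hs, ht]
    | tmul m n =>
      change tmul (f.app U (α.scalar U c • m)) _ = tmul (α.scalar U c • _) _
      rw [Scheme.Modules.Hom.app_smul]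

@[simp] theorem map_tmul (f : M ⟶ M') (g : N ⟶ N') (m : Γ(M, U)) (n : Γ(N, U)) :
    map (α := α) f g U (tmul m n) = tmul (f.app U m) (g.app U n) := rfl

/-- The action `m ⊗ n ↦ x m ⊗ n + m ⊗ x n` of `x : g₀`. -/
def act (F G : EquivModule α) (x : g₀) (U : X.Opens) :
    TensorSec α F.sheaf G.sheaf U →ₗ[k] TensorSec α F.sheaf G.sheaf U where
  toFun := lift (AddMonoidHom.mk' (fun m => AddMonoidHom.mk'
      (fun n => tmul (F.act x U m) n + tmul m (G.act x U n))
      fun n n' => by rw [map_add, tmul_add, tmul_add]; abel)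
      fun m m' => by
        ext n
        change tmul (F.act x U (m + m')) n + tmul (m + m') (G.act x U n) =
          (tmul (F.act x U m) n + tmul m (G.act x U n)) +
            (tmul (F.act x U m') n + tmul m' (G.act x U n))
        rw [map_add, add_tmul, add_tmul]; abel)
    fun r m n => by
      change tmul (F.act x U (r • m)) n + tmul (r • m) (G.act x U n) =
        tmul (F.act x U m) (r • n) + tmul m (G.act x U (r • n))
      rw [F.act_smul, G.act_smul, tmul_add, add_tmul, tmul_smul, tmul_smul, tmul_smul]
      abel
  map_add' := map_add _
  map_smul' c t := by
    induction t using ind with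
    | zero => simp only [smul_zero, map_zero]
    | add s t hs ht => simp only [smul_add, map_add, hs, ht]
    | tmul m n =>
      change tmul (F.act x U (α.scalar U c • m)) n + tmul (α.scalar U c • m) (G.act x U n) =
        α.scalar U c • (tmul (F.act x U m) n + tmul m (G.act x U n))
      rw [F.act_smul, α.act_scalar, zero_smul, zero_add, smul_add, smul_tmul', smul_tmul']

@[simp] theorem act_tmul (F G : EquivModule α) (x : g₀) (m : Γ(F.sheaf, U)) (n : Γ(G.sheaf, U)) :
    act F G x U (tmul m n) = tmul (F.act x U m) n + tmul m (G.act x U n) := rfl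

end TensorSec

/-- The presheaf `U ↦ M(U) ⊗ N(U)`. -/
def tensorPresheaf (M N : X.Modules) : X.Opensᵒᵖ ⥤ ModuleCat.{u} k where
  obj U := ModuleCat.of k (TensorSec α M N U.unop)
  map i := ModuleCat.ofHom (TensorSec.res i.unop)
  map_id U := ModuleCat.hom_ext (TensorSec.linearMap_ext fun m n => by
    change TensorSec.tmul (α := α) (M.presheaf.map (𝟙 U) m) (N.presheaf.map (𝟙 U) n) = TensorSec.tmul (α := α) m n
    simp)
  map_comp i j := ModuleCat.hom_ext (TensorSec.linearMap_ext fun m n => by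
    change TensorSec.tmul (α := α) (M.presheaf.map (i ≫ j) m) (N.presheaf.map (i ≫ j) n) =
      TensorSec.tmul (α := α) (M.presheaf.map j (M.presheaf.map i m))
        (N.presheaf.map j (N.presheaf.map i n))
    simp)

variable {M N M' N' M'' N'' : X.Modules}

/-- The functoriality of `U ↦ M(U) ⊗ N(U)`. -/
def tensorPresheafMap (f : M ⟶ M') (g : N ⟶ N') : tensorPresheaf α M N ⟶ tensorPresheaf α M' N' where
  app U := ModuleCat.ofHom (TensorSec.map f g U.unop)
  naturality U V i := ModuleCat.hom_ext (TensorSec.linearMap_ext fun m n => by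
    change TensorSec.tmul (α := α) (f.app V.unop (M.presheaf.map i m)) (g.app V.unop (N.presheaf.map i n)) =
      TensorSec.tmul (α := α) (M'.presheaf.map i (f.app U.unop m)) (N'.presheaf.map i (g.app U.unop n))
    congr 1
    · exact congrArg (fun t => t.hom m) (f.mapPresheaf.naturality i)
    · exact congrArg (fun t => t.hom n) (g.mapPresheaf.naturality i))

theorem tensorPresheaf_hom_ext {P : X.Opensᵒᵖ ⥤ ModuleCat.{u} k} {f g : tensorPresheaf α M N ⟶ P}
    (h : ∀ U m n, (f.app (op U)).hom (TensorSec.tmul (α := α) m n) =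
      (g.app (op U)).hom (TensorSec.tmul (α := α) m n)) : f = g := by
  ext U : 2
  exact ModuleCat.hom_ext (TensorSec.linearMap_ext (h U.unop))

theorem tensorPresheafMap_id : tensorPresheafMap α (𝟙 M) (𝟙 N) = 𝟙 _ :=
  tensorPresheaf_hom_ext α fun _ _ _ => rfl

theorem tensorPresheafMap_comp (f : M ⟶ M') (g : N ⟶ N') (f' : M' ⟶ M'') (g' : N' ⟶ N'') :
    tensorPresheafMap α (f ≫ f') (g ≫ g') = tensorPresheafMap α f g ≫ tensorPresheafMap α f' g' :=
  tensorPresheaf_hom_ext α fun _ _ _ => rfl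

variable {α}

/-- The action of `x : g₀` on the presheaf `U ↦ F(U) ⊗ G(U)`. -/
def tensorPresheafAct (F G : EquivModule α) (x : g₀) :
    tensorPresheaf α F.sheaf G.sheaf ⟶ tensorPresheaf α F.sheaf G.sheaf where
  app U := ModuleCat.ofHom (TensorSec.act F G x U.unop)
  naturality U V i := ModuleCat.hom_ext (TensorSec.linearMap_ext fun m n => by
    change TensorSec.act F G x V.unop (TensorSec.res i.unop (TensorSec.tmul m n)) =
      TensorSec.res i.unop (TensorSec.act F G x U.unop (TensorSec.tmul m n))
    simp only [TensorSec.act_tmul, TensorSec.res_tmul, map_add, F.act_res, G.act_res])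

/-- The global sections of `M ⊗ N`, the sheaf associated to `U ↦ M(U) ⊗ N(U)`. -/
def TensorΓ (α : SchemeAction k g₀ X) (M N : X.Modules) : Type u :=
  ((sheafify (Opens.grothendieckTopology X) (tensorPresheaf α M N)).obj (op ⊤) : ModuleCat.{u} k)

instance (M N : X.Modules) : AddCommGroup (TensorΓ α M N) :=
  inferInstanceAs (AddCommGroup
    ((sheafify (Opens.grothendieckTopology X) (tensorPresheaf α M N)).obj (op ⊤) : ModuleCat.{u} k))

instance (M N : X.Modules) : Module k (TensorΓ α M N) :=
  inferInstanceAs (Module k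
    ((sheafify (Opens.grothendieckTopology X) (tensorPresheaf α M N)).obj (op ⊤) : ModuleCat.{u} k))

/-- The map on global sections of the associated sheaves given by a map of presheaves. -/
def sheafifyΓ (η : tensorPresheaf α M N ⟶ tensorPresheaf α M' N') :
    TensorΓ α M N →ₗ[k] TensorΓ α M' N' :=
  ((sheafifyMap (Opens.grothendieckTopology X) η).app (op ⊤)).hom

theorem sheafifyΓ_id : sheafifyΓ (𝟙 (tensorPresheaf α M N)) = LinearMap.id := by
  unfold sheafifyΓ
  rw [sheafifyMap_id]
  rfl

theorem sheafifyΓ_comp (η : tensorPresheaf α M N ⟶ tensorPresheaf α M' N')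
    (θ : tensorPresheaf α M' N' ⟶ tensorPresheaf α M'' N'') :
    sheafifyΓ (η ≫ θ) = sheafifyΓ θ ∘ₗ sheafifyΓ η := by
  unfold sheafifyΓ
  rw [sheafifyMap_comp]
  rfl

theorem sheafifyΓ_add (η θ : tensorPresheaf α M N ⟶ tensorPresheaf α M' N') :
    sheafifyΓ (η + θ) = sheafifyΓ η + sheafifyΓ θ := by
  have : sheafifyMap (Opens.grothendieckTopology X) (η + θ) =
      sheafifyMap (Opens.grothendieckTopology X) η +
        sheafifyMap (Opens.grothendieckTopology X) θ := by
    apply sheafify_hom_ext _ _ _ ((presheafToSheaf _ _).obj _).property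
    rw [Preadditive.comp_add, ← toSheafify_naturality, ← toSheafify_naturality,
      ← toSheafify_naturality, Preadditive.add_comp]
  unfold sheafifyΓ
  rw [this]
  rfl

theorem sheafifyΓ_smul (c : k) (η : tensorPresheaf α M N ⟶ tensorPresheaf α M' N') :
    sheafifyΓ (c • η) = c • sheafifyΓ η := by
  have : sheafifyMap (Opens.grothendieckTopology X) (c • η) =
      c • sheafifyMap (Opens.grothendieckTopology X) η := by
    apply sheafify_hom_ext _ _ _ ((presheafToSheaf _ _).obj _).property
    rw [Linear.comp_smul, ← toSheafify_naturality, ← toSheafify_naturality, Linear.smul_comp]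
  unfold sheafifyΓ
  rw [this]
  rfl

/-- The functoriality of the global sections of `M ⊗ N`. -/
def TensorΓ.map (f : M ⟶ M') (g : N ⟶ N') : TensorΓ α M N →ₗ[k] TensorΓ α M' N' :=
  sheafifyΓ (tensorPresheafMap α f g)

theorem TensorΓ.map_id : TensorΓ.map (α := α) (𝟙 M) (𝟙 N) = LinearMap.id := by
  rw [TensorΓ.map, tensorPresheafMap_id, sheafifyΓ_id]

theorem TensorΓ.map_comp (f : M ⟶ M') (g : N ⟶ N') (f' : M' ⟶ M'') (g' : N' ⟶ N'') :
    TensorΓ.map (α := α) (f ≫ f') (g ≫ g') = TensorΓ.map f' g' ∘ₗ TensorΓ.map f g := by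
  rw [TensorΓ.map, tensorPresheafMap_comp, sheafifyΓ_comp]; rfl

variable (F G : EquivModule α)

/-- The representation of `g₀` on the global sections of `F ⊗ G`. -/
instance TensorΓ.lieRingModule : LieRingModule g₀ (TensorΓ α F.sheaf G.sheaf) where
  bracket x s := sheafifyΓ (tensorPresheafAct F G x) s
  add_lie x y s := by
    change sheafifyΓ (tensorPresheafAct F G (x + y)) s =
      sheafifyΓ (tensorPresheafAct F G x) s + sheafifyΓ (tensorPresheafAct F G y) s
    rw [← LinearMap.add_apply, ← sheafifyΓ_add]
    congr 2
    refine tensorPresheaf_hom_ext α fun U m n => ?_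
    change TensorSec.act F G (x + y) U _ = TensorSec.act F G x U _ + TensorSec.act F G y U _
    simp only [TensorSec.act_tmul, F.add_act, G.add_act, TensorSec.add_tmul, TensorSec.tmul_add]
    abel
  lie_add x s t := map_add _ s t
  leibniz_lie x y s := by
    change sheafifyΓ (tensorPresheafAct F G x) (sheafifyΓ (tensorPresheafAct F G y) s) =
      sheafifyΓ (tensorPresheafAct F G ⁅x, y⁆) s +
      sheafifyΓ (tensorPresheafAct F G y) (sheafifyΓ (tensorPresheafAct F G x) s)
    rw [← LinearMap.comp_apply, ← LinearMap.comp_apply, ← sheafifyΓ_comp, ← sheafifyΓ_comp,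
      ← LinearMap.add_apply, ← sheafifyΓ_add]
    congr 2
    refine tensorPresheaf_hom_ext α fun U m n => ?_
    change TensorSec.act F G x U (TensorSec.act F G y U (TensorSec.tmul m n)) =
      TensorSec.act F G ⁅x, y⁆ U (TensorSec.tmul m n) +
        TensorSec.act F G y U (TensorSec.act F G x U (TensorSec.tmul m n))
    simp only [TensorSec.act_tmul, map_add, F.lie_act, G.lie_act, sub_eq_add_neg,
      TensorSec.add_tmul, TensorSec.tmul_add]
    have e1 : (TensorSec.tmul (-(F.act y U (F.act x U m))) n : TensorSec α _ _ U) =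
        -TensorSec.tmul (F.act y U (F.act x U m)) n := TensorProduct.neg_tmul _ _
    have e2 : (TensorSec.tmul m (-(G.act y U (G.act x U n))) : TensorSec α _ _ U) =
        -TensorSec.tmul m (G.act y U (G.act x U n)) := TensorProduct.tmul_neg _ _
    rw [e1, e2]
    abel

theorem TensorΓ.lie_def (x : g₀) (s : TensorΓ α F.sheaf G.sheaf) :
    ⁅x, s⁆ = sheafifyΓ (tensorPresheafAct F G x) s := rfl

instance TensorΓ.lieModule : LieModule k g₀ (TensorΓ α F.sheaf G.sheaf) where
  smul_lie c x s := by
    rw [TensorΓ.lie_def, TensorΓ.lie_def, ← LinearMap.smul_apply, ← sheafifyΓ_smul]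
    congr 2
    refine tensorPresheaf_hom_ext α fun U m n => ?_
    change TensorSec.act F G (c • x) U (TensorSec.tmul m n) = c • TensorSec.act F G x U (TensorSec.tmul m n)
    rw [TensorSec.csmul_def]
    simp only [TensorSec.act_tmul, F.smul_act, G.smul_act, TensorSec.tmul_smul, smul_add,
      TensorSec.smul_tmul']
  lie_smul c x s := map_smul _ c s

variable {F G} {F' G' : EquivModule α}

theorem TensorΓ.map_lie (f : F ⟶ F') (g : G ⟶ G') (x : g₀) (s : TensorΓ α F.sheaf G.sheaf) :
    TensorΓ.map (EquivModule.Hom.hom f) (EquivModule.Hom.hom g) ⁅x, s⁆ =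
      ⁅x, TensorΓ.map (EquivModule.Hom.hom f) (EquivModule.Hom.hom g) s⁆ := by
  rw [TensorΓ.lie_def, TensorΓ.lie_def, TensorΓ.map, ← LinearMap.comp_apply,
    ← LinearMap.comp_apply, ← sheafifyΓ_comp, ← sheafifyΓ_comp]
  congr 2
  refine tensorPresheaf_hom_ext α fun U m n => ?_
  change TensorSec.map _ _ U (TensorSec.act F G x U (TensorSec.tmul m n)) =
    TensorSec.act F' G' x U (TensorSec.map _ _ U (TensorSec.tmul m n))
  simp only [TensorSec.act_tmul, TensorSec.map_tmul, _root_.map_add, EquivModule.Hom.comm]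

end Tensor

/-! ## Twisting by `𝒪(n)` and multiplication by linear forms -/

section TwistΓ
variable {k g₀ A : Type u} [Field k] [LieRing g₀] [LieAlgebra k g₀] [CommRing A] [Algebra k A]
  {𝒜 : ℕ → Submodule k A} [GradedAlgebra 𝒜]
  (δ : g₀ →ₗ⁅k⁆ Derivation k A A) (hδ : ∀ x n, ∀ a ∈ 𝒜 n, δ x a ∈ 𝒜 n)

/-- The equivariant line bundle `𝒪(n)`. -/
abbrev lineBundle (n : ℤ) : EquivModule (projAction δ hδ) :=
  twist (TrivialLieModule k g₀ k) δ hδ n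

variable {δ hδ}

/-- The representation `Γ(F(n))` of `g₀`, where `F(n) = F ⊗ 𝒪(n)`. -/
abbrev TwistΓ (F : EquivModule (projAction δ hδ)) (n : ℤ) : Type u :=
  TensorΓ (projAction δ hδ) F.sheaf (lineBundle δ hδ n).sheaf

/-- The map `Γ(F(n)) → Γ(G(n))` induced by a morphism `F → G`. -/
def TwistΓ.map {F G : EquivModule (projAction δ hδ)} (f : F ⟶ G) (n : ℤ) :
    TwistΓ F n →ₗ[k] TwistΓ G n :=
  TensorΓ.map (EquivModule.Hom.hom f) (𝟙 _)

theorem TwistΓ.map_id (F : EquivModule (projAction δ hδ)) (n : ℤ) :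
    TwistΓ.map (𝟙 F) n = LinearMap.id := TensorΓ.map_id

theorem TwistΓ.map_comp {F G H : EquivModule (projAction δ hδ)} (f : F ⟶ G) (g : G ⟶ H) (n : ℤ) :
    TwistΓ.map (f ≫ g) n = TwistΓ.map g n ∘ₗ TwistΓ.map f n := by
  rw [TwistΓ.map, TwistΓ.map, TwistΓ.map, ← TensorΓ.map_comp, Category.comp_id]; rfl

theorem TwistΓ.map_lie {F G : EquivModule (projAction δ hδ)} (f : F ⟶ G) (n : ℤ) (x : g₀)
    (s : TwistΓ F n) : TwistΓ.map f n ⁅x, s⁆ = ⁅x, TwistΓ.map f n s⁆ :=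
  TensorΓ.map_lie f (𝟙 (lineBundle δ hδ n)) x s

variable (g₀) in
/-- Multiplication by `a ∈ 𝒜₁` as a morphism `𝒪(n) → 𝒪(n + 1)`. -/
def mulTwistHom (a : 𝒜 1) {n n' : ℤ} (hn : n' = n + 1) :
    twistSheaf 𝒜 (TrivialLieModule k g₀ k) n ⟶ twistSheaf 𝒜 (TrivialLieModule k g₀ k) n' :=
  famHom (fun _ : PUnit.{u + 1} => (a : A)) (fun _ => LinearMap.id) 1 (fun _ => a.2) hn

theorem twVal_mulTwistHom (a : 𝒜 1) {n n' : ℤ} (hn : n' = n + 1) {U : (Proj 𝒜).Opens}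
    (s : Γ(twistSheaf 𝒜 (TrivialLieModule k g₀ k) n, U)) (p) (hp) :
    twVal ((mulTwistHom g₀ a hn).app U s) p hp =
      algebraMap A (Loc 𝒜 p) a • twVal s p hp := by
  change famMap (Loc 𝒜 p) (fun _ : PUnit.{u + 1} => (a : A)) (fun _ => LinearMap.id)
    (twVal s p hp) = _
  simp [famMap]

theorem mulTwistHom_add (a b : 𝒜 1) {n n' : ℤ} (hn : n' = n + 1) {U : (Proj 𝒜).Opens}
    (s : Γ(twistSheaf 𝒜 (TrivialLieModule k g₀ k) n, U)) :
    (mulTwistHom g₀ (a + b) hn).app U s =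
      (mulTwistHom g₀ a hn).app U s + (mulTwistHom g₀ b hn).app U s :=
  tw_ext fun p hp => by
    rw [twVal_add, twVal_mulTwistHom, twVal_mulTwistHom, twVal_mulTwistHom, Submodule.coe_add, map_add, add_smul]

theorem mulTwistHom_smul (c : k) (a : 𝒜 1) {n n' : ℤ} (hn : n' = n + 1) {U : (Proj 𝒜).Opens}
    (s : Γ(twistSheaf 𝒜 (TrivialLieModule k g₀ k) n, U)) :
    (mulTwistHom g₀ (c • a) hn).app U s = projScalar U c • (mulTwistHom g₀ a hn).app U s :=
  tw_ext fun p hp => by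
    rw [twVal_smul, twVal_mulTwistHom, twVal_mulTwistHom, projScalar_val, Submodule.coe_smul, smul_smul,
      Algebra.smul_def, map_mul, ← IsScalarTower.algebraMap_apply k A (Loc 𝒜 p)]

variable (δ hδ) in
/-- Multiplication by `a ∈ 𝒜₁` as a morphism between the line bundles `𝒪(n)` and `𝒪(n + 1)`. -/
def mulHom (a : 𝒜 1) {n n' : ℤ} (hn : n' = n + 1) :
    (lineBundle δ hδ n).sheaf ⟶ (lineBundle δ hδ n').sheaf := mulTwistHom g₀ a hn

theorem mulHom_add (a b : 𝒜 1) {n n' : ℤ} (hn : n' = n + 1) {U : (Proj 𝒜).Opens}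
    (s : Γ((lineBundle δ hδ n).sheaf, U)) :
    (mulHom δ hδ (a + b) hn).app U s =
      (mulHom δ hδ a hn).app U s + (mulHom δ hδ b hn).app U s := mulTwistHom_add a b hn s

theorem mulHom_smul (c : k) (a : 𝒜 1) {n n' : ℤ} (hn : n' = n + 1) {U : (Proj 𝒜).Opens}
    (s : Γ((lineBundle δ hδ n).sheaf, U)) :
    (mulHom δ hδ (c • a) hn).app U s = projScalar U c • (mulHom δ hδ a hn).app U s :=
  mulTwistHom_smul c a hn s

/-- The map `Γ(F(n)) → Γ(F(n + 1))` given by multiplication by `a ∈ 𝒜₁`, linearly in `a`. -/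
def TwistΓ.mul (F : EquivModule (projAction δ hδ)) {n n' : ℤ} (hn : n' = n + 1) :
    𝒜 1 →ₗ[k] TwistΓ F n →ₗ[k] TwistΓ F n' where
  toFun a := TensorΓ.map (𝟙 _) (mulHom δ hδ a hn)
  map_add' a b := by
    rw [TensorΓ.map, TensorΓ.map, TensorΓ.map, ← sheafifyΓ_add]
    congr 1
    refine tensorPresheaf_hom_ext _ fun U m s => ?_
    change TensorSec.tmul m ((mulHom δ hδ (a + b) hn).app U s) =
      TensorSec.tmul (α := projAction δ hδ) m ((mulHom δ hδ a hn).app U s) +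
        TensorSec.tmul m ((mulHom δ hδ b hn).app U s)
    rw [mulHom_add, TensorSec.tmul_add]
  map_smul' c a := by
    rw [RingHom.id_apply, TensorΓ.map, TensorΓ.map, ← sheafifyΓ_smul]
    congr 1
    refine tensorPresheaf_hom_ext _ fun U m s => ?_
    change TensorSec.tmul m ((mulHom δ hδ (c • a) hn).app U s) =
      c • TensorSec.tmul (α := projAction δ hδ) m ((mulHom δ hδ a hn).app U s)
    rw [mulHom_smul, TensorSec.tmul_smul]
    rfl

theorem TwistΓ.mul_map {F G : EquivModule (projAction δ hδ)} (f : F ⟶ G) {n n' : ℤ}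
    (hn : n' = n + 1) (a : 𝒜 1) (s : TwistΓ F n) :
    TwistΓ.map f n' (TwistΓ.mul F hn a s) = TwistΓ.mul G hn a (TwistΓ.map f n s) := by
  change TensorΓ.map _ _ (TensorΓ.map _ _ s) = TensorΓ.map _ _ (TensorΓ.map _ _ s)
  rw [← LinearMap.comp_apply, ← LinearMap.comp_apply, ← TensorΓ.map_comp, ← TensorΓ.map_comp]
  simp only [Category.comp_id, Category.id_comp]

end TwistΓ

/-! ## Lie superalgebras and graded modules -/

section Super
variable (k g₀ g₁ : Type u) [Field k] [LieRing g₀] [LieAlgebra k g₀] [AddCommGroup g₁] [Module k g₁]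
  [LieRingModule g₀ g₁] [LieModule k g₀ g₁]

/-- The structure of a Lie superalgebra on `g₀ ⊕ g₁`, for a Lie algebra `g₀` and a `g₀`-module
`g₁`: the bracket of odd elements. -/
structure LieSuperalgebra where
  oddBracket : g₁ →ₗ[k] g₁ →ₗ[k] g₀
  symm (a b : g₁) : oddBracket a b = oddBracket b a
  lie_oddBracket (x : g₀) (a b : g₁) :
    ⁅x, oddBracket a b⁆ = oddBracket ⁅x, a⁆ b + oddBracket a ⁅x, b⁆
  jacobi (a b c : g₁) : ⁅oddBracket a b, c⁆ + ⁅oddBracket b c, a⁆ + ⁅oddBracket c a, b⁆ = 0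

variable {k g₀ g₁}

/-- A `ℤ`-graded module `V = ⨁ Vʲ` over a Lie superalgebra, with even elements acting in degree `0`
and odd elements acting in degree `1`. -/
structure GrMod (S : LieSuperalgebra k g₀ g₁) where
  piece : ℤ → Type u
  [addCommGroup : ∀ j, AddCommGroup (piece j)]
  [module : ∀ j, Module k (piece j)]
  [lieRingModule : ∀ j, LieRingModule g₀ (piece j)]
  [lieModule : ∀ j, LieModule k g₀ (piece j)]
  odd (j : ℤ) : g₁ →ₗ[k] piece j →ₗ[k] piece (j + 1)
  lie_odd (j : ℤ) (x : g₀) (y : g₁) (v : piece j) :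
    odd j ⁅x, y⁆ v = ⁅x, odd j y v⁆ - odd j y ⁅x, v⁆
  oddBracket_lie (j : ℤ) (a b : g₁) (v : piece j) :
    DirectSum.of piece j ⁅S.oddBracket a b, v⁆ =
      DirectSum.of piece (j + 1 + 1) (odd (j + 1) a (odd j b v) + odd (j + 1) b (odd j a v))

namespace GrMod
attribute [instance] addCommGroup module lieRingModule lieModule
variable {S : LieSuperalgebra k g₀ g₁}

/-- Morphisms of graded modules: linear maps of degree `0` commuting with the even and the odd
elements. -/
@[ext] structure Hom (V W : GrMod S) where
  map (j : ℤ) : V.piece j →ₗ[k] W.piece j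
  map_lie (j : ℤ) (x : g₀) (v : V.piece j) : map j ⁅x, v⁆ = ⁅x, map j v⁆
  map_odd (j : ℤ) (y : g₁) (v : V.piece j) : map (j + 1) (V.odd j y v) = W.odd j y (map j v)

instance : Category (GrMod S) where
  Hom := Hom
  id V := ⟨fun _ => LinearMap.id, fun _ _ _ => rfl, fun _ _ _ => rfl⟩
  comp f g := ⟨fun j => g.map j ∘ₗ f.map j,
    fun j x v => by simp only [LinearMap.comp_apply, f.map_lie, g.map_lie],
    fun j y v => by simp only [LinearMap.comp_apply, f.map_odd, g.map_odd]⟩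

@[ext] theorem hom_ext {V W : GrMod S} {f g : V ⟶ W} (h : ∀ j, Hom.map f j = Hom.map g j) : f = g :=
  Hom.ext (funext h)

@[simp] theorem comp_map {V W K : GrMod S} (f : V ⟶ W) (g : W ⟶ K) (j : ℤ) :
    Hom.map (f ≫ g) j = Hom.map g j ∘ₗ Hom.map f j := rfl
@[simp] theorem id_map (V : GrMod S) (j : ℤ) : Hom.map (𝟙 V) j = LinearMap.id := rfl

/-- The graded module `V` is finite-dimensional. -/
def IsFiniteDimensional (V : GrMod S) : Prop := Module.Finite k (⨁ j, V.piece j)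

theorem odd_odd (V : GrMod S) (j : ℤ) (a b : g₁) (v : V.piece j) :
    V.odd (j + 1) a (V.odd j b v) + V.odd (j + 1) b (V.odd j a v) = 0 := by
  have h := congrArg (fun t => t (j + 1 + 1)) (V.oddBracket_lie j a b v)
  simp only [DirectSum.of_eq_same] at h
  rw [← h]
  exact DirectSum.of_eq_of_ne _ _ _ (by omega)

end GrMod
end Super

/-! ## The complex attached to a graded module -/

section EquivariantFamily
variable {k g₀ A : Type u} [Field k] [LieRing g₀] [LieAlgebra k g₀] [CommRing A] [Algebra k A]
  {𝒜 : ℕ → Submodule k A} [GradedAlgebra 𝒜]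
  {W : Type u} [AddCommGroup W] [Module k W] [LieRingModule g₀ W] [LieModule k g₀ W]
  {W' : Type u} [AddCommGroup W'] [Module k W'] [LieRingModule g₀ W'] [LieModule k g₀ W']
  (δ : g₀ →ₗ⁅k⁆ Derivation k A A) (hδ : ∀ x n, ∀ a ∈ 𝒜 n, δ x a ∈ 𝒜 n)
  {ι : Type*} [Fintype ι]

/-- The morphism `∑ᵢ cᵢ ⊗ fᵢ : W ⊗ 𝒪(j) → W' ⊗ 𝒪(j + m)` of equivariant sheaves, when
`∑ᵢ cᵢ ⊗ fᵢ` is invariant. -/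
def famEquivHom (c : ι → A) (f : ι → W →ₗ[k] W') (m : ℕ) (hc : ∀ i, c i ∈ 𝒜 m) {j j' : ℤ}
    (hj : j' = j + m)
    (h : ∀ (x : g₀) (w : W), ∑ i, (δ x (c i) ⊗ₜ[k] f i w + c i ⊗ₜ[k] ⁅x, f i w⁆) =
      ∑ i, c i ⊗ₜ[k] f i ⁅x, w⁆) : twist W δ hδ j ⟶ twist W' δ hδ j' :=
  EquivModule.Hom.mk (M := twist W δ hδ j) (N := twist W' δ hδ j') (famHom c f m hc hj)
    fun x U s => tw_ext fun p hp => famMap_tensorAct x (δ x) (h x) p (twVal s p hp)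

theorem twVal_famHom {c : ι → A} {f : ι → W →ₗ[k] W'} {m : ℕ} {hc : ∀ i, c i ∈ 𝒜 m} {j j' : ℤ}
    {hj : j' = j + m} {U : (Proj 𝒜).Opens} (s : Γ(twistSheaf 𝒜 W j, U)) (p) (hp) :
    twVal ((famHom c f m hc hj).app U s) p hp = famMap (Loc 𝒜 p) c f (twVal s p hp) := rfl

theorem twist_hom_ext {j j' : ℤ} {φ ψ : twist W δ hδ j ⟶ twist W' δ hδ j'}
    (h : ∀ (U : (Proj 𝒜).Opens) (s : Γ(twistSheaf 𝒜 W j, U)) p hp,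
      twVal (W := W') (j := j') ((EquivModule.Hom.hom φ).app U s) p hp =
      twVal (W := W') (j := j') ((EquivModule.Hom.hom ψ).app U s) p hp) : φ = ψ := by
  refine EquivModule.hom_ext (Scheme.Modules.hom_ext _ _ fun U => ?_)
  ext s
  exact tw_ext (h U s)

end EquivariantFamily

section ComplexOfModule
variable (k g₀ g₁ : Type u) [Field k] [LieRing g₀] [LieAlgebra k g₀] [AddCommGroup g₁] [Module k g₁]
  [LieRingModule g₀ g₁] [LieModule k g₀ g₁]

/-- The projective space `X = 𝒫(g₁)` of lines in `g₁`, the `Proj` of the symmetric algebra of the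
dual of `g₁`. -/
abbrev ProjSpace : Scheme.{u} := Proj (symDeg k (Module.Dual k g₁))

variable {k g₀ g₁} in
theorem symLieAction_mem (x : g₀) (n : ℕ) (a) (ha : a ∈ symDeg k (Module.Dual k g₁) n) :
    symLieAction (k := k) (M := Module.Dual k g₁) g₀ x a ∈ symDeg k (Module.Dual k g₁) n :=
  symDerivation_mem _ n ha

/-- The action of `g₀` on `𝒫(g₁)` induced by the representation of `g₀` on the dual of `g₁`. -/
abbrev projSpaceAction : SchemeAction k g₀ (ProjSpace k g₁) :=
  projAction (symLieAction (k := k) (M := Module.Dual k g₁) g₀) symLieAction_mem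

/-- The category of `g₀`-equivariant sheaves of modules on `X = 𝒫(g₁)`. -/
abbrev GSheaf := EquivModule (projSpaceAction k g₀ g₁)

/-- The equivariant sheaf `W ⊗ 𝒪_X(j)` on `X = 𝒫(g₁)`. -/
abbrev projTwist (W : Type u) [AddCommGroup W] [Module k W] [LieRingModule g₀ W] [LieModule k g₀ W]
    (j : ℤ) : GSheaf k g₀ g₁ :=
  twist W (symLieAction (k := k) (M := Module.Dual k g₁) g₀) symLieAction_mem j

variable {k g₀ g₁}

/-- The coevaluation element of `g₁* ⊗ g₁` is invariant. -/
theorem coev_invariant [Module.Finite k g₁] {P : Type*} [AddCommGroup P] [Module k P]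
    (Φ : Module.Dual k g₁ →ₗ[k] g₁ →ₗ[k] P) (x : g₀) :
    ∑ i, (Φ ⁅x, (Module.finBasis k g₁).coord i⁆ (Module.finBasis k g₁ i) +
      Φ ((Module.finBasis k g₁).coord i) ⁅x, Module.finBasis k g₁ i⁆) = 0 := by
  set b := Module.finBasis k g₁
  have h1 (i) : ⁅x, b.coord i⁆ = -∑ l, b.coord i ⁅x, b l⁆ • b.coord l := by
    refine b.ext fun l => ?_
    simp [Finsupp.single_apply]
  have h2 (i) : ⁅x, b i⁆ = ∑ l, b.coord l ⁅x, b i⁆ • b l := by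
    simp [b.sum_repr]
  have h3 (i) : Φ (b.coord i) ⁅x, b i⁆ = ∑ l, b.coord l ⁅x, b i⁆ • Φ (b.coord i) (b l) := by
    conv_lhs => rw [h2 i]
    simp only [map_sum, map_smul]
  rw [Finset.sum_add_distrib]
  simp only [h1, h3, map_neg, map_sum, map_smul, LinearMap.neg_apply, LinearMap.sum_apply,
    LinearMap.smul_apply, Finset.sum_neg_distrib]
  rw [Finset.sum_comm, neg_add_cancel]

theorem ι_mem_symDeg (f : Module.Dual k g₁) :
    SymmetricAlgebra.ι k _ f ∈ symDeg k (Module.Dual k g₁) 1 := by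
  simpa only [symDeg, pow_one] using LinearMap.mem_range_self _ f

variable {S : LieSuperalgebra k g₀ g₁} [Module.Finite k g₁]

/-- The coordinates `eᵢ*` on `g₁` as elements of degree `1` of the symmetric algebra. -/
def coordForm (i : Fin (Module.finrank k g₁)) : SymmetricAlgebra k (Module.Dual k g₁) :=
  SymmetricAlgebra.ι k _ ((Module.finBasis k g₁).coord i)

/-- The differential `v ⊗ f ↦ ∑ᵢ eᵢ v ⊗ eᵢ* f` from `Vʲ ⊗ 𝒪(j)` to `Vʲ⁺¹ ⊗ 𝒪(j + 1)`. -/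
def complexD (V : GrMod S) (j : ℤ) :
    projTwist k g₀ g₁ (V.piece j) j ⟶ projTwist k g₀ g₁ (V.piece (j + 1)) (j + 1) :=
  famEquivHom (symLieAction (k := k) (M := Module.Dual k g₁) g₀) symLieAction_mem
    (coordForm (k := k) (g₁ := g₁)) (fun i => V.odd j (Module.finBasis k g₁ i)) 1
    (fun i => ι_mem_symDeg _) (by simp) (fun x w => by
      have h := coev_invariant (((TensorProduct.mk k _ _).compl₂ ((V.odd j).flip w)).comp
        (SymmetricAlgebra.ι k (Module.Dual k g₁))) x
      simp only [LinearMap.comp_apply, LinearMap.compl₂_apply, LinearMap.flip_apply,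
        TensorProduct.mk_apply, V.lie_odd, TensorProduct.tmul_sub] at h
      rw [← sub_eq_zero, ← Finset.sum_sub_distrib, ← h]
      refine Finset.sum_congr rfl fun i _ => ?_
      rw [add_sub_assoc]
      congr 2
      exact symDerivation_ι _ _)

theorem sum_antisymm [NeZero (2 : k)] {ι T : Type*} [Fintype ι] [AddCommGroup T] [Module k T]
    (F : ι → ι → T) (h : ∀ i l, F i l + F l i = 0) : ∑ i, ∑ l, F i l = 0 := by
  refine (smul_eq_zero.1 (?_ : (2 : k) • ∑ i, ∑ l, F i l = 0)).resolve_left (NeZero.ne 2)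
  rw [two_smul]
  conv_lhs => arg 2; rw [Finset.sum_comm]
  rw [← Finset.sum_add_distrib]
  refine Finset.sum_eq_zero fun i _ => ?_
  rw [← Finset.sum_add_distrib]
  exact Finset.sum_eq_zero fun l _ => h i l

theorem complexD_comp [NeZero (2 : k)] (V : GrMod S) (j : ℤ) :
    complexD V j ≫ complexD V (j + 1) = 0 := by
  refine twist_hom_ext _ _ fun U s p hp => ?_
  change famMap _ _ _ (famMap _ _ _ (twVal s p hp)) = 0
  generalize twVal s p hp = z
  induction z with
  | zero => simp
  | add y z hy hz => simp only [map_add, hy, hz, add_zero]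
  | tmul b w =>
    simp only [famMap_tmul, map_sum]
    refine sum_antisymm (k := k) _ fun i l => ?_
    rw [← mul_assoc, ← mul_assoc, mul_comm (algebraMap _ _ (coordForm i)), ← TensorProduct.tmul_add,
      V.odd_odd, TensorProduct.tmul_zero]

/-- The complex `L(V)` of equivariant sheaves on `𝒫(g₁)` attached to a graded module `V`. -/
def complexOf [NeZero (2 : k)] (V : GrMod S) : CochainComplex (GSheaf k g₀ g₁) ℤ :=
  CochainComplex.of (fun j => projTwist k g₀ g₁ (V.piece j) j) (complexD V) (complexD_comp V)

/-- The morphism `f ⊗ id : W ⊗ 𝒪(j) → W' ⊗ 𝒪(j)` for a homomorphism `f` of representations. -/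
def projTwistMap {W W' : Type u} [AddCommGroup W] [Module k W] [LieRingModule g₀ W]
    [LieModule k g₀ W] [AddCommGroup W'] [Module k W'] [LieRingModule g₀ W'] [LieModule k g₀ W']
    (f : W →ₗ[k] W') (hf : ∀ (x : g₀) w, f ⁅x, w⁆ = ⁅x, f w⁆) (j : ℤ) :
    projTwist k g₀ g₁ W j ⟶ projTwist k g₀ g₁ W' j :=
  famEquivHom (symLieAction (k := k) (M := Module.Dual k g₁) g₀) symLieAction_mem
    (fun _ : Unit => 1) (fun _ => f) 0
    (fun _ => SetLike.GradedOne.one_mem) (by simp) (fun x w => by simp [hf])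

/-- The functor `V ↦ L(V)`. -/
def complexFunctor [NeZero (2 : k)] (S : LieSuperalgebra k g₀ g₁) :
    GrMod S ⥤ CochainComplex (GSheaf k g₀ g₁) ℤ where
  obj V := complexOf V
  map {V W} φ := CochainComplex.ofHom (X := complexOf V) (Y := complexOf W)
    (fun j => projTwistMap (GrMod.Hom.map φ j) (GrMod.Hom.map_lie φ j) j) fun j => by
      simp only [complexOf, CochainComplex.of_d]
      refine twist_hom_ext _ _ fun U s p hp => ?_
      change famMap _ _ _ (famMap _ _ _ (twVal s p hp)) = famMap _ _ _ (famMap _ _ _ (twVal s p hp))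
      generalize twVal s p hp = z
      induction z with
      | zero => simp
      | add y z hy hz => simp only [map_add, hy, hz]
      | tmul b w => simp [famMap_tmul, GrMod.Hom.map_odd]
  map_id V := by
    ext j : 1
    refine twist_hom_ext _ _ fun U s p hp => ?_
    change famMap _ _ _ (twVal s p hp) = twVal s p hp
    generalize twVal s p hp = z
    induction z with
    | zero => simp
    | add y z hy hz => simp only [map_add, hy, hz]
    | tmul b w => simp [famMap_tmul]
  map_comp φ ψ := by
    ext j : 1
    refine twist_hom_ext _ _ fun U s p hp => ?_
    change famMap _ _ _ (twVal s p hp) = famMap _ _ _ (famMap _ _ _ (twVal s p hp))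
    generalize twVal s p hp = z
    induction z with
    | zero => simp
    | add y z hy hz => simp only [map_add, hy, hz]
    | tmul b w => simp [famMap_tmul]

end ComplexOfModule

/-! ## Rigid complexes and the graded module attached to a rigid complex -/

section Rigid
variable (k g₀ g₁ : Type u) [Field k] [LieRing g₀] [LieAlgebra k g₀] [AddCommGroup g₁] [Module k g₁]
  [LieRingModule g₀ g₁] [LieModule k g₀ g₁]

/-- The data of a complex `⋯ → Vʲ ⊗ 𝒪(j) → Vʲ⁺¹ ⊗ 𝒪(j + 1) → ⋯` of equivariant sheaves, for
representations `Vʲ` of `g₀` and arbitrary equivariant differentials. -/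
structure RigidForm where
  piece : ℤ → Type u
  [addCommGroup : ∀ j, AddCommGroup (piece j)]
  [module : ∀ j, Module k (piece j)]
  [lieRingModule : ∀ j, LieRingModule g₀ (piece j)]
  [lieModule : ∀ j, LieModule k g₀ (piece j)]
  d (j : ℤ) : projTwist k g₀ g₁ (piece j) j ⟶ projTwist k g₀ g₁ (piece (j + 1)) (j + 1)
  d_comp_d (j : ℤ) : d j ≫ d (j + 1) = 0

attribute [instance] RigidForm.addCommGroup RigidForm.module RigidForm.lieRingModule
  RigidForm.lieModule

variable {k g₀ g₁}

/-- The complex given by a `RigidForm`. -/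
def RigidForm.complex (R : RigidForm k g₀ g₁) : CochainComplex (GSheaf k g₀ g₁) ℤ :=
  CochainComplex.of (fun j => projTwist k g₀ g₁ (R.piece j) j) R.d R.d_comp_d

variable (k g₀ g₁) in
/-- A complex of quasi-coherent equivariant sheaves on `𝒫(g₁)` is rigid if it is isomorphic to a
complex with terms `Vʲ ⊗ 𝒪(j)`. -/
def IsRigid : ObjectProperty (CochainComplex (GSheaf k g₀ g₁) ℤ) := fun L =>
  (∀ j, (L.X j).sheaf.IsQuasicoherent) ∧ ∃ R : RigidForm k g₀ g₁, Nonempty (L ≅ R.complex)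

/-- A complex is bounded if its terms vanish outside of a finite interval. -/
def IsBoundedComplex (L : CochainComplex (GSheaf k g₀ g₁) ℤ) : Prop :=
  ∃ a b : ℤ, ∀ j, j < a ∨ b < j → Limits.IsZero (L.X j)

/-- A rigid complex is finite if it is bounded and all the `Vʲ` are finite-dimensional. -/
def IsFiniteRigid (L : CochainComplex (GSheaf k g₀ g₁) ℤ) : Prop :=
  (∀ j, (L.X j).sheaf.IsQuasicoherent) ∧ IsBoundedComplex L ∧
    ∃ R : RigidForm k g₀ g₁, Nonempty (L ≅ R.complex) ∧ ∀ j, Module.Finite k (R.piece j)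

/-- Quasi-coherent sheaves for which `X` is covered by affine open subsets `U` such that the
sections over `U` are finitely generated under the functions on `U` and `g₀` (i.e. finitely
generated over the smash product `𝓡_X(U)` of `𝒪_X(U)` and the enveloping algebra of `g₀`). -/
def IsCoherentEquiv (F : GSheaf k g₀ g₁) : Prop :=
  F.sheaf.IsQuasicoherent ∧ ∀ x : ProjSpace k g₁, ∃ U : (ProjSpace k g₁).Opens, x ∈ U ∧
    IsAffineOpen U ∧ ∃ s : Finset Γ(F.sheaf, U), ∀ N : Submodule Γ(ProjSpace k g₁, U) Γ(F.sheaf, U),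
      (∀ (x : g₀), ∀ m ∈ N, F.act x U m ∈ N) → (∀ m ∈ s, m ∈ N) → N = ⊤

/-- Quasi-coherent sheaves for which `X` is covered by affine open subsets `U` such that the
sections over `U` are finitely generated over the functions on `U`. -/
def IsCoherentSheaf (F : GSheaf k g₀ g₁) : Prop :=
  F.sheaf.IsQuasicoherent ∧ ∀ x : ProjSpace k g₁, ∃ U : (ProjSpace k g₁).Opens, x ∈ U ∧
    IsAffineOpen U ∧ Module.Finite Γ(ProjSpace k g₁, U) Γ(F.sheaf, U)

/-- The multiplication map `Γ(F(n)) ⊗ g₁* → Γ(F(n + 1))`. -/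
def mulDual (F : GSheaf k g₀ g₁) {n n' : ℤ} (hn : n' = n + 1) :
    TwistΓ F n ⊗[k] Module.Dual k g₁ →ₗ[k] TwistΓ F n' :=
  TensorProduct.lift ((TwistΓ.mul F hn).comp
    ((SymmetricAlgebra.ι k (Module.Dual k g₁)).codRestrict _ ι_mem_symDeg)).flip

variable (g₁) in
/-- The evaluation `id ⊗ sₓ : M ⊗ g₁* → M`, linearly in `x`. -/
def evalDual (M : Type u) [AddCommGroup M] [Module k M] :
    g₁ →ₗ[k] M ⊗[k] Module.Dual k g₁ →ₗ[k] M :=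
  (LinearMap.llcomp k _ _ _ (TensorProduct.rid k M).toLinearMap).comp
    ((LinearMap.lTensorHom M).comp (Module.Dual.eval k g₁))

@[simp] theorem evalDual_tmul {M : Type u} [AddCommGroup M] [Module k M] (x : g₁) (m : M)
    (f : Module.Dual k g₁) : evalDual g₁ M x (m ⊗ₜ f) = f x • m := by
  simp [evalDual]

open Classical in
/-- The inverse of a bijective linear map (and `0` otherwise). -/
def linearInv {M N : Type u} [AddCommGroup M] [Module k M] [AddCommGroup N] [Module k N]
    (f : M →ₗ[k] N) : N →ₗ[k] M :=
  if h : Function.Bijective f then (LinearEquiv.ofBijective f h).symm.toLinearMap else 0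

theorem linearInv_apply_self {M N : Type u} [AddCommGroup M] [Module k M] [AddCommGroup N]
    [Module k N] {f : M →ₗ[k] N} (h : Function.Bijective f) (m : M) : linearInv f (f m) = m := by
  rw [linearInv, dif_pos h]
  exact (LinearEquiv.ofBijective f h).symm_apply_apply m

theorem apply_linearInv_self {M N : Type u} [AddCommGroup M] [Module k M] [AddCommGroup N]
    [Module k N] {f : M →ₗ[k] N} (h : Function.Bijective f) (n : N) : f (linearInv f n) = n := by
  rw [linearInv, dif_pos h]
  exact (LinearEquiv.ofBijective f h).apply_symm_apply n

variable (L : CochainComplex (GSheaf k g₀ g₁) ℤ)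

/-- The representation `V(L)ʲ = Γ(Lʲ(-j))` of `g₀`. -/
abbrev sectionPiece (j : ℤ) : Type u := TwistΓ (L.X j) (-j)

/-- The multiplication map `V(L)ʲ⁺¹ ⊗ g₁* = Γ(Lʲ⁺¹(-j-1)) ⊗ Γ(𝒪(1)) → Γ(Lʲ⁺¹(-j))`. -/
def sectionMul (j : ℤ) :
    sectionPiece L (j + 1) ⊗[k] Module.Dual k g₁ →ₗ[k] TwistΓ (L.X (j + 1)) (-j) :=
  mulDual (L.X (j + 1)) (by ring)

/-- The action of `x ∈ g₁`: `x v = (-1)ʲ (id ⊗ sₓ) Γ(dʲ(-j)) (v)` for `v ∈ V(L)ʲ`, where the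
target `Γ(Lʲ⁺¹(-j))` of `Γ(dʲ(-j))` is identified with `V(L)ʲ⁺¹ ⊗ g₁*`. -/
def sectionOdd (j : ℤ) : g₁ →ₗ[k] sectionPiece L j →ₗ[k] sectionPiece L (j + 1) :=
  (-1 : k) ^ j • ((LinearMap.lcomp k _
    (linearInv (sectionMul L j) ∘ₗ TwistΓ.map (L.d j (j + 1)) (-j))).comp (evalDual g₁ _))

theorem sectionOdd_apply (j : ℤ) (x : g₁) (v : sectionPiece L j) :
    sectionOdd L j x v = (-1 : k) ^ j •
      evalDual g₁ _ x (linearInv (sectionMul L j) (TwistΓ.map (L.d j (j + 1)) (-j) v)) := rfl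

variable (S : LieSuperalgebra k g₀ g₁)

/-- The complex `L` gives rise to a graded module `V(L)`: the multiplication maps
`V(L)ʲ⁺¹ ⊗ g₁* → Γ(Lʲ⁺¹(-j))` are isomorphisms, and the actions of `g₀` and of `g₁` define a graded
module. -/
structure HasSectionModule : Prop where
  bijective (j : ℤ) : Function.Bijective (sectionMul L j)
  lie_odd (j : ℤ) (x : g₀) (y : g₁) (v : sectionPiece L j) :
    sectionOdd L j ⁅x, y⁆ v = ⁅x, sectionOdd L j y v⁆ - sectionOdd L j y ⁅x, v⁆
  oddBracket_lie (j : ℤ) (a b : g₁) (v : sectionPiece L j) :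
    DirectSum.of (sectionPiece L) j ⁅S.oddBracket a b, v⁆ =
      DirectSum.of (sectionPiece L) (j + 1 + 1)
        (sectionOdd L (j + 1) a (sectionOdd L j b v) + sectionOdd L (j + 1) b (sectionOdd L j a v))

/-- The property `HasSectionModule` of complexes. -/
def hasSectionModule : ObjectProperty (CochainComplex (GSheaf k g₀ g₁) ℤ) := fun L =>
  HasSectionModule L S

variable {L S}

/-- The graded module `V(L) = ⨁ Γ(Lʲ(-j))`. -/
def sectionModule (h : HasSectionModule L S) : GrMod S where
  piece := sectionPiece L
  odd := sectionOdd L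
  lie_odd := h.lie_odd
  oddBracket_lie := h.oddBracket_lie

theorem mulDual_natural {F G : GSheaf k g₀ g₁} (f : F ⟶ G) {n n' : ℤ} (hn : n' = n + 1)
    (t : TwistΓ F n ⊗[k] Module.Dual k g₁) :
    mulDual G hn (LinearMap.rTensor _ (TwistΓ.map f n) t) = TwistΓ.map f n' (mulDual F hn t) := by
  induction t with
  | zero => simp
  | add s t hs ht => simp only [map_add, hs, ht]
  | tmul s a => exact (TwistΓ.mul_map f hn _ s).symm

theorem evalDual_natural {M N : Type u} [AddCommGroup M] [Module k M] [AddCommGroup N] [Module k N]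
    (f : M →ₗ[k] N) (x : g₁) (t : M ⊗[k] Module.Dual k g₁) :
    evalDual g₁ N x (LinearMap.rTensor _ f t) = f (evalDual g₁ M x t) := by
  induction t with
  | zero => simp
  | add s t hs ht => simp only [map_add, hs, ht]
  | tmul s a => simp

theorem sectionOdd_natural {L' : CochainComplex (GSheaf k g₀ g₁) ℤ} (φ : L ⟶ L') (j : ℤ)
    (h : Function.Bijective (sectionMul L j)) (h' : Function.Bijective (sectionMul L' j))
    (x : g₁) (v : sectionPiece L j) :
    TwistΓ.map (φ.f (j + 1)) (-(j + 1)) (sectionOdd L j x v) =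
      sectionOdd L' j x (TwistΓ.map (φ.f j) (-j) v) := by
  rw [sectionOdd_apply, sectionOdd_apply, map_smul, ← evalDual_natural]
  congr 2
  apply h'.1
  rw [apply_linearInv_self h', sectionMul, mulDual_natural]
  change TwistΓ.map _ _ (sectionMul L j (linearInv (sectionMul L j) _)) = _
  rw [apply_linearInv_self h, ← LinearMap.comp_apply, ← LinearMap.comp_apply, ← TwistΓ.map_comp,
    ← TwistΓ.map_comp, φ.comm]

variable (S) in
/-- The functor `L ↦ V(L)`. -/
def sectionFunctor : (hasSectionModule S).FullSubcategory ⥤ GrMod S where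
  obj L := sectionModule L.property
  map {L L'} φ := GrMod.Hom.mk (V := sectionModule L.property) (W := sectionModule L'.property)
    (fun j => TwistΓ.map (φ.hom.f j) (-j)) (fun j x v => TwistΓ.map_lie _ _ x v)
    (fun j x v => sectionOdd_natural φ.hom j (L.property.bijective j) (L'.property.bijective j) x v)
  map_id L := GrMod.hom_ext fun j => TwistΓ.map_id _ _
  map_comp φ ψ := GrMod.hom_ext fun j => TwistΓ.map_comp _ _ _

end Rigid

end GZeroGeometry
end

/-!
A section of `W ⊗ 𝒪(j)` over an open subset of `Proj 𝒜` is a family of elements of the `A_p ⊗ W`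
that is locally a fraction of degree `j`. Where a linear form `f` does not vanish, multiplication by
`fⁿ` identifies `W ⊗ 𝒪(j)` with `W ⊗ 𝒪(j + n)`, and linear forms without common zeros exist; hence
multiplication is an isomorphism from the sheaf `W ⊗ 𝒪(j) ⊗ 𝒪(n)` to `W ⊗ 𝒪(j + n)`
(`isIso_sheafMul`), and global sections of the twists can be computed with fractions. The symmetric
algebra `S(g₁*)` is a domain, so such a section is determined by its value at the generic point, and
factoriality in the weak form `HasLinearForms` shows that the global sections of `W ⊗ 𝒪(d)` are
`S^d(g₁*) ⊗ W` for `d ≥ 0` (`exists_eq_numMap`). For `d = 0` and `d = 1` this says that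
`W ≅ Γ(W ⊗ 𝒪(j) ⊗ 𝒪(-j))` (`projUnit`) and that the multiplication map
`Γ(F(-j)) ⊗ g₁* → Γ(F(-j + 1))` is bijective for `F = W ⊗ 𝒪(j)` (`mulDual_bijective`).

An equivariant morphism `W ⊗ 𝒪(j) → W' ⊗ 𝒪(j')` is determined by what it does to the global sections
`W` of the twist by `-j`, because `W ⊗ 𝒪(j)` is locally generated by these (`projTwist_hom_ext`).
For `j' = j + 1` such a morphism therefore amounts to an equivariant map `W → W' ⊗ g₁*`, its
`symbol`, i.e. to operators `W → W'` indexed linearly by `g₁`. The composition of two consecutive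
differentials has as its symbol a quadratic form on `g₁` with values in the operators, whose value
at `y` is the square of the operator of `y`; so `d² = 0` makes the odd operators anticommute
(`evalDual_symbol_symm`), which is the module axiom as `[g₁, g₁] = 0`. Thus every rigid complex is
`L(V)` for a graded module `V` (`RigidForm.complexOf_toGrMod`), and the functor `L` is full and
faithful by the same description of morphisms. The module `V(L(V))` is `V` up to the sign `(-1)ʲ` in
the action of `g₁`, and rescaling the `j`-th piece by `(-1)^(j(j-1)/2)` removes it
(`sectionModuleIso`).

The terms of `L(V)` are quasi-coherent because, where `f` does not vanish, the sections `fʲ wᵢ` form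
a basis over every smaller open subset, for a basis `wᵢ` of `W` (`twistBasis`). In particular they
are coherent if `W` is finite-dimensional. Conversely, finitely many sections of `W ⊗ 𝒪(j)` involve
only finitely many of the `wᵢ` at the generic point, while over an affine open subset
quasi-coherence provides a section `s` of `𝒪(j)` that is nonzero there, hence sections `s wᵢ` that
involve each `wᵢ`; so a coherent `W ⊗ 𝒪(j)` has finite-dimensional `W` (`finite_of_finite_sections`).
-/

noncomputable section

namespace GZeroGeometry
open CategoryTheory AlgebraicGeometry TopologicalSpace Opposite

/-! ### Scalar sections: local fractions of a given degree -/

section ScalarSections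
variable {k A : Type u} [Field k] [CommRing A] [Algebra k A]
  (𝒜 : ℕ → Submodule k A) [GradedAlgebra 𝒜]
  {W : Type u} [AddCommGroup W] [Module k W]

/-- The element `c` of `A_p` equals `a / b`. -/
def IsScalarFracAt (p : ProjectiveSpectrum 𝒜) (a b : A) (c : Loc 𝒜 p) : Prop :=
  b ∉ p.asHomogeneousIdeal ∧ algebraMap A (Loc 𝒜 p) b * c = algebraMap A (Loc 𝒜 p) a

/-- The family `c` of elements of the `A_p` is locally a fraction of degree `n`, i.e. it is a
section of `𝒪(n)` over `U`. -/
def IsScalarSec (n : ℤ) (U : (Proj 𝒜).Opens) (c : ∀ p : U, Loc 𝒜 p.1) : Prop :=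
  ∀ p : U, ∃ (V : (Proj 𝒜).Opens) (_ : p.1 ∈ V) (hV : V ≤ U) (i m : ℕ) (a b : A),
    (i : ℤ) = m + n ∧ a ∈ 𝒜 i ∧ b ∈ 𝒜 m ∧ ∀ q : V, IsScalarFracAt 𝒜 q.1 a b (c ⟨q.1, hV q.2⟩)

variable {𝒜}

theorem isUnit_algebraMap_loc {p : ProjectiveSpectrum 𝒜} {b : A} (hb : b ∉ p.asHomogeneousIdeal) :
    IsUnit (algebraMap A (Loc 𝒜 p) b) :=
  IsLocalization.map_units (Loc 𝒜 p) (⟨b, hb⟩ : p.asHomogeneousIdeal.toIdeal.primeCompl)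

theorem IsFracAt.scalar_smul {p : ProjectiveSpectrum 𝒜} {a : A ⊗[k] W} {b a' b' : A}
    {y : Loc 𝒜 p ⊗[k] W} {c : Loc 𝒜 p} (h : IsFracAt 𝒜 W p a b y)
    (hc : IsScalarFracAt 𝒜 p a' b' c) : IsFracAt 𝒜 W p (a' • a) (b' * b) (c • y) := by
  refine ⟨mul_notMem 𝒜 p hc.1 h.1, ?_⟩
  rw [numMap_smul, ← h.2, ← hc.2, map_mul, smul_smul, smul_smul]
  congr 1
  ring

theorem IsScalarFracAt.tmul {p : ProjectiveSpectrum 𝒜} {a b : A} {c : Loc 𝒜 p}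
    (hc : IsScalarFracAt 𝒜 p a b c) (w : W) : IsFracAt 𝒜 W p (a ⊗ₜ w) b (c ⊗ₜ w) := by
  refine ⟨hc.1, ?_⟩
  rw [TensorProduct.smul_tmul', smul_eq_mul, hc.2]
  rfl

theorem IsScalarSec.smul_mem {n j j' : ℤ} (hj : j' = j + n) {U : (Proj 𝒜).Opens}
    {c : ∀ p : U, Loc 𝒜 p.1} (hc : IsScalarSec 𝒜 n U c) {s : ∀ p : U, Loc 𝒜 p.1 ⊗[k] W}
    (hs : s ∈ twistSections 𝒜 W j U) : (fun p => c p • s p) ∈ twistSections 𝒜 W j' U := fun p => by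
  obtain ⟨V, hV, i, l, n, a, b, h, ha, hb, e⟩ := hs p
  obtain ⟨V', hV', i', l', n', a', b', h', ha', hb', e'⟩ := hc p
  refine ⟨V ⊓ V', ⟨hV, hV'⟩, Opens.infLELeft _ _ ≫ i, l' + l, n' + n, a' • a, b' * b,
    by push_cast; omega, smul_mem_numDeg rfl ha' ha, SetLike.mul_mem_graded hb' hb,
    fun q => (e ⟨q.1, q.2.1⟩).scalar_smul (e' ⟨q.1, q.2.2⟩)⟩

theorem IsScalarSec.tmul_mem {n : ℤ} {U : (Proj 𝒜).Opens}
    {c : ∀ p : U, Loc 𝒜 p.1} (hc : IsScalarSec 𝒜 n U c) (w : W) :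
    (fun p => c p ⊗ₜ[k] w) ∈ twistSections 𝒜 W n U := fun p => by
  obtain ⟨V, hV, i, l, n, a, b, h, ha, hb, e⟩ := hc p
  exact ⟨V, hV, homOfLE i, l, n, a ⊗ₜ w, b, h, Submodule.subset_span ⟨a, ha, w, rfl⟩, hb,
    fun q => (e q).tmul w⟩

theorem IsScalarSec.mul {n m n' : ℤ} (hn : n' = n + m) {U : (Proj 𝒜).Opens}
    {c d : ∀ p : U, Loc 𝒜 p.1} (hc : IsScalarSec 𝒜 n U c) (hd : IsScalarSec 𝒜 m U d) :
    IsScalarSec 𝒜 n' U (fun p => c p * d p) := fun p => by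
  obtain ⟨V, hV, i, l, n, a, b, h, ha, hb, e⟩ := hc p
  obtain ⟨V', hV', i', l', n', a', b', h', ha', hb', e'⟩ := hd p
  refine ⟨V ⊓ V', ⟨hV, hV'⟩, inf_le_left.trans i, l' + l, n' + n, a' * a, b' * b,
    by push_cast; omega, SetLike.mul_mem_graded ha' ha, SetLike.mul_mem_graded hb' hb,
    fun q => ⟨mul_notMem 𝒜 _ (e' ⟨q.1, q.2.2⟩).1 (e ⟨q.1, q.2.1⟩).1, ?_⟩⟩
  have h1 := (e ⟨q.1, q.2.1⟩).2
  have h2 := (e' ⟨q.1, q.2.2⟩).2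
  rw [map_mul, map_mul, ← h1, ← h2]
  ring

/-- A homogeneous element of degree `i` is a global section of `𝒪(i)`. -/
theorem isScalarSec_algebraMap {i : ℕ} {a : A} (ha : a ∈ 𝒜 i) (U : (Proj 𝒜).Opens) :
    IsScalarSec 𝒜 i U (fun p => algebraMap A (Loc 𝒜 p.1) a) := fun p =>
  ⟨U, p.2, le_rfl, i, 0, a, 1, by simp, ha, SetLike.GradedOne.one_mem, fun q =>
    ⟨one_notMem 𝒜 q.1, by simp⟩⟩

/-- The function `fⁿ` at a point `p` where `f` does not vanish (and `1` elsewhere). -/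
def powAt (f : A) (n : ℤ) (p : ProjectiveSpectrum 𝒜) : Loc 𝒜 p :=
  open Classical in
  if h : f ∉ p.asHomogeneousIdeal then (((isUnit_algebraMap_loc h).unit ^ n : (Loc 𝒜 p)ˣ) : Loc 𝒜 p)
  else 1

theorem powAt_add (f : A) (m n : ℤ) (p : ProjectiveSpectrum 𝒜) :
    powAt f (m + n) p = powAt f m p * powAt f n p := by
  unfold powAt
  by_cases h : f ∉ p.asHomogeneousIdeal
  · rw [dif_pos h, dif_pos h, dif_pos h, zpow_add, Units.val_mul]
  · rw [dif_neg h, dif_neg h, dif_neg h, one_mul]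

@[simp] theorem powAt_zero (f : A) (p : ProjectiveSpectrum 𝒜) : powAt f 0 p = 1 := by
  unfold powAt
  split_ifs <;> simp

theorem powAt_mul_neg (f : A) (n : ℤ) (p : ProjectiveSpectrum 𝒜) :
    powAt f n p * powAt f (-n) p = 1 := by
  rw [← powAt_add, add_neg_cancel, powAt_zero]

theorem powAt_neg_mul (f : A) (n : ℤ) (p : ProjectiveSpectrum 𝒜) :
    powAt f (-n) p * powAt f n p = 1 := by
  rw [← powAt_add, neg_add_cancel, powAt_zero]

theorem powAt_natCast {f : A} {p : ProjectiveSpectrum 𝒜} (h : f ∉ p.asHomogeneousIdeal) (n : ℕ) :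
    powAt f n p = algebraMap A (Loc 𝒜 p) (f ^ n) := by
  unfold powAt
  rw [dif_pos h]
  simp

theorem isScalarFracAt_powAt {f : A} {p : ProjectiveSpectrum 𝒜} (h : f ∉ p.asHomogeneousIdeal)
    (n : ℤ) : IsScalarFracAt 𝒜 p (f ^ n.toNat) (f ^ (-n).toNat) (powAt f n p) := by
  refine ⟨fun h' => h (p.isPrime.mem_of_pow_mem _ h'), ?_⟩
  rw [← powAt_natCast h, ← powAt_natCast h, ← powAt_add]
  congr 1
  omega

theorem isScalarSec_powAt {f : A} (hf : f ∈ 𝒜 1) (n : ℤ) {U : (Proj 𝒜).Opens}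
    (hU : U ≤ ProjectiveSpectrum.basicOpen 𝒜 f) :
    IsScalarSec 𝒜 n U (fun p => powAt f n p.1) := fun p =>
  ⟨U, p.2, le_rfl, n.toNat, (-n).toNat, f ^ n.toNat, f ^ (-n).toNat, by omega,
    by simpa using SetLike.pow_mem_graded n.toNat hf,
    by simpa using SetLike.pow_mem_graded (-n).toNat hf, fun q => isScalarFracAt_powAt (hU q.2) n⟩

theorem isScalarFracAt_of_eq_mk {p : ProjectiveSpectrum 𝒜} {a b : A} {c : Loc 𝒜 p}
    (hb : b ∉ p.asHomogeneousIdeal) (h : c = Localization.mk a ⟨b, hb⟩) :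
    IsScalarFracAt 𝒜 p a b c := by
  refine ⟨hb, ?_⟩
  rw [h, Localization.mk_eq_mk']
  exact IsLocalization.mk'_spec' (Loc 𝒜 p) a (⟨b, hb⟩ : p.asHomogeneousIdeal.toIdeal.primeCompl)

theorem IsScalarFracAt.eq_mk {p : ProjectiveSpectrum 𝒜} {a b : A} {c : Loc 𝒜 p}
    (h : IsScalarFracAt 𝒜 p a b c) : c = Localization.mk a ⟨b, h.1⟩ := by
  rw [Localization.mk_eq_mk', IsLocalization.eq_mk'_iff_mul_eq, mul_comm]
  exact h.2

/-- A section of `𝒪(0)` comes from a section of the structure sheaf. -/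
theorem IsScalarSec.exists_sec {U : (Proj 𝒜).Opens} {c : ∀ p : U, Loc 𝒜 p.1}
    (hc : IsScalarSec 𝒜 0 U c) :
    ∃ r : Γ(Proj 𝒜, U), ∀ p hp, (secVal 𝒜 r p hp).val = c ⟨p, hp⟩ := by
  have key : ∀ p : U, ∃ z : HLoc 𝒜 p.1, z.val = c p := fun p => by
    obtain ⟨V, hV, i, l, n, a, b, h, ha, hb, e⟩ := hc p
    obtain rfl : l = n := by omega
    exact ⟨HomogeneousLocalization.mk ⟨l, ⟨a, ha⟩, ⟨b, hb⟩, (e ⟨p.1, hV⟩).1⟩,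
      (e ⟨p.1, hV⟩).eq_mk.symm⟩
  choose z hz using key
  refine ⟨⟨z, fun p => ?_⟩, fun p hp => hz ⟨p, hp⟩⟩
  obtain ⟨V, hV, i, l, n, a, b, h, ha, hb, e⟩ := hc p
  obtain rfl : l = n := by omega
  refine ⟨V, hV, homOfLE i, l, ⟨a, ha⟩, ⟨b, hb⟩, fun q => (e q).1, fun q => ?_⟩
  apply HomogeneousLocalization.val_injective
  exact (hz ⟨q.1, i q.2⟩).trans (e q).eq_mk

end ScalarSections

/-! ### Multiplication of sections of `W ⊗ 𝒪(j)` and `𝒪(n)` -/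

section Scal
variable {k g₀ B : Type u} [Field k] [LieRing g₀] [LieAlgebra k g₀] [CommRing B] [Algebra k B]

variable (k g₀ B) in
/-- The identification `B ⊗ k ≅ B`, where `k` is the trivial representation of `g₀`. -/
def scal : B ⊗[k] TrivialLieModule k g₀ k →ₗ[B] B :=
  (TensorProduct.AlgebraTensorModule.rid k B B).toLinearMap ∘ₗ
    (TrivialLieModule.equiv k g₀ k).toLinearMap.baseChange B

theorem scal_tmul (b : B) (w : TrivialLieModule k g₀ k) :
    scal k g₀ B (b ⊗ₜ w) = TrivialLieModule.equiv k g₀ k w • b := by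
  simp [scal]

variable (k g₀) in
/-- The element `1` of the trivial representation `k`. -/
def trivOne : TrivialLieModule k g₀ k := (TrivialLieModule.equiv k g₀ k).symm 1

@[simp] theorem scal_tmul_one (b : B) : scal k g₀ B (b ⊗ₜ trivOne k g₀) = b := by
  simp [scal_tmul, trivOne]

theorem scal_tmul_trivOne (z : B ⊗[k] TrivialLieModule k g₀ k) :
    scal k g₀ B z ⊗ₜ trivOne k g₀ = z := by
  induction z with
  | zero => simp
  | add y z hy hz => rw [map_add, TensorProduct.add_tmul, hy, hz]
  | tmul b w =>
    rw [scal_tmul, TensorProduct.smul_tmul]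
    congr 1
    apply (TrivialLieModule.equiv k g₀ k).injective
    simp [trivOne]

theorem scal_tensorAct (D : Derivation k B B) (x : g₀) (z : B ⊗[k] TrivialLieModule k g₀ k) :
    scal k g₀ B (tensorAct D x z) = D (scal k g₀ B z) := by
  induction z with
  | zero => simp
  | add y z hy hz => simp only [map_add, hy, hz]
  | tmul b w =>
    rw [tensorAct_tmul, trivial_lie_zero, TensorProduct.tmul_zero, add_zero, scal_tmul, scal_tmul,
      D.map_smul]

end Scal

section TwistSub
variable {k g₀ A : Type u} [Field k] [LieRing g₀] [LieAlgebra k g₀] [CommRing A] [Algebra k A]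
  {𝒜 : ℕ → Submodule k A} [GradedAlgebra 𝒜]

theorem scal_mem {i : ℕ} {a : A ⊗[k] TrivialLieModule k g₀ k}
    (ha : a ∈ numDeg 𝒜 (TrivialLieModule k g₀ k) i) : scal k g₀ A a ∈ 𝒜 i := by
  induction ha using Submodule.span_induction with
  | zero => simp
  | add x y _ _ hx hy => rw [map_add]; exact add_mem hx hy
  | smul c x _ hx =>
    rw [← algebraMap_smul A c x, map_smul, algebraMap_smul]; exact Submodule.smul_mem _ _ hx
  | mem x hx =>
    obtain ⟨a, ha, w, rfl⟩ := hx
    rw [scal_tmul]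
    exact Submodule.smul_mem _ _ ha

theorem scal_numMap (p : ProjectiveSpectrum 𝒜) (a : A ⊗[k] TrivialLieModule k g₀ k) :
    scal k g₀ (Loc 𝒜 p) (numMap 𝒜 _ p a) = algebraMap A (Loc 𝒜 p) (scal k g₀ A a) := by
  induction a with
  | zero => simp
  | add y z hy hz => simp only [map_add, hy, hz]
  | tmul b w =>
    simp only [numMap, LinearMap.rTensor_tmul, scal_tmul, Algebra.smul_def, map_mul]
    rw [← IsScalarTower.algebraMap_apply k A]
    rfl

theorem IsFracAt.scal {p : ProjectiveSpectrum 𝒜} {a : A ⊗[k] TrivialLieModule k g₀ k} {b : A}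
    {y : Loc 𝒜 p ⊗[k] TrivialLieModule k g₀ k}
    (h : IsFracAt 𝒜 (TrivialLieModule k g₀ k) p a b y) :
    IsScalarFracAt 𝒜 p (scal k g₀ A a) b (scal k g₀ (Loc 𝒜 p) y) := by
  refine ⟨h.1, ?_⟩
  rw [← scal_numMap, ← h.2, map_smul, smul_eq_mul]

theorem isScalarSec_scal {n : ℤ} {U : (Proj 𝒜).Opens}
    {t : ∀ p : U, Loc 𝒜 p.1 ⊗[k] TrivialLieModule k g₀ k}
    (ht : t ∈ twistSections 𝒜 (TrivialLieModule k g₀ k) n U) :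
    IsScalarSec 𝒜 n U (fun p => GZeroGeometry.scal k g₀ (Loc 𝒜 p.1) (t p)) := fun p => by
  obtain ⟨V, hV, i, l, n, a, b, h, ha, hb, e⟩ := ht p
  exact ⟨V, hV, i.le, l, n, _, b, h, scal_mem ha, hb, fun q => (e q).scal⟩

theorem IsFracAt.csmul {W : Type u} [AddCommGroup W] [Module k W] {p : ProjectiveSpectrum 𝒜}
    {a : A ⊗[k] W} {b : A} {y : Loc 𝒜 p ⊗[k] W} (h : IsFracAt 𝒜 W p a b y) (c : k) :
    IsFracAt 𝒜 W p (c • a) b (c • y) := by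
  refine ⟨h.1, ?_⟩
  rw [map_smul, ← h.2, smul_comm]

variable (W : Type u) [AddCommGroup W] [Module k W]

variable (𝒜) in
/-- The `k`-vector space of sections of `W ⊗ 𝒪(j)` over `U`. -/
def twistSub (j : ℤ) (U : (Proj 𝒜).Opens) : Submodule k (∀ p : U, Loc 𝒜 p.1 ⊗[k] W) where
  carrier := {s | s ∈ twistSections 𝒜 W j U}
  add_mem' := (twistSections 𝒜 W j U).add_mem
  zero_mem' := (twistSections 𝒜 W j U).zero_mem
  smul_mem' c s (hs : s ∈ twistSections 𝒜 W j U) := fun p => by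
    obtain ⟨V, hV, i, l, n, a, b, h, ha, hb, e⟩ := hs p
    exact ⟨V, hV, i, l, n, c • a, b, h, Submodule.smul_mem _ _ ha, hb, fun q => (e q).csmul c⟩

variable {W} in
/-- The value at `p` of a section of `W ⊗ 𝒪(j)`. -/
def tsVal {j : ℤ} {U : (Proj 𝒜).Opens} (s : twistSub 𝒜 W j U) (p : ProjectiveSpectrum 𝒜)
    (hp : p ∈ U) : Loc 𝒜 p ⊗[k] W := s.1 ⟨p, hp⟩

variable {W} in
theorem ts_ext {j : ℤ} {U : (Proj 𝒜).Opens} {s t : twistSub 𝒜 W j U}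
    (h : ∀ p hp, tsVal s p hp = tsVal t p hp) : s = t :=
  Subtype.ext (funext fun p => h p.1 p.2)

variable {W} in
theorem tsVal_add {j : ℤ} {U : (Proj 𝒜).Opens} (s t : twistSub 𝒜 W j U) (p hp) :
    tsVal (s + t) p hp = tsVal s p hp + tsVal t p hp := rfl

variable {W} in
theorem tsVal_smul {j : ℤ} {U : (Proj 𝒜).Opens} (c : k) (s : twistSub 𝒜 W j U) (p hp) :
    tsVal (c • s) p hp = c • tsVal s p hp := rfl

variable {W} in
@[simp] theorem tsVal_zero {j : ℤ} {U : (Proj 𝒜).Opens} (p hp) :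
    tsVal (0 : twistSub 𝒜 W j U) p hp = 0 := rfl

/-- Restriction of sections of `W ⊗ 𝒪(j)`. -/
def twistSub.res (j : ℤ) {U V : (Proj 𝒜).Opens} (i : U ⟶ V) :
    twistSub 𝒜 W j V →ₗ[k] twistSub 𝒜 W j U where
  toFun s := ⟨fun p => s.1 (i p),
    (isLocallyTwistFraction 𝒜 W j).res i s.1 (show s.1 ∈ twistSections 𝒜 W j V from s.2)⟩
  map_add' _ _ := rfl
  map_smul' _ _ := rfl

variable (𝒜) in
/-- The sheaf of `k`-vector spaces underlying `W ⊗ 𝒪(j)`. -/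
def twistPre (j : ℤ) : (Proj 𝒜).Opensᵒᵖ ⥤ ModuleCat.{u} k where
  obj U := ModuleCat.of k (twistSub 𝒜 W j U.unop)
  map i := ModuleCat.ofHom (twistSub.res W j i.unop)

theorem twistPre_isSheaf (j : ℤ) :
    Presheaf.IsSheaf (Opens.grothendieckTopology (Proj 𝒜)) (twistPre 𝒜 W j) :=
  (TopCat.Presheaf.isSheaf_iff_isSheaf_comp
    (forget (ModuleCat.{u} k)) (twistPre 𝒜 W j)).2
    (show TopCat.Presheaf.IsSheaf (twistInType 𝒜 W j).1 from (twistInType 𝒜 W j).2)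

end TwistSub

section MulSec
variable {k g₀ A : Type u} [Field k] [LieRing g₀] [LieAlgebra k g₀] [CommRing A] [Algebra k A]
  {𝒜 : ℕ → Submodule k A} [GradedAlgebra 𝒜]
  (δ : g₀ →ₗ⁅k⁆ Derivation k A A) (hδ : ∀ x n, ∀ a ∈ 𝒜 n, δ x a ∈ 𝒜 n)
  (W : Type u) [AddCommGroup W] [Module k W] [LieRingModule g₀ W] [LieModule k g₀ W]
  {j n j' : ℤ} (hj : j' = j + n)

/-- The product of a section of `W ⊗ 𝒪(j)` and a section of `𝒪(n)`. -/
def mulSec (U : (Proj 𝒜).Opens) (s : Γ(twistSheaf 𝒜 W j, U))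
    (t : Γ(twistSheaf 𝒜 (TrivialLieModule k g₀ k) n, U)) : twistSub 𝒜 W j' U :=
  ⟨fun p => scal k g₀ (Loc 𝒜 p.1) (twVal t p.1 p.2) • twVal s p.1 p.2,
      IsScalarSec.smul_mem (c := fun p => scal k g₀ (Loc 𝒜 p.1) (twVal t p.1 p.2))
        (s := fun p => twVal s p.1 p.2) hj (isScalarSec_scal t.2) s.2⟩

theorem tsVal_mulSec (U : (Proj 𝒜).Opens) (s : Γ(twistSheaf 𝒜 W j, U))
    (t : Γ(twistSheaf 𝒜 (TrivialLieModule k g₀ k) n, U)) (p hp) :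
    tsVal (mulSec W hj U s t) p hp = scal k g₀ (Loc 𝒜 p) (twVal t p hp) • twVal s p hp := rfl

theorem mulSec_add_right (U : (Proj 𝒜).Opens) (s : Γ(twistSheaf 𝒜 W j, U))
    (t t' : Γ(twistSheaf 𝒜 (TrivialLieModule k g₀ k) n, U)) :
    mulSec W hj U s (t + t') = mulSec W hj U s t + mulSec W hj U s t' := ts_ext fun p hp => by
  rw [tsVal_add, tsVal_mulSec, tsVal_mulSec, tsVal_mulSec, twVal_add, map_add, add_smul]

theorem mulSec_add_left (U : (Proj 𝒜).Opens) (s s' : Γ(twistSheaf 𝒜 W j, U))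
    (t : Γ(twistSheaf 𝒜 (TrivialLieModule k g₀ k) n, U)) :
    mulSec W hj U (s + s') t = mulSec W hj U s t + mulSec W hj U s' t := ts_ext fun p hp => by
  rw [tsVal_add, tsVal_mulSec, tsVal_mulSec, tsVal_mulSec, twVal_add, smul_add]

theorem mulSec_smul (U : (Proj 𝒜).Opens) (r : Γ(Proj 𝒜, U)) (s : Γ(twistSheaf 𝒜 W j, U))
    (t : Γ(twistSheaf 𝒜 (TrivialLieModule k g₀ k) n, U)) :
    mulSec W hj U (r • s) t = mulSec W hj U s (r • t) := ts_ext fun p hp => by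
  rw [tsVal_mulSec, tsVal_mulSec, twVal_smul, twVal_smul, map_smul, smul_smul, smul_eq_mul,
    mul_comm]

theorem mulSec_csmul (U : (Proj 𝒜).Opens) (c : k) (s : Γ(twistSheaf 𝒜 W j, U))
    (t : Γ(twistSheaf 𝒜 (TrivialLieModule k g₀ k) n, U)) :
    mulSec W hj U (projScalar U c • s) t = c • mulSec W hj U s t := ts_ext fun p hp => by
  rw [tsVal_mulSec, tsVal_smul, tsVal_mulSec, twVal_smul, projScalar_val, algebraMap_smul,
    smul_comm]

/-- The multiplication map `Γ(U, W ⊗ 𝒪(j)) ⊗ Γ(U, 𝒪(n)) → Γ(U, W ⊗ 𝒪(j + n))`, additively. -/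
def mulTensorAdd (U : (Proj 𝒜).Opens) :
    TensorSec (projAction δ hδ) (twist W δ hδ j).sheaf (lineBundle δ hδ n).sheaf U →+
      twistSub 𝒜 W j' U :=
  TensorSec.lift (AddMonoidHom.mk' (fun s => AddMonoidHom.mk' (mulSec W hj U s)
      (mulSec_add_right W hj U s))
      fun s s' => AddMonoidHom.ext fun t => mulSec_add_left W hj U s s' t)
    (mulSec_smul W hj U)

/-- The multiplication map `Γ(U, W ⊗ 𝒪(j)) ⊗ Γ(U, 𝒪(n)) → Γ(U, W ⊗ 𝒪(j + n))`. -/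
def mulTensor (U : (Proj 𝒜).Opens) :
    TensorSec (projAction δ hδ) (twist W δ hδ j).sheaf (lineBundle δ hδ n).sheaf U →ₗ[k]
      twistSub 𝒜 W j' U where
  toFun := mulTensorAdd δ hδ W hj U
  map_add' := map_add _
  map_smul' c t := by
    rw [RingHom.id_apply]
    induction t using TensorSec.ind with
    | zero => simp only [smul_zero, map_zero]
    | add s t hs ht => simp only [smul_add, map_add, hs, ht]
    | tmul s t => exact mulSec_csmul W hj U c s t

theorem mulTensor_tmul (U : (Proj 𝒜).Opens) (s : Γ(twistSheaf 𝒜 W j, U))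
    (t : Γ(twistSheaf 𝒜 (TrivialLieModule k g₀ k) n, U)) :
    mulTensor δ hδ W hj U (TensorSec.tmul s t) = mulSec W hj U s t := rfl

/-- Multiplication as a morphism of presheaves. -/
def mulPre : tensorPresheaf (projAction δ hδ) (twist W δ hδ j).sheaf (lineBundle δ hδ n).sheaf ⟶
    twistPre 𝒜 W j' where
  app U := ModuleCat.ofHom (mulTensor δ hδ W hj U.unop)
  naturality U V i := ModuleCat.hom_ext (TensorSec.linearMap_ext fun s t => rfl)

end MulSec

/-! ### Multiplication is an isomorphism of sheaves -/

section LocalTensor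
variable {k g₀ A : Type u} [Field k] [LieRing g₀] [LieAlgebra k g₀] [CommRing A] [Algebra k A]
  {𝒜 : ℕ → Submodule k A} [GradedAlgebra 𝒜]
  (δ : g₀ →ₗ⁅k⁆ Derivation k A A) (hδ : ∀ x n, ∀ a ∈ 𝒜 n, δ x a ∈ 𝒜 n)
  {W : Type u} [AddCommGroup W] [Module k W] [LieRingModule g₀ W] [LieModule k g₀ W]
  {j n j' : ℤ} (hj : j' = j + n)

/-- The section of `W ⊗ 𝒪(j)` with given values. -/
def twMk {j : ℤ} {U : (Proj 𝒜).Opens} (s : twistSub 𝒜 W j U) : Γ(twistSheaf 𝒜 W j, U) :=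
  ⟨s.1, s.2⟩

theorem twVal_twMk {j : ℤ} {U : (Proj 𝒜).Opens} (s : twistSub 𝒜 W j U) (p hp) :
    twVal (twMk s) p hp = tsVal s p hp := rfl

/-- The section `fⁿ w` of `W ⊗ 𝒪(n)` on an open subset on which the linear form `f` does not
vanish. -/
def powTmul {f : A} (hf : f ∈ 𝒜 1) (n : ℤ) {U : (Proj 𝒜).Opens}
    (hU : U ≤ ProjectiveSpectrum.basicOpen 𝒜 f) (w : W) : Γ(twistSheaf 𝒜 W n, U) :=
  ⟨fun p => powAt f n p.1 ⊗ₜ w, (isScalarSec_powAt hf n hU).tmul_mem w⟩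

theorem twVal_powTmul {f : A} (hf : f ∈ 𝒜 1) (n : ℤ) {U : (Proj 𝒜).Opens}
    (hU : U ≤ ProjectiveSpectrum.basicOpen 𝒜 f) (w : W) (p hp) :
    twVal (powTmul hf n hU w) p hp = powAt f n p ⊗ₜ w := rfl

/-- Multiplication by `fⁿ` on sections of `W ⊗ 𝒪(j)`. -/
def powSmul {f : A} (hf : f ∈ 𝒜 1) (n : ℤ) {j j' : ℤ} (hj : j' = j + n) {U : (Proj 𝒜).Opens}
    (hU : U ≤ ProjectiveSpectrum.basicOpen 𝒜 f) (s : twistSub 𝒜 W j U) :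
    twistSub 𝒜 W j' U :=
  ⟨fun p => powAt f n p.1 • s.1 p, (isScalarSec_powAt hf n hU).smul_mem hj s.2⟩

theorem tsVal_powSmul {f : A} (hf : f ∈ 𝒜 1) (n : ℤ) {j j' : ℤ} (hj : j' = j + n)
    {U : (Proj 𝒜).Opens} (hU : U ≤ ProjectiveSpectrum.basicOpen 𝒜 f) (s : twistSub 𝒜 W j U)
    (p hp) : tsVal (powSmul hf n hj hU s) p hp = powAt f n p • tsVal s p hp := rfl

/-- On an open subset on which the linear form `f` does not vanish, `fⁿ` generates `𝒪(n)`. -/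
theorem exists_eq_smul_powTmul {f : A} (hf : f ∈ 𝒜 1) (n : ℤ) {U : (Proj 𝒜).Opens}
    (hU : U ≤ ProjectiveSpectrum.basicOpen 𝒜 f)
    (t : Γ(twistSheaf 𝒜 (TrivialLieModule k g₀ k) n, U)) :
    ∃ r : Γ(Proj 𝒜, U), t = r • powTmul hf n hU (trivOne k g₀) := by
  have h : IsScalarSec 𝒜 0 U
      (fun p => scal k g₀ (Loc 𝒜 p.1) (twVal t p.1 p.2) * powAt f (-n) p.1) :=
    IsScalarSec.mul (by ring) (isScalarSec_scal t.2) (isScalarSec_powAt hf (-n) hU)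
  obtain ⟨r, hr⟩ := h.exists_sec
  refine ⟨r, tw_ext fun p hp => ?_⟩
  rw [twVal_smul, twVal_powTmul, hr p hp, TensorProduct.smul_tmul', smul_eq_mul, mul_assoc,
    powAt_neg_mul, mul_one, scal_tmul_trivOne]

theorem exists_eq_tmul_powTmul {f : A} (hf : f ∈ 𝒜 1) (n : ℤ) {U : (Proj 𝒜).Opens}
    (hU : U ≤ ProjectiveSpectrum.basicOpen 𝒜 f)
    (t : TensorSec (projAction δ hδ) (twistSheaf 𝒜 W j)
      (twistSheaf 𝒜 (TrivialLieModule k g₀ k) n) U) :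
    ∃ s : Γ(twistSheaf 𝒜 W j, U), t = TensorSec.tmul s (powTmul hf n hU (trivOne k g₀)) := by
  induction t using TensorSec.ind with
  | zero => exact ⟨0, (TensorSec.zero_tmul _).symm⟩
  | add s t hs ht =>
    obtain ⟨s, rfl⟩ := hs
    obtain ⟨t, rfl⟩ := ht
    exact ⟨s + t, (TensorSec.add_tmul _ _ _).symm⟩
  | tmul s t =>
    obtain ⟨r, rfl⟩ := exists_eq_smul_powTmul hf n hU t
    exact ⟨r • s, TensorSec.tmul_smul r s _⟩

theorem tsVal_mulSec_powTmul {f : A} (hf : f ∈ 𝒜 1) {U : (Proj 𝒜).Opens}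
    (hU : U ≤ ProjectiveSpectrum.basicOpen 𝒜 f) (s : Γ(twistSheaf 𝒜 W j, U)) (p hp) :
    tsVal (mulSec W hj U s (powTmul hf n hU (trivOne k g₀))) p hp =
      powAt f n p • twVal s p hp := by
  rw [tsVal_mulSec, twVal_powTmul, scal_tmul_one]

/-- On an open subset on which the linear form `f` does not vanish, the inverse of multiplication is
`s ↦ f⁻ⁿ s ⊗ fⁿ`. -/
theorem mulTensor_bijective {f : A} (hf : f ∈ 𝒜 1) {U : (Proj 𝒜).Opens}
    (hU : U ≤ ProjectiveSpectrum.basicOpen 𝒜 f) :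
    Function.Bijective (mulTensor δ hδ W hj U) := by
  constructor
  · rw [injective_iff_map_eq_zero]
    intro t ht
    obtain ⟨s, rfl⟩ := exists_eq_tmul_powTmul δ hδ hf n hU t
    have hs : s = 0 := tw_ext fun p hp => by
      have ht' : mulSec W hj U s (powTmul hf n hU (trivOne k g₀)) = 0 := ht
      have := congrArg (fun z => powAt f (-n) p • tsVal z p hp) ht'
      rwa [tsVal_mulSec_powTmul, smul_smul, powAt_neg_mul, one_smul, tsVal_zero, smul_zero] at this
    rw [hs]
    exact TensorSec.zero_tmul _
  · intro s
    refine ⟨TensorSec.tmul (twMk (powSmul hf (-n) (by omega) hU s))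
      (powTmul hf n hU (trivOne k g₀)), ?_⟩
    refine ts_ext fun p hp => ?_
    rw [mulTensor_tmul, tsVal_mulSec_powTmul, twVal_twMk, tsVal_powSmul, smul_smul, powAt_mul_neg,
      one_smul]

/-- Every point lies on an open subset of the form `D₊(f)` for a linear form `f`. -/
def CoveredByLinear (𝒜 : ℕ → Submodule k A) [GradedAlgebra 𝒜] : Prop :=
  ∀ p : ProjectiveSpectrum 𝒜, ∃ f ∈ 𝒜 1, f ∉ p.asHomogeneousIdeal

variable (h𝒜 : CoveredByLinear 𝒜)
include h𝒜

/-- Multiplication is locally bijective, hence becomes an isomorphism on associated sheaves. -/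
theorem W_mulPre : (Opens.grothendieckTopology (Proj 𝒜)).W (mulPre δ hδ W hj) := by
  rw [GrothendieckTopology.W_iff_isLocallyBijective]
  constructor
  · constructor
    intro U x y hxy p hp
    obtain ⟨f, hf, hfp⟩ := h𝒜 p
    have hV : U.unop ⊓ ProjectiveSpectrum.basicOpen 𝒜 f ≤ ProjectiveSpectrum.basicOpen 𝒜 f :=
      inf_le_right
    refine ⟨U.unop ⊓ ProjectiveSpectrum.basicOpen 𝒜 f, Opens.infLELeft _ _, ?_, hp, hfp⟩
    apply (mulTensor_bijective δ hδ (W := W) hj hf hV).1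
    have hn (z) := congrArg (fun t => t.hom z) ((mulPre δ hδ W hj).naturality
      (Opens.infLELeft U.unop (ProjectiveSpectrum.basicOpen 𝒜 f)).op)
    exact (hn x).trans ((congrArg (twistSub.res W j' (Opens.infLELeft U.unop _)) hxy).trans
      (hn y).symm)
  · constructor
    intro U s p hp
    obtain ⟨f, hf, hfp⟩ := h𝒜 p
    have hV : U ⊓ ProjectiveSpectrum.basicOpen 𝒜 f ≤ ProjectiveSpectrum.basicOpen 𝒜 f :=
      inf_le_right
    exact ⟨U ⊓ ProjectiveSpectrum.basicOpen 𝒜 f, Opens.infLELeft _ _,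
      (mulTensor_bijective δ hδ (W := W) hj hf hV).2 _, hp, hfp⟩

omit h𝒜
variable (W) in
/-- The morphism from the sheaf associated to `U ↦ Γ(U, W ⊗ 𝒪(j)) ⊗ Γ(U, 𝒪(n))` to
`W ⊗ 𝒪(j + n)`. -/
def sheafMul : sheafify (Opens.grothendieckTopology (Proj 𝒜))
    (tensorPresheaf (projAction δ hδ) (twist W δ hδ j).sheaf (lineBundle δ hδ n).sheaf) ⟶
      twistPre 𝒜 W j' :=
  sheafifyLift _ (mulPre δ hδ W hj) (twistPre_isSheaf W j')
include h𝒜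

theorem isIso_sheafMul : IsIso (sheafMul δ hδ W hj) := by
  have h1 : sheafMul δ hδ W hj = sheafifyMap _ (mulPre δ hδ W hj) ≫
      (isoSheafify (Opens.grothendieckTopology (Proj 𝒜)) (twistPre_isSheaf W j')).inv := by
    rw [isoSheafify_inv, sheafifyMap_sheafifyLift, Category.comp_id]
    rfl
  have h2 : IsIso ((presheafToSheaf (Opens.grothendieckTopology (Proj 𝒜)) _).map
    (mulPre δ hδ W hj)) := (GrothendieckTopology.W_iff _ _).1 (W_mulPre δ hδ hj h𝒜)
  have h3 : IsIso (sheafifyMap (Opens.grothendieckTopology (Proj 𝒜)) (mulPre δ hδ W hj)) :=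
    inferInstanceAs (IsIso ((sheafToPresheaf _ _).map ((presheafToSheaf
      (Opens.grothendieckTopology (Proj 𝒜)) _).map (mulPre δ hδ W hj))))
  rw [h1]
  infer_instance

end LocalTensor

/-! ### Global sections of `W ⊗ 𝒪(j) ⊗ 𝒪(n)` -/

section TensorSh
variable {k g₀ : Type u} [Field k] [LieRing g₀] [LieAlgebra k g₀] {X : Scheme.{u}}
  {α : SchemeAction k g₀ X} {M N M' N' : X.Modules} {U V : X.Opens}

/-- The sections over `U` of the sheaf associated to `U ↦ M(U) ⊗ N(U)`. -/
def TensorSh (α : SchemeAction k g₀ X) (M N : X.Modules) (U : X.Opens) : Type u :=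
  ((sheafify (Opens.grothendieckTopology X) (tensorPresheaf α M N)).obj (op U) : ModuleCat.{u} k)

instance : AddCommGroup (TensorSh α M N U) :=
  inferInstanceAs (AddCommGroup
    ((sheafify (Opens.grothendieckTopology X) (tensorPresheaf α M N)).obj (op U) : ModuleCat.{u} k))

instance : Module k (TensorSh α M N U) :=
  inferInstanceAs (Module k
    ((sheafify (Opens.grothendieckTopology X) (tensorPresheaf α M N)).obj (op U) : ModuleCat.{u} k))

/-- Restriction of sections of `M ⊗ N`. -/
def TensorSh.res (i : U ⟶ V) : TensorSh α M N V →ₗ[k] TensorSh α M N U :=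
  ((sheafify (Opens.grothendieckTopology X) (tensorPresheaf α M N)).map i.op).hom

/-- The section of `M ⊗ N` given by an element of `M(U) ⊗ N(U)`. -/
def TensorSh.of : TensorSec α M N U →ₗ[k] TensorSh α M N U :=
  ((toSheafify (Opens.grothendieckTopology X) (tensorPresheaf α M N)).app (op U)).hom

/-- The map of sections of associated sheaves given by a map of presheaves. -/
def TensorSh.map (η : tensorPresheaf α M N ⟶ tensorPresheaf α M' N') (U : X.Opens) :
    TensorSh α M N U →ₗ[k] TensorSh α M' N' U :=
  ((sheafifyMap (Opens.grothendieckTopology X) η).app (op U)).hom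

theorem TensorSh.map_res (η : tensorPresheaf α M N ⟶ tensorPresheaf α M' N') (i : U ⟶ V)
    (z : TensorSh α M N V) : map η U (res i z) = res i (map η V z) :=
  congrArg (fun t => t.hom z)
    ((sheafifyMap (Opens.grothendieckTopology X) η).naturality i.op)

theorem TensorSh.map_of (η : tensorPresheaf α M N ⟶ tensorPresheaf α M' N')
    (t : TensorSec α M N U) : map η U (of t) = of ((η.app (op U)).hom t) :=
  (congrArg (fun ζ => (ζ.app (op U)).hom t)
    (toSheafify_naturality (Opens.grothendieckTopology X) η)).symm

theorem TensorSh.map_of_tmul (f : M ⟶ M') (g : N ⟶ N') (m : Γ(M, U)) (n : Γ(N, U)) :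
    map (tensorPresheafMap α f g) U (of (TensorSec.tmul m n)) =
      of (TensorSec.tmul (f.app U m) (g.app U n)) :=
  map_of _ _

theorem TensorSh.res_map_of_eq (f : M ⟶ M') (g : N ⟶ N') {i : U ⟶ V} {s : TensorSh α M N V}
    {m : Γ(M, U)} {n : Γ(N, U)} (h : res i s = of (TensorSec.tmul m n)) :
    res i (map (tensorPresheafMap α f g) V s) = of (TensorSec.tmul (f.app U m) (g.app U n)) := by
  rw [← map_res, h, map_of_tmul]

end TensorSh

section GlobalSections
variable {k g₀ A : Type u} [Field k] [LieRing g₀] [LieAlgebra k g₀] [CommRing A] [Algebra k A]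
  {𝒜 : ℕ → Submodule k A} [GradedAlgebra 𝒜]
  {δ : g₀ →ₗ⁅k⁆ Derivation k A A} {hδ : ∀ x n, ∀ a ∈ 𝒜 n, δ x a ∈ 𝒜 n}
  {W : Type u} [AddCommGroup W] [Module k W] [LieRingModule g₀ W] [LieModule k g₀ W]
  {W' : Type u} [AddCommGroup W'] [Module k W'] [LieRingModule g₀ W'] [LieModule k g₀ W']
  (h𝒜 : CoveredByLinear 𝒜)

/-- The isomorphism `Γ(W ⊗ 𝒪(j) ⊗ 𝒪(n)) ≅ Γ(W ⊗ 𝒪(j + n))` given by multiplication. -/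
def globalMul {j n j' : ℤ} (hj : j' = j + n) :
    TwistΓ (twist W δ hδ j) n ≃ₗ[k] twistSub 𝒜 W j' ⊤ :=
  haveI := isIso_sheafMul δ hδ (W := W) hj h𝒜
  ((asIso (sheafMul δ hδ W hj)).app (op ⊤)).toLinearEquiv

/-- The value of `sheafMul` on sections over `U`. -/
def sheafMulAt (δ : g₀ →ₗ⁅k⁆ Derivation k A A) (hδ : ∀ x n, ∀ a ∈ 𝒜 n, δ x a ∈ 𝒜 n)
    {j n j' : ℤ} (hj : j' = j + n) (U : (Proj 𝒜).Opens) :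
    TensorSh (projAction δ hδ) (twistSheaf 𝒜 W j) (twistSheaf 𝒜 (TrivialLieModule k g₀ k) n) U
      →ₗ[k] twistSub 𝒜 W j' U :=
  ((sheafMul δ hδ W hj).app (op U)).hom

theorem sheafMulAt_of {j n j' : ℤ} (hj : j' = j + n) (U : (Proj 𝒜).Opens)
    (t : TensorSec (projAction δ hδ) (twistSheaf 𝒜 W j)
      (twistSheaf 𝒜 (TrivialLieModule k g₀ k) n) U) :
    sheafMulAt δ hδ hj U (TensorSh.of t) = mulTensor δ hδ W hj U t := by
  have h := toSheafify_sheafifyLift (Opens.grothendieckTopology (Proj 𝒜)) (mulPre δ hδ W hj)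
    (twistPre_isSheaf W j')
  exact congrArg (fun θ => (θ.app (op U)).hom t) h

theorem sheafMulAt_res {j n j' : ℤ} (hj : j' = j + n) {U V : (Proj 𝒜).Opens} (i : U ⟶ V)
    (z : TensorSh (projAction δ hδ) (twistSheaf 𝒜 W j)
      (twistSheaf 𝒜 (TrivialLieModule k g₀ k) n) V) :
    sheafMulAt δ hδ hj U (TensorSh.res i z) = twistSub.res W j' i (sheafMulAt δ hδ hj V z) :=
  congrArg (fun t => t.hom z) ((sheafMul δ hδ W hj).naturality i.op)

include h𝒜 in
theorem sheafMulAt_injective {j n j' : ℤ} (hj : j' = j + n) (U : (Proj 𝒜).Opens) :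
    Function.Injective (sheafMulAt δ hδ (W := W) hj U) := by
  have := isIso_sheafMul δ hδ (W := W) hj h𝒜
  exact ((asIso (sheafMul δ hδ W hj)).app (op U)).toLinearEquiv.injective

/-- Multiplication is compatible with maps of presheaves. -/
theorem globalMul_sheafifyΓ {j n l j' n' l' : ℤ} (hj : l = j + n) (hj' : l' = j' + n')
    (η : tensorPresheaf (projAction δ hδ) (twist W δ hδ j).sheaf (lineBundle δ hδ n).sheaf ⟶
      tensorPresheaf (projAction δ hδ) (twist W' δ hδ j').sheaf (lineBundle δ hδ n').sheaf)
    (θ : twistPre 𝒜 W l ⟶ twistPre 𝒜 W' l')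
    (h : mulPre δ hδ W hj ≫ θ = η ≫ mulPre δ hδ W' hj') (s : TwistΓ (twist W δ hδ j) n) :
    globalMul (δ := δ) (hδ := hδ) (W := W') h𝒜 hj' (sheafifyΓ η s) =
      (θ.app (op ⊤)).hom (globalMul h𝒜 hj s) := by
  have : sheafMul δ hδ W hj ≫ θ =
      sheafifyMap (Opens.grothendieckTopology (Proj 𝒜)) η ≫ sheafMul δ hδ W' hj' := by
    refine sheafify_hom_ext (Opens.grothendieckTopology (Proj 𝒜)) _ _ (twistPre_isSheaf W' l') ?_
    have h1 := toSheafify_sheafifyLift (Opens.grothendieckTopology (Proj 𝒜)) (mulPre δ hδ W hj)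
      (twistPre_isSheaf W l)
    have h2 := toSheafify_sheafifyLift (Opens.grothendieckTopology (Proj 𝒜)) (mulPre δ hδ W' hj')
      (twistPre_isSheaf W' l')
    have h3 := toSheafify_naturality (Opens.grothendieckTopology (Proj 𝒜)) η
    exact (Category.assoc _ _ _).symm.trans <| (congrArg (· ≫ θ) h1).trans <| h.trans <|
      (congrArg (η ≫ ·) h2.symm).trans <| (Category.assoc _ _ _).symm.trans <|
      (congrArg (· ≫ sheafMul δ hδ W' hj') h3).trans (Category.assoc _ _ _)
  exact (congrArg (fun ζ => (ζ.app (op ⊤)).hom s) this).symm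

/-- The map of sheaves of vector spaces given by a family of linear maps on the `A_p ⊗ W`. -/
def twistPreMap {l l' : ℤ} (T : ∀ p : ProjectiveSpectrum 𝒜, Loc 𝒜 p ⊗[k] W →ₗ[k] Loc 𝒜 p ⊗[k] W')
    (hT : ∀ (U : (Proj 𝒜).Opens) (s : ∀ p : U, Loc 𝒜 p.1 ⊗[k] W), s ∈ twistSections 𝒜 W l U →
      (fun p : U => T p.1 (s p)) ∈ twistSections 𝒜 W' l' U) :
    twistPre 𝒜 W l ⟶ twistPre 𝒜 W' l' where
  app U := ModuleCat.ofHom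
    { toFun := fun s => ⟨fun p => T p.1 (s.1 p), hT U.unop s.1 s.2⟩
      map_add' := fun s t => Subtype.ext (funext fun p => map_add (T p.1) _ _)
      map_smul' := fun c s => Subtype.ext (funext fun p => map_smul (T p.1) c _) }
  naturality U V i := rfl

variable (W) in
/-- The action of `x : g₀` on `A_p ⊗ W`. -/
def locAct (δ : g₀ →ₗ⁅k⁆ Derivation k A A) (x : g₀) (p : ProjectiveSpectrum 𝒜) :
    Loc 𝒜 p ⊗[k] W →ₗ[k] Loc 𝒜 p ⊗[k] W :=
  tensorAct (locDerivation (δ x) p.asHomogeneousIdeal.toIdeal.primeCompl) x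

theorem tensorAct_mem_twistSections (hδ : ∀ x n, ∀ a ∈ 𝒜 n, δ x a ∈ 𝒜 n) (l : ℤ) (x : g₀)
    (U : (Proj 𝒜).Opens) (s : ∀ p : U, Loc 𝒜 p.1 ⊗[k] W) (hs : s ∈ twistSections 𝒜 W l U) :
    (fun p : U => locAct W δ x p.1 (s p)) ∈ twistSections 𝒜 W l U :=
  (twistAct δ hδ l x U ⟨s, hs⟩).2

theorem famMap_mem_twistSections {ι : Type*} [Fintype ι] (c : ι → A) (f : ι → W →ₗ[k] W') (m : ℕ)
    (hc : ∀ i, c i ∈ 𝒜 m) {l l' : ℤ} (hl : l' = l + m) (U : (Proj 𝒜).Opens)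
    (s : ∀ p : U, Loc 𝒜 p.1 ⊗[k] W) (hs : s ∈ twistSections 𝒜 W l U) :
    (fun p : U => famMap (Loc 𝒜 p.1) c f (s p)) ∈ twistSections 𝒜 W' l' U :=
  ((famHom c f m hc hl).app U (⟨s, hs⟩ : Γ(twistSheaf 𝒜 W l, U))).2

variable (δ hδ) in
theorem mulSec_act {j n l : ℤ} (hj : l = j + n) (x : g₀) (U : (Proj 𝒜).Opens)
    (m : Γ(twistSheaf 𝒜 W j, U)) (t : Γ(twistSheaf 𝒜 (TrivialLieModule k g₀ k) n, U))
    (p : ProjectiveSpectrum 𝒜) (hp : p ∈ U) :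
    locAct W δ x p (tsVal (mulSec W hj U m t) p hp) =
      tsVal (mulSec W hj U (twistAct δ hδ j x U m) t + mulSec W hj U m (twistAct δ hδ n x U t))
        p hp := by
  rw [tsVal_add, tsVal_mulSec, tsVal_mulSec,
    tsVal_mulSec, locAct, tensorAct_smul, twVal_twistAct, twVal_twistAct, scal_tensorAct, add_comm]

variable (δ hδ) in
theorem mulTensor_act {j n l : ℤ} (hj : l = j + n) (x : g₀) (U : (Proj 𝒜).Opens)
    (m : Γ(twistSheaf 𝒜 W j, U)) (t : Γ(twistSheaf 𝒜 (TrivialLieModule k g₀ k) n, U)) :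
    mulTensor δ hδ W hj U (TensorSec.act (twist W δ hδ j) (lineBundle δ hδ n) x U
      (TensorSec.tmul m t)) =
      mulSec W hj U (twistAct δ hδ j x U m) t + mulSec W hj U m (twistAct δ hδ n x U t) :=
  map_add (mulTensor δ hδ W hj U) (TensorSec.tmul (twistAct δ hδ j x U m) t)
    (TensorSec.tmul m (twistAct δ hδ n x U t))

theorem mulSec_mulTwistHom {j n l n' l' : ℤ} (hj : l = j + n) (hj' : l' = j + n')
    (hn : n' = n + 1) (a : 𝒜 1) (U : (Proj 𝒜).Opens)
    (m : Γ(twistSheaf 𝒜 W j, U)) (t : Γ(twistSheaf 𝒜 (TrivialLieModule k g₀ k) n, U))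
    (p : ProjectiveSpectrum 𝒜) (hp : p ∈ U) :
    algebraMap A (Loc 𝒜 p) a • tsVal (mulSec W hj U m t) p hp =
      tsVal (mulSec W hj' U m ((mulTwistHom g₀ a hn).app U t)) p hp := by
  rw [tsVal_mulSec, tsVal_mulSec, twVal_mulTwistHom, map_smul, smul_smul, smul_eq_mul]

theorem mulSec_famHom {ι : Type*} [Fintype ι] {c : ι → A} {f : ι → W →ₗ[k] W'} {m : ℕ}
    (hc : ∀ i, c i ∈ 𝒜 m) {j j' n l l' : ℤ} (hl : l = j + n) (hl' : l' = j' + n)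
    (hm : j' = j + m) (U : (Proj 𝒜).Opens)
    (s : Γ(twistSheaf 𝒜 W j, U)) (t : Γ(twistSheaf 𝒜 (TrivialLieModule k g₀ k) n, U))
    (p : ProjectiveSpectrum 𝒜) (hp : p ∈ U) :
    famMap (Loc 𝒜 p) c f (tsVal (mulSec W hl U s t) p hp) =
      tsVal (mulSec W' hl' U ((famHom c f m hc hm).app U s) t) p hp := by
  rw [tsVal_mulSec, tsVal_mulSec, map_smul, twVal_famHom]

theorem tsVal_globalMul_lie {j n l : ℤ} (hj : l = j + n) (x : g₀)
    (s : TwistΓ (twist W δ hδ j) n) (p : ProjectiveSpectrum 𝒜) (hp) :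
    tsVal (globalMul h𝒜 hj ⁅x, s⁆) p hp =
      locAct W δ x p (tsVal (globalMul h𝒜 hj s) p hp) := by
  have h := globalMul_sheafifyΓ h𝒜 hj hj (tensorPresheafAct (twist W δ hδ j) (lineBundle δ hδ n) x)
    (twistPreMap (locAct W δ x)
      (tensorAct_mem_twistSections hδ l x)) ?_ s
  · exact congrArg (fun t => tsVal t p hp) h
  · refine tensorPresheaf_hom_ext _ fun U m t => ts_ext fun p hp => ?_
    refine (mulSec_act δ hδ hj x U m t p hp).trans (congrArg (fun z => tsVal z p hp) ?_)
    exact (mulTensor_act δ hδ hj x U m t).symm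

theorem tsVal_globalMul_mul {j n l n' l' : ℤ} (hj : l = j + n) (hj' : l' = j + n')
    (hn : n' = n + 1) (a : 𝒜 1) (s : TwistΓ (twist W δ hδ j) n) (p : ProjectiveSpectrum 𝒜) (hp) :
    tsVal (globalMul h𝒜 hj' (TwistΓ.mul (twist W δ hδ j) hn a s)) p hp =
      algebraMap A (Loc 𝒜 p) a • tsVal (globalMul h𝒜 hj s) p hp := by
  have h := globalMul_sheafifyΓ h𝒜 hj hj'
    (tensorPresheafMap (projAction δ hδ) (𝟙 (twist W δ hδ j).sheaf) (mulHom δ hδ a hn))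
    (twistPreMap (fun p => algebraMap A (Loc 𝒜 p) a • LinearMap.id) fun U s hs =>
      IsScalarSec.smul_mem (by omega) (isScalarSec_algebraMap a.2 U) hs) ?_ s
  · exact congrArg (fun t => tsVal t p hp) h
  · refine tensorPresheaf_hom_ext _ fun U m t => ts_ext fun p hp => ?_
    exact mulSec_mulTwistHom hj hj' hn a U m t p hp

theorem tsVal_globalMul_map_fam {ι : Type*} [Fintype ι] {c : ι → A} {f : ι → W →ₗ[k] W'} {m : ℕ}
    (hc : ∀ i, c i ∈ 𝒜 m) {j j' n l l' : ℤ} (hl : l = j + n) (hl' : l' = j' + n)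
    (φ : twist W δ hδ j ⟶ twist W' δ hδ j') (hm : j' = j + m)
    (hφ : EquivModule.Hom.hom φ = famHom c f m hc hm)
    (s : TwistΓ (twist W δ hδ j) n) (p : ProjectiveSpectrum 𝒜) (hp) :
    tsVal (globalMul h𝒜 hl' (TwistΓ.map φ n s)) p hp =
      famMap (Loc 𝒜 p) c f (tsVal (globalMul h𝒜 hl s) p hp) := by
  have h := globalMul_sheafifyΓ h𝒜 hl hl'
    (tensorPresheafMap (projAction δ hδ) (EquivModule.Hom.hom φ) (𝟙 (lineBundle δ hδ n).sheaf))
    (twistPreMap (fun p => (famMap (Loc 𝒜 p) c f).restrictScalars k)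
      (famMap_mem_twistSections c f m hc (by omega))) ?_ s
  · exact congrArg (fun t => tsVal t p hp) h
  · refine tensorPresheaf_hom_ext _ fun U s t => ts_ext fun p hp => ?_
    rw [hφ]
    exact mulSec_famHom hc hl hl' hm U s t p hp

/-- The section `1 ⊗ w` of `W ⊗ 𝒪`. -/
def oneTmul (w : W) {l : ℤ} (hl : l = 0) : twistSub 𝒜 W l ⊤ :=
  ⟨fun p => 1 ⊗ₜ w, by
    subst hl
    have h := (isScalarSec_algebraMap (𝒜 := 𝒜) (SetLike.GradedOne.one_mem) ⊤).tmul_mem w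
    simp only [map_one] at h
    exact h⟩

theorem tsVal_oneTmul (w : W) {l : ℤ} (hl : l = 0) (p hp) :
    tsVal (oneTmul (𝒜 := 𝒜) w hl) p hp = 1 ⊗ₜ w := rfl

/-- A morphism `W ⊗ 𝒪(j) → W' ⊗ 𝒪(j')` is given on the section `fʲ w` by the global sections it
induces after twisting by `-j`. -/
theorem twVal_hom_powTmul {j j' n l l' : ℤ} (hl : l = j + n) (hl0 : l = 0) (hl' : l' = j' + n)
    (φ : twist W δ hδ j ⟶ twist W' δ hδ j') {f : A} (hf : f ∈ 𝒜 1) {U : (Proj 𝒜).Opens}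
    (hU : U ≤ ProjectiveSpectrum.basicOpen 𝒜 f) (w : W) (p : ProjectiveSpectrum 𝒜) (hp : p ∈ U) :
    twVal (W := W') (j := j') ((EquivModule.Hom.hom φ).app U (powTmul hf j hU w)) p hp =
      powAt f j p • tsVal (globalMul h𝒜 hl' (TwistΓ.map φ n
        ((globalMul h𝒜 hl).symm (oneTmul w hl0)))) p trivial := by
  set s := (globalMul (δ := δ) (hδ := hδ) (W := W) h𝒜 hl).symm (oneTmul w hl0) with hs
  set i : U ⟶ ⊤ := homOfLE le_top
  let t : TensorSec (projAction δ hδ) (twistSheaf 𝒜 W j)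
      (twistSheaf 𝒜 (TrivialLieModule k g₀ k) n) U :=
    TensorSec.tmul (powTmul hf j hU w) (powTmul hf n hU (trivOne k g₀))
  -- on `U` the section `s` is the product of `fʲ w` and `f⁻ʲ`
  have h1 : TensorSh.res i s = TensorSh.of t := by
    apply sheafMulAt_injective h𝒜 hl U
    rw [sheafMulAt_of]
    refine (sheafMulAt_res hl i s).trans ?_
    have h3 : sheafMulAt δ hδ hl ⊤ s = oneTmul w hl0 := (globalMul h𝒜 hl).apply_symm_apply _
    rw [h3]
    refine ts_ext fun q hq => ?_
    change (1 : Loc 𝒜 q) ⊗ₜ[k] w = tsVal (mulSec W hl U (powTmul hf j hU w)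
      (powTmul hf n hU (trivOne k g₀))) q hq
    rw [tsVal_mulSec_powTmul, twVal_powTmul, TensorProduct.smul_tmul', smul_eq_mul, ← powAt_add,
      show n + j = 0 by omega, powAt_zero]
  have h4 : TensorSh.res i (TwistΓ.map φ n s) =
      TensorSh.of (TensorSec.tmul ((EquivModule.Hom.hom φ).app U (powTmul hf j hU w))
        (powTmul hf n hU (trivOne k g₀))) := by
    exact TensorSh.res_map_of_eq (M' := twistSheaf 𝒜 W' j')
      (N' := twistSheaf 𝒜 (TrivialLieModule k g₀ k) n) (EquivModule.Hom.hom φ)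
      (𝟙 (twistSheaf 𝒜 (TrivialLieModule k g₀ k) n)) h1
  have h5 := congrArg (fun z => tsVal z p hp) (congrArg (sheafMulAt δ hδ hl' U) h4)
  have h6 : tsVal (globalMul h𝒜 hl' (TwistΓ.map φ n s)) p trivial =
      powAt f n p • twVal (W := W') (j := j')
        ((EquivModule.Hom.hom φ).app U (powTmul hf j hU w)) p hp :=
    (congrArg (fun z => tsVal z p hp) (sheafMulAt_res hl' i _)).symm.trans (h5.trans
      ((congrArg (fun z => tsVal z p hp) (sheafMulAt_of hl' U _)).trans
        (tsVal_mulSec_powTmul hl' hf hU _ p hp)))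
  rw [h6, smul_smul, ← powAt_add, show j + n = 0 by omega, powAt_zero, one_smul]

end GlobalSections

/-! ### Morphisms between the sheaves `W ⊗ 𝒪(j)` -/

section Pointwise
variable {k g₀ A : Type u} [Field k] [LieRing g₀] [LieAlgebra k g₀] [CommRing A] [Algebra k A]
  {𝒜 : ℕ → Submodule k A} [GradedAlgebra 𝒜]
  {W : Type u} [AddCommGroup W] [Module k W]
  {W' : Type u} [AddCommGroup W'] [Module k W']
  (h𝒜 : CoveredByLinear 𝒜)

theorem twVal_map {j : ℤ} {U V : (Proj 𝒜).Opens} (i : U ⟶ V) (s : Γ(twistSheaf 𝒜 W j, V))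
    (p : ProjectiveSpectrum 𝒜) (hp : p ∈ U) :
    twVal ((twistSheaf 𝒜 W j).presheaf.map i.op s) p hp = twVal s p (i.le hp) := rfl

theorem app_map {j j' : ℤ} (ξ : twistSheaf 𝒜 W j ⟶ twistSheaf 𝒜 W' j') {U V : (Proj 𝒜).Opens}
    (i : U ⟶ V) (s : Γ(twistSheaf 𝒜 W j, V)) :
    ξ.app U ((twistSheaf 𝒜 W j).presheaf.map i.op s) =
      (twistSheaf 𝒜 W' j').presheaf.map i.op (ξ.app V s) :=
  congrArg (fun t => t.hom s) (ξ.mapPresheaf.naturality i.op)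

theorem isScalarSec_mk {i m : ℕ} {n : ℤ} {a b : A} (h : (i : ℤ) = m + n) (ha : a ∈ 𝒜 i)
    (hb : b ∈ 𝒜 m) {U : (Proj 𝒜).Opens} (hU : ∀ p : U, b ∉ p.1.asHomogeneousIdeal) :
    IsScalarSec 𝒜 n U (fun p => Localization.mk a ⟨b, hU p⟩) := fun p =>
  ⟨U, p.2, le_rfl, i, m, a, b, h, ha, hb, fun q => isScalarFracAt_of_eq_mk (hU q) rfl⟩

/-- On an open subset on which the linear form `f` and the form `b` do not vanish, a fraction with
denominator `b` is a combination of the sections `fʲ w`. -/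
theorem frac_induction {j : ℤ} {f b : A} (hf : f ∈ 𝒜 1) {i m : ℕ} (h : (i : ℤ) = m + j)
    (hb : b ∈ 𝒜 m) {U : (Proj 𝒜).Opens} (hU : U ≤ ProjectiveSpectrum.basicOpen 𝒜 f)
    (hbU : ∀ p : U, b ∉ p.1.asHomogeneousIdeal) {W₀ : Set W}
    {P : Γ(twistSheaf 𝒜 W j, U) → Prop} (hpow : ∀ w ∈ W₀, P (powTmul hf j hU w))
    (hsmul : ∀ (r : Γ(Proj 𝒜, U)) s, P s → P (r • s)) (hadd : ∀ s t, P s → P t → P (s + t))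
    (hzero : P 0)
    {a : A ⊗[k] W} (ha : a ∈ Submodule.span k {z | ∃ a ∈ 𝒜 i, ∃ w ∈ W₀, z = a ⊗ₜ[k] w}) :
    ∃ s, P s ∧ ∀ p hp, algebraMap A (Loc 𝒜 p) b • twVal s p hp = numMap 𝒜 W p a := by
  induction ha using Submodule.span_induction with
  | zero => exact ⟨0, hzero, fun p hp => by rw [map_zero]; exact smul_zero _⟩
  | add x y _ _ hx hy =>
    obtain ⟨s, hs, hs'⟩ := hx
    obtain ⟨t, ht, ht'⟩ := hy
    exact ⟨s + t, hadd s t hs ht, fun p hp => by rw [twVal_add, smul_add, hs', ht', map_add]⟩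
  | smul c x _ hx =>
    obtain ⟨s, hs, hs'⟩ := hx
    refine ⟨projScalar U c • s, hsmul _ s hs, fun p hp => ?_⟩
    rw [twVal_smul, projScalar_val, smul_comm, hs', algebraMap_smul, map_smul]
  | mem x hx =>
    obtain ⟨a, ha, w, hw, rfl⟩ := hx
    obtain ⟨r, hr⟩ := (IsScalarSec.mul (n' := 0) (by ring) (isScalarSec_mk h ha hb hbU)
      (isScalarSec_powAt hf (-j) hU)).exists_sec
    refine ⟨r • powTmul hf j hU w, hsmul _ _ (hpow w hw), fun p hp => ?_⟩
    have hp' : b ∉ p.asHomogeneousIdeal := hbU ⟨p, hp⟩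
    have e1 : algebraMap A (Loc 𝒜 p) b * Localization.mk a ⟨b, hp'⟩ = algebraMap A _ a :=
      (isScalarFracAt_of_eq_mk hp' rfl).2
    rw [twVal_smul, hr p hp, twVal_powTmul, TensorProduct.smul_tmul', TensorProduct.smul_tmul',
      smul_eq_mul, smul_eq_mul, mul_assoc, powAt_neg_mul, mul_one, e1]
    rfl

theorem numDeg_eq_span_univ (i : ℕ) : numDeg 𝒜 W i =
    Submodule.span k {z | ∃ a ∈ 𝒜 i, ∃ w ∈ (Set.univ : Set W), z = a ⊗ₜ[k] w} := by
  simp [numDeg]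

/-- Locally, a section of `W ⊗ 𝒪(j)` is a fraction. -/
theorem exists_frac {j : ℤ} {U : (Proj 𝒜).Opens} (s : Γ(twistSheaf 𝒜 W j, U))
    (p : ProjectiveSpectrum 𝒜) (hp : p ∈ U) : ∃ (V : (Proj 𝒜).Opens) (_ : p ∈ V) (hV : V ≤ U)
      (i m : ℕ) (a : A ⊗[k] W) (b : A), (i : ℤ) = m + j ∧ a ∈ numDeg 𝒜 W i ∧ b ∈ 𝒜 m ∧
        ∀ q (hq : q ∈ V), IsFracAt 𝒜 W q a b (twVal s q (hV hq)) := by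
  obtain ⟨V, hV, i, l, n, a, b, h, ha, hb, e⟩ := s.2 ⟨p, hp⟩
  exact ⟨V, hV, i.le, l, n, a, b, h, ha, hb, fun q hq => e ⟨q, hq⟩⟩

include h𝒜 in
/-- A morphism of sheaves of modules is given by linear maps on the `A_p ⊗ W` if this holds on the
sections `fʲ w`. -/
theorem twVal_app_of_powTmul {j j' : ℤ} (ξ : twistSheaf 𝒜 W j ⟶ twistSheaf 𝒜 W' j')
    (Θ : ∀ p : ProjectiveSpectrum 𝒜, Loc 𝒜 p ⊗[k] W →ₗ[Loc 𝒜 p] Loc 𝒜 p ⊗[k] W')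
    (hΘ : ∀ {f : A} (hf : f ∈ 𝒜 1) {U : (Proj 𝒜).Opens}
      (hU : U ≤ ProjectiveSpectrum.basicOpen 𝒜 f) (w : W) (p : ProjectiveSpectrum 𝒜) (hp : p ∈ U),
      twVal (ξ.app U (powTmul hf j hU w)) p hp = Θ p (powAt f j p ⊗ₜ w))
    {U : (Proj 𝒜).Opens} (s : Γ(twistSheaf 𝒜 W j, U)) (p : ProjectiveSpectrum 𝒜) (hp : p ∈ U) :
    twVal (ξ.app U s) p hp = Θ p (twVal s p hp) := by
  obtain ⟨f, hf, hfp⟩ := h𝒜 p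
  obtain ⟨V, hpV, hV, i, m, a, b, h, ha, hb, e⟩ := exists_frac s p hp
  let V' : (Proj 𝒜).Opens := V ⊓ ProjectiveSpectrum.basicOpen 𝒜 f
  have hV'f : V' ≤ ProjectiveSpectrum.basicOpen 𝒜 f := inf_le_right
  have hV'V : V' ≤ V := inf_le_left
  have hpV' : p ∈ V' := ⟨hpV, hfp⟩
  rw [numDeg_eq_span_univ] at ha
  obtain ⟨t, ht, ht'⟩ := frac_induction hf h hb hV'f (fun q => (e q.1 (hV'V q.2)).1)
    (P := fun t => ∀ q hq, twVal (ξ.app V' t) q hq = Θ q (twVal t q hq))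
    (fun w _ q hq => by rw [hΘ hf hV'f w q hq, twVal_powTmul])
    (fun r s hs q hq => by
      rw [Scheme.Modules.Hom.app_smul, twVal_smul, hs, twVal_smul, map_smul])
    (fun s t hs ht q hq => by rw [map_add, twVal_add, hs, ht, twVal_add, map_add])
    (fun q hq => by rw [map_zero]; exact (map_zero (Θ q)).symm) ha
  let i' : V' ⟶ U := homOfLE (hV'V.trans hV)
  have hs : (twistSheaf 𝒜 W j).presheaf.map i'.op s = t := tw_ext fun q hq => by
    apply (isUnit_algebraMap_loc (e q (hV'V hq)).1).smul_left_cancel.1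
    rw [ht' q hq, twVal_map, (e q (hV'V hq)).2]
  have h1 := ht p hpV'
  rw [← hs, app_map, twVal_map, twVal_map] at h1
  exact h1

end Pointwise

section HomAt
variable {k g₀ A : Type u} [Field k] [LieRing g₀] [LieAlgebra k g₀] [CommRing A] [Algebra k A]
  {𝒜 : ℕ → Submodule k A} [GradedAlgebra 𝒜]
  {δ : g₀ →ₗ⁅k⁆ Derivation k A A} {hδ : ∀ x n, ∀ a ∈ 𝒜 n, δ x a ∈ 𝒜 n}
  {W : Type u} [AddCommGroup W] [Module k W] [LieRingModule g₀ W] [LieModule k g₀ W]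
  {W' : Type u} [AddCommGroup W'] [Module k W'] [LieRingModule g₀ W'] [LieModule k g₀ W']
  (h𝒜 : CoveredByLinear 𝒜)

/-- The canonical map `W → Γ(W ⊗ 𝒪(j) ⊗ 𝒪(-j))`. -/
def unitΓ (δ : g₀ →ₗ⁅k⁆ Derivation k A A) (hδ : ∀ x n, ∀ a ∈ 𝒜 n, δ x a ∈ 𝒜 n)
    {j n : ℤ} (hn : (0 : ℤ) = j + n) : W →ₗ[k] TwistΓ (twist W δ hδ j) n :=
  (globalMul h𝒜 hn).symm.toLinearMap ∘ₗ
    { toFun := fun w => oneTmul w rfl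
      map_add' := fun w w' => ts_ext fun p hp => TensorProduct.tmul_add _ _ _
      map_smul' := fun c w => ts_ext fun p hp => TensorProduct.tmul_smul _ _ _ }

theorem globalMul_unitΓ {j n : ℤ} (hn : (0 : ℤ) = j + n) (w : W) :
    globalMul h𝒜 hn (unitΓ h𝒜 δ hδ hn w) = oneTmul w rfl :=
  (globalMul h𝒜 hn).apply_symm_apply _

/-- Evaluation of global sections at `p`. -/
def tsEval (W : Type u) [AddCommGroup W] [Module k W] (l : ℤ) (p : ProjectiveSpectrum 𝒜) :
    twistSub 𝒜 W l ⊤ →ₗ[k] Loc 𝒜 p ⊗[k] W where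
  toFun s := tsVal s p trivial
  map_add' _ _ := rfl
  map_smul' _ _ := rfl

/-- The map on `A_p ⊗ W` that a morphism `W ⊗ 𝒪(j) → W' ⊗ 𝒪(j')` induces. -/
def homAt {j j' n l' : ℤ} (hn : (0 : ℤ) = j + n) (hl' : l' = j' + n)
    (φ : twist W δ hδ j ⟶ twist W' δ hδ j') (p : ProjectiveSpectrum 𝒜) :
    Loc 𝒜 p ⊗[k] W →ₗ[Loc 𝒜 p] Loc 𝒜 p ⊗[k] W' :=
  LinearMap.liftBaseChange (Loc 𝒜 p) (tsEval W' l' p ∘ₗ (globalMul h𝒜 hl').toLinearMap ∘ₗ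
    TwistΓ.map φ n ∘ₗ unitΓ h𝒜 δ hδ hn)

theorem homAt_tmul {j j' n l' : ℤ} (hn : (0 : ℤ) = j + n) (hl' : l' = j' + n)
    (φ : twist W δ hδ j ⟶ twist W' δ hδ j') (p : ProjectiveSpectrum 𝒜) (b : Loc 𝒜 p) (w : W) :
    homAt h𝒜 hn hl' φ p (b ⊗ₜ w) =
      b • tsVal (globalMul h𝒜 hl' (TwistΓ.map φ n (unitΓ h𝒜 δ hδ hn w))) p trivial :=
  LinearMap.liftBaseChange_tmul _ _ _ _

/-- Every morphism `W ⊗ 𝒪(j) → W' ⊗ 𝒪(j')` is given pointwise by the linear maps `homAt`. -/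
theorem twVal_hom_app {j j' n l' : ℤ} (hn : (0 : ℤ) = j + n) (hl' : l' = j' + n)
    (φ : twist W δ hδ j ⟶ twist W' δ hδ j') {U : (Proj 𝒜).Opens} (s : Γ(twistSheaf 𝒜 W j, U))
    (p : ProjectiveSpectrum 𝒜) (hp : p ∈ U) :
    twVal (W := W') (j := j') ((EquivModule.Hom.hom φ).app U s) p hp =
      homAt h𝒜 hn hl' φ p (twVal s p hp) :=
  twVal_app_of_powTmul h𝒜 (EquivModule.Hom.hom φ) (homAt h𝒜 hn hl' φ)
    (@fun f hf U hU w p hp => (twVal_hom_powTmul h𝒜 hn rfl hl' φ hf hU w p hp).trans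
      (homAt_tmul h𝒜 hn hl' φ p _ w).symm) s p hp

include h𝒜 in
/-- A morphism `W ⊗ 𝒪(j) → W' ⊗ 𝒪(j')` is determined by the map on global sections it induces
after twisting by `-j`. -/
theorem twist_hom_ext_of_map {j j' n : ℤ} (hn : (0 : ℤ) = j + n)
    {φ ψ : twist W δ hδ j ⟶ twist W' δ hδ j'} (h : TwistΓ.map φ n = TwistΓ.map ψ n) : φ = ψ := by
  refine twist_hom_ext δ hδ fun U s p hp => ?_
  rw [twVal_hom_app h𝒜 hn rfl, twVal_hom_app h𝒜 hn rfl]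
  unfold homAt
  rw [h]

end HomAt

/-! ### The generic point and global sections -/

section Generic
variable {k A : Type u} [Field k] [CommRing A] [Algebra k A] [IsDomain A]
  {𝒜 : ℕ → Submodule k A} [GradedAlgebra 𝒜]

theorem algebraMap_loc_injective (p : ProjectiveSpectrum 𝒜) :
    Function.Injective (algebraMap A (Loc 𝒜 p)) :=
  IsLocalization.injective _ p.asHomogeneousIdeal.toIdeal.primeCompl_le_nonZeroDivisors

instance (p : ProjectiveSpectrum 𝒜) : IsDomain (Loc 𝒜 p) :=
  IsLocalization.isDomain_localization p.asHomogeneousIdeal.toIdeal.primeCompl_le_nonZeroDivisors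

/-- The generic point of `Proj 𝒜`, i.e. the zero ideal. -/
def genericPt (h : ∃ f ∈ 𝒜 1, f ≠ 0) : ProjectiveSpectrum 𝒜 where
  asHomogeneousIdeal := ⊥
  isPrime := by
    rw [HomogeneousIdeal.toIdeal_bot]
    exact Ideal.isPrime_bot
  not_irrelevant_le hle := by
    obtain ⟨f, hf, hf0⟩ := h
    have h1 : f ∈ HomogeneousIdeal.irrelevant 𝒜 := by
      rw [HomogeneousIdeal.mem_irrelevant_iff, GradedRing.proj_apply,
        DirectSum.decompose_of_mem_ne 𝒜 hf one_ne_zero]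
    exact hf0 (Ideal.mem_bot.1 (hle h1))

theorem genericPt_le (h : ∃ f ∈ 𝒜 1, f ≠ 0) (p : ProjectiveSpectrum 𝒜) : genericPt h ≤ p :=
  show (⊥ : HomogeneousIdeal 𝒜) ≤ _ from bot_le

theorem genericPt_mem (h : ∃ f ∈ 𝒜 1, f ≠ 0) {U : (Proj 𝒜).Opens} {p : ProjectiveSpectrum 𝒜}
    (hp : p ∈ U) : genericPt h ∈ U := by
  have h1 := (ProjectiveSpectrum.le_iff_mem_closure 𝒜 _ _).1 (genericPt_le h p)
  obtain ⟨q, hq, hq'⟩ := mem_closure_iff.1 h1 U.1 U.2 hp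
  rw [Set.mem_singleton_iff] at hq'
  exact hq' ▸ hq

/-- In a graded domain the quotient of homogeneous elements is homogeneous. -/
theorem mem_of_mul_mem {m i : ℕ} {b c : A} (hb : b ∈ 𝒜 m) (hb0 : b ≠ 0) (h : b * c ∈ 𝒜 (m + i)) :
    c ∈ 𝒜 i := by
  have h1 : b * c = b * (DirectSum.decompose 𝒜 c i : A) := by
    rw [← DirectSum.coe_decompose_mul_add_of_left_mem 𝒜 hb, DirectSum.decompose_of_mem_same 𝒜 h]
  rw [mul_left_cancel₀ hb0 h1]
  exact SetLike.coe_mem _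

/-- The condition on a graded algebra that makes its homogeneous elements of degree `d ≥ 0` the
global sections of `𝒪(d)`: either there are two linear forms, one of which is prime and does not
divide the other, or it is a polynomial ring in one variable of degree `1`. -/
def HasLinearForms (𝒜 : ℕ → Submodule k A) : Prop :=
  (∃ f ∈ 𝒜 1, ∃ g ∈ 𝒜 1, Prime f ∧ ¬ f ∣ g) ∨
    ∃ f ∈ 𝒜 1, f ≠ 0 ∧ ∀ i, ∀ a ∈ 𝒜 i, ∃ c : k, a = c • f ^ i

theorem HasLinearForms.exists_ne_zero (h : HasLinearForms 𝒜) : ∃ f ∈ 𝒜 1, f ≠ 0 := by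
  obtain ⟨f, hf, g, hg, hp, hd⟩ | ⟨f, hf, hf0, h⟩ := h
  · exact ⟨f, hf, hp.ne_zero⟩
  · exact ⟨f, hf, hf0⟩

/-- If `z` is at each point of `Proj 𝒜` a fraction whose denominator does not vanish there, then
`f ^ N * z` is integral for every linear form `f` and some `N`. -/
theorem exists_pow_mul_eq {B : Type u} [CommRing B] [Algebra A B] (z : B)
    (hz : ∀ p : ProjectiveSpectrum 𝒜, ∃ (m : ℕ) (a b : A), b ∈ 𝒜 m ∧
      b ∉ p.asHomogeneousIdeal ∧ algebraMap A B b * z = algebraMap A B a)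
    {f : A} (hf : f ∈ 𝒜 1) : ∃ (N : ℕ) (a : A), algebraMap A B (f ^ N) * z = algebraMap A B a := by
  -- the denominators of `z` generate an ideal that is contained in no relevant prime ideal, and its
  -- radical is an intersection of homogeneous prime ideals
  let T : Set A := {b | (∃ m, b ∈ 𝒜 m) ∧ ∃ a, algebraMap A B b * z = algebraMap A B a}
  have hT : (Ideal.span T).IsHomogeneous 𝒜 :=
    Ideal.homogeneous_span 𝒜 T fun b hb => hb.1
  have hf' : f ∈ (Ideal.span T).radical := by
    rw [hT.radical_eq, Submodule.mem_sInf]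
    rintro P ⟨hP, hTP, hprime⟩
    by_contra hfP
    have hirr : ¬ HomogeneousIdeal.irrelevant 𝒜 ≤ ⟨P, hP⟩ := fun hle => by
      refine hfP (hle ?_)
      rw [HomogeneousIdeal.mem_irrelevant_iff, GradedRing.proj_apply,
        DirectSum.decompose_of_mem_ne 𝒜 hf one_ne_zero]
    obtain ⟨m, a, b, hb, hbp, e⟩ := hz ⟨⟨P, hP⟩, hprime, hirr⟩
    exact hbp (hTP (Ideal.subset_span ⟨⟨m, hb⟩, a, e⟩))
  obtain ⟨N, hN⟩ := hf'
  refine ⟨N, ?_⟩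
  generalize f ^ N = x at hN
  induction hN using Submodule.span_induction with
  | mem x hx => exact hx.2
  | zero => exact ⟨0, by simp⟩
  | add x y _ _ hx hy =>
    obtain ⟨a, ha⟩ := hx
    obtain ⟨b, hb⟩ := hy
    exact ⟨a + b, by rw [map_add, map_add, add_mul, ha, hb]⟩
  | smul c x _ hx =>
    obtain ⟨a, ha⟩ := hx
    exact ⟨c * a, by rw [smul_eq_mul, map_mul, mul_assoc, ha, map_mul]⟩

/-- The global sections of `𝒪(d)` are the forms of degree `d`. -/
theorem IsScalarSec.exists_eq_algebraMap (h : HasLinearForms 𝒜) (d : ℕ)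
    {c : ∀ p : (⊤ : (Proj 𝒜).Opens), Loc 𝒜 p.1} (hc : IsScalarSec 𝒜 d ⊤ c) :
    ∃ a ∈ 𝒜 d, ∀ p, c p = algebraMap A _ a := by
  let η := genericPt h.exists_ne_zero
  have key : ∀ p : (⊤ : (Proj 𝒜).Opens), ∃ (m : ℕ) (a b : A), a ∈ 𝒜 (m + d) ∧ b ∈ 𝒜 m ∧
      IsScalarFracAt 𝒜 p.1 a b (c p) ∧
      algebraMap A (Loc 𝒜 η) b * c ⟨η, trivial⟩ = algebraMap A (Loc 𝒜 η) a := fun p => by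
    obtain ⟨V, hpV, hV, i, m, a, b, h', ha, hb, e⟩ := hc p
    obtain rfl : i = m + d := by omega
    exact ⟨m, a, b, ha, hb, e ⟨p, hpV⟩, (e ⟨η, genericPt_mem _ hpV⟩).2⟩
  -- a section is determined by its value at the generic point, so it suffices to show that this
  -- value comes from an element of `A`
  suffices hx : ∃ x : A, c ⟨η, trivial⟩ = algebraMap A (Loc 𝒜 η) x by
    obtain ⟨x, hx⟩ := hx
    have h2 : ∀ p : (⊤ : (Proj 𝒜).Opens), x ∈ 𝒜 d ∧ c p = algebraMap A _ x := fun p => by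
      obtain ⟨m, a, b, ha, hb, e, e'⟩ := key p
      rw [hx, ← map_mul] at e'
      have e2 := algebraMap_loc_injective η e'
      subst e2
      have hb0 : b ≠ 0 := fun h0 => e.1 (h0 ▸ zero_mem _)
      refine ⟨mem_of_mul_mem hb hb0 ha, (isUnit_algebraMap_loc e.1).mul_left_cancel ?_⟩
      rw [e.2, map_mul]
    exact ⟨x, (h2 ⟨η, trivial⟩).1, fun p => (h2 p).2⟩
  obtain ⟨f, hf, g, hg, hp, hd⟩ | ⟨f, hf, hf0, h⟩ := h
  · have hz : ∀ p : ProjectiveSpectrum 𝒜, ∃ (m : ℕ) (a b : A), b ∈ 𝒜 m ∧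
        b ∉ p.asHomogeneousIdeal ∧
        algebraMap A (Loc 𝒜 η) b * c ⟨η, trivial⟩ = algebraMap A (Loc 𝒜 η) a := fun p => by
      obtain ⟨m, a, b, ha, hb, e, e'⟩ := key ⟨p, trivial⟩
      exact ⟨m, a, b, hb, e.1, e'⟩
    -- the value is both `a / f ^ N` and `b / g ^ M`, and `f ^ N` divides `a` as `f` is prime to `g`
    obtain ⟨N, a, ha⟩ := exists_pow_mul_eq _ hz hf
    obtain ⟨M, b, hb⟩ := exists_pow_mul_eq _ hz hg
    have h1 : f ^ N * b = g ^ M * a := by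
      apply algebraMap_loc_injective η
      rw [map_mul, ← hb, map_mul, ← ha]
      ring
    have h2 : f ^ N ∣ a :=
      hp.pow_dvd_of_dvd_mul_left N (fun h => hd (hp.dvd_of_dvd_pow h)) (h1 ▸ dvd_mul_right _ _)
    obtain ⟨x, rfl⟩ := h2
    refine ⟨x, ?_⟩
    have h3 : algebraMap A (Loc 𝒜 η) (f ^ N) ≠ 0 := by
      rw [map_ne_zero_iff _ (algebraMap_loc_injective η)]
      exact pow_ne_zero _ hp.ne_zero
    apply mul_left_cancel₀ h3
    rw [ha, map_mul]
  · obtain ⟨m, a, b, ha, hb, e, e'⟩ := key ⟨η, trivial⟩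
    obtain ⟨x, rfl⟩ := h _ a ha
    obtain ⟨y, rfl⟩ := h _ b hb
    have hy : y ≠ 0 := fun h0 => e.1 (by rw [h0, zero_smul]; exact zero_mem _)
    refine ⟨(y⁻¹ * x) • f ^ d, ?_⟩
    have h3 : algebraMap A (Loc 𝒜 η) (y • f ^ m) ≠ 0 := by
      rw [map_ne_zero_iff _ (algebraMap_loc_injective η)]
      exact smul_ne_zero hy (pow_ne_zero _ hf0)
    apply mul_left_cancel₀ h3
    rw [e', ← map_mul, smul_mul_smul_comm, mul_inv_cancel_left₀ hy, pow_add]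

end Generic

section Coordinates
variable {k A : Type u} [Field k] [CommRing A] [Algebra k A]
  {𝒜 : ℕ → Submodule k A} [GradedAlgebra 𝒜]
  {W : Type u} [AddCommGroup W] [Module k W] {ι : Type*} (w : Module.Basis ι k W)

/-- The `i`-th coordinate `B ⊗ W → B` with respect to a basis of `W`. -/
def coordAt (B : Type u) [CommRing B] [Algebra k B] (i : ι) : B ⊗[k] W →ₗ[B] B :=
  (Algebra.TensorProduct.basis B w).coord i

theorem coordAt_tmul (B : Type u) [CommRing B] [Algebra k B] (i : ι) (b : B) (v : W) :
    coordAt w B i (b ⊗ₜ v) = w.coord i v • b := by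
  simp [coordAt, Algebra.TensorProduct.basis_repr_tmul, Algebra.smul_def, mul_comm b]

theorem coordAt_ext {B : Type u} [CommRing B] [Algebra k B] {y z : B ⊗[k] W}
    (h : ∀ i, coordAt w B i y = coordAt w B i z) : y = z :=
  (Algebra.TensorProduct.basis B w).ext_elem h

theorem finite_coordAt {B : Type u} [CommRing B] [Algebra k B] (z : B ⊗[k] W) :
    {i | coordAt w B i z ≠ 0}.Finite :=
  ((Algebra.TensorProduct.basis B w).repr z).hasFiniteSupport

theorem coordAt_numMap (p : ProjectiveSpectrum 𝒜) (i : ι) (a : A ⊗[k] W) :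
    coordAt w (Loc 𝒜 p) i (numMap 𝒜 W p a) = algebraMap A (Loc 𝒜 p) (coordAt w A i a) := by
  induction a with
  | zero => simp
  | add y z hy hz => simp only [map_add, hy, hz]
  | tmul b v =>
    simp only [numMap, LinearMap.rTensor_tmul, coordAt_tmul, Algebra.smul_def, map_mul]
    rw [← IsScalarTower.algebraMap_apply k A]
    rfl

theorem coordAt_mem (l : ι) {i : ℕ} {a : A ⊗[k] W}
    (ha : a ∈ numDeg 𝒜 W i) : coordAt w A l a ∈ 𝒜 i := by
  induction ha using Submodule.span_induction with
  | zero => simp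
  | add x y _ _ hx hy => rw [map_add]; exact add_mem hx hy
  | smul c x _ hx =>
    rw [← algebraMap_smul A c x, map_smul, algebraMap_smul]; exact Submodule.smul_mem _ _ hx
  | mem x hx =>
    obtain ⟨a, ha, v, rfl⟩ := hx
    rw [coordAt_tmul]
    exact Submodule.smul_mem _ _ ha

theorem IsFracAt.coordAt {p : ProjectiveSpectrum 𝒜} {a : A ⊗[k] W} {b : A}
    {y : Loc 𝒜 p ⊗[k] W} (h : IsFracAt 𝒜 W p a b y) (i : ι) :
    IsScalarFracAt 𝒜 p (coordAt w A i a) b (coordAt w (Loc 𝒜 p) i y) := by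
  refine ⟨h.1, ?_⟩
  rw [← coordAt_numMap, ← h.2, map_smul, smul_eq_mul]

theorem isScalarSec_coordAt {n : ℤ} {U : (Proj 𝒜).Opens}
    {t : ∀ p : U, Loc 𝒜 p.1 ⊗[k] W} (ht : t ∈ twistSections 𝒜 W n U) (i : ι) :
    IsScalarSec 𝒜 n U (fun p => GZeroGeometry.coordAt w (Loc 𝒜 p.1) i (t p)) := fun p => by
  obtain ⟨V, hV, j, l, n, a, b, h, ha, hb, e⟩ := ht p
  exact ⟨V, hV, j.le, l, n, _, b, h, coordAt_mem w i ha, hb, fun q => (e q).coordAt w i⟩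

variable [IsDomain A]

theorem numMap_injective (p : ProjectiveSpectrum 𝒜) : Function.Injective (numMap 𝒜 W p) :=
  Module.Flat.rTensor_preserves_injective_linearMap _ (algebraMap_loc_injective p)

/-- A coordinate that vanishes at the generic point vanishes everywhere. -/
theorem coordAt_eq_zero (h : ∃ f ∈ 𝒜 1, f ≠ 0) {j : ℤ} {U : (Proj 𝒜).Opens}
    (s : Γ(twistSheaf 𝒜 W j, U)) (i : ι) (p : ProjectiveSpectrum 𝒜) (hp : p ∈ U)
    (h0 : coordAt w (Loc 𝒜 (genericPt h)) i (twVal s _ (genericPt_mem h hp)) = 0) :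
    coordAt w (Loc 𝒜 p) i (twVal s p hp) = 0 := by
  obtain ⟨V, hpV, hV, l, n, a, b, h', ha, hb, e⟩ := exists_frac s p hp
  have e1 := ((e _ (genericPt_mem h hpV)).coordAt w i).2
  rw [h0, mul_zero] at e1
  have e2 := algebraMap_loc_injective _ ((map_zero _).trans e1)
  have e3 := ((e _ hpV).coordAt w i).2
  rw [← e2, map_zero] at e3
  exact (isUnit_algebraMap_loc (e _ hpV).1).mul_left_cancel (e3.trans (mul_zero _).symm)

/-- The global sections of `W ⊗ 𝒪(d)` for `d ≥ 0` are the elements of `𝒜_d ⊗ W`. -/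
theorem exists_eq_numMap (h : HasLinearForms 𝒜) (d : ℕ) (s : twistSub 𝒜 W d ⊤) :
    ∃ c ∈ numDeg 𝒜 W d, ∀ p hp, tsVal s p hp = numMap 𝒜 W p c := by
  classical
  let w := Module.Basis.ofVectorSpace k W
  choose a ha ha' using fun i => (isScalarSec_coordAt w s.2 i).exists_eq_algebraMap h d
  let η : (⊤ : (Proj 𝒜).Opens) := ⟨genericPt h.exists_ne_zero, trivial⟩
  have hfin := finite_coordAt w (s.1 η)
  have h0 : ∀ i, i ∉ hfin.toFinset → a i = 0 := fun i hi => by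
    simp only [Set.Finite.mem_toFinset, Set.mem_ofPred_eq, not_not] at hi
    exact algebraMap_loc_injective η.1 (((ha' i η).symm.trans hi).trans (map_zero _).symm)
  refine ⟨∑ i ∈ hfin.toFinset, a i ⊗ₜ w i, Submodule.sum_mem _ fun i _ =>
    Submodule.subset_span ⟨a i, ha i, w i, rfl⟩, fun p hp => coordAt_ext w fun i => ?_⟩
  refine (ha' i ⟨p, hp⟩).trans ?_
  rw [coordAt_numMap, map_sum]
  congr 1
  simp only [coordAt_tmul, Module.Basis.coord_apply, Module.Basis.repr_self, Finsupp.single_apply,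
    ite_smul, one_smul, zero_smul, Finset.sum_ite_eq']
  split_ifs with hi
  · rfl
  · exact h0 i hi

end Coordinates

/-! ### Global sections of `W ⊗ 𝒪(j)` twisted by `-j` and by `-j + 1` -/

section UnitΓ
variable {k g₀ A : Type u} [Field k] [LieRing g₀] [LieAlgebra k g₀] [CommRing A] [Algebra k A]
  [IsDomain A] {𝒜 : ℕ → Submodule k A} [GradedAlgebra 𝒜]
  {δ : g₀ →ₗ⁅k⁆ Derivation k A A} {hδ : ∀ x n, ∀ a ∈ 𝒜 n, δ x a ∈ 𝒜 n}
  {W : Type u} [AddCommGroup W] [Module k W] [LieRingModule g₀ W] [LieModule k g₀ W]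
  {W' : Type u} [AddCommGroup W'] [Module k W'] [LieRingModule g₀ W'] [LieModule k g₀ W']
  (h𝒜 : CoveredByLinear 𝒜) (hL : HasLinearForms 𝒜)
  (h0 : ∀ a ∈ 𝒜 0, ∃ c : k, a = algebraMap k A c)

omit [IsDomain A] in
theorem tsVal_globalMul_unitΓ {j n : ℤ} (hn : (0 : ℤ) = j + n) (w : W) (p hp) :
    tsVal (globalMul h𝒜 hn (unitΓ h𝒜 δ hδ hn w)) p hp = numMap 𝒜 W p (1 ⊗ₜ w) := by
  rw [globalMul_unitΓ, tsVal_oneTmul]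
  exact congrArg (· ⊗ₜ[k] w) (map_one (IsScalarTower.toAlgHom k A (Loc 𝒜 p))).symm

omit [IsDomain A] in
theorem one_tmul_injective [Nontrivial A] {w w' : W} (h : (1 : A) ⊗ₜ[k] w = 1 ⊗ₜ w') : w = w' := by
  let b := Module.Basis.ofVectorSpace k W
  refine b.ext_elem fun i => ?_
  have := congrArg (coordAt b A i) h
  rw [coordAt_tmul, coordAt_tmul] at this
  exact smul_left_injective k one_ne_zero this

include hL in
theorem unitΓ_injective {j n : ℤ} (hn : (0 : ℤ) = j + n) :
    Function.Injective (unitΓ h𝒜 δ hδ (W := W) hn) := fun w w' h => by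
  let p := genericPt hL.exists_ne_zero
  have h1 := congrArg (fun s => tsVal (globalMul h𝒜 hn s) p trivial) h
  exact one_tmul_injective (numMap_injective p
    ((tsVal_globalMul_unitΓ h𝒜 hn w p trivial).symm.trans
      (h1.trans (tsVal_globalMul_unitΓ h𝒜 hn w' p trivial))))

include hL h0 in
theorem unitΓ_surjective {j n : ℤ} (hn : (0 : ℤ) = j + n) :
    Function.Surjective (unitΓ h𝒜 δ hδ (W := W) hn) := fun s => by
  obtain ⟨c, hc, hs⟩ := exists_eq_numMap hL 0 (globalMul h𝒜 hn s)
  have : ∃ w : W, c = 1 ⊗ₜ w := by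
    clear hs
    induction hc using Submodule.span_induction with
    | zero => exact ⟨0, (TensorProduct.tmul_zero _ _).symm⟩
    | add x y _ _ hx hy =>
      obtain ⟨w, rfl⟩ := hx
      obtain ⟨w', rfl⟩ := hy
      exact ⟨w + w', (TensorProduct.tmul_add _ _ _).symm⟩
    | smul a x _ hx =>
      obtain ⟨w, rfl⟩ := hx
      exact ⟨a • w, (TensorProduct.tmul_smul _ _ _).symm⟩
    | mem x hx =>
      obtain ⟨a, ha, w, rfl⟩ := hx
      obtain ⟨c, rfl⟩ := h0 a ha
      exact ⟨c • w, by rw [Algebra.algebraMap_eq_smul_one, TensorProduct.smul_tmul]⟩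
  obtain ⟨w, rfl⟩ := this
  refine ⟨w, (globalMul h𝒜 hn).injective (ts_ext fun p hp => ?_)⟩
  rw [tsVal_globalMul_unitΓ]
  exact (hs p hp).symm

section Mul
variable {M : Type u} [AddCommGroup M] [Module k M] (ι : M →ₗ[k] 𝒜 1)

/-- The multiplication map `Γ(F(n)) ⊗ M → Γ(F(n + 1))` for a space `M` of linear forms. -/
def mulForms (ι : M →ₗ[k] 𝒜 1) (F : EquivModule (projAction δ hδ)) {n n' : ℤ} (hn : n' = n + 1) :
    TwistΓ F n ⊗[k] M →ₗ[k] TwistΓ F n' :=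
  TensorProduct.lift ((TwistΓ.mul F hn).comp ι).flip

omit [IsDomain A] in
theorem tsVal_globalMul_mulForms {j n n' l : ℤ} (hn : (0 : ℤ) = j + n) (hn' : n' = n + 1)
    (hl : l = j + n') (y : W ⊗[k] M) (p hp) :
    tsVal (globalMul h𝒜 hl (mulForms ι (twist W δ hδ j) hn'
      (LinearMap.rTensor _ (unitΓ h𝒜 δ hδ hn) y))) p hp =
      numMap _ W p (LinearMap.rTensor W ((𝒜 1).subtype ∘ₗ ι) (TensorProduct.comm k _ _ y)) := by
  induction y with
  | zero => simp only [map_zero, tsVal_zero]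
  | add y z hy hz => simp only [map_add, tsVal_add, hy, hz]
  | tmul w f =>
    rw [LinearMap.rTensor_tmul]
    refine (tsVal_globalMul_mul h𝒜 hn hl hn' (ι f) (unitΓ h𝒜 δ hδ hn w) p hp).trans ?_
    rw [tsVal_globalMul_unitΓ, ← numMap_smul]
    simp [TensorProduct.smul_tmul']

include h𝒜 hL h0 in
/-- The multiplication map `Γ(F(n)) ⊗ M → Γ(F(n + 1))` is bijective for `F = W ⊗ 𝒪(-n)` if `M` is
the space of all linear forms. -/
theorem mulForms_bijective (hι : Function.Bijective ι) {j n n' : ℤ} (hn : (0 : ℤ) = j + n)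
    (hn' : n' = n + 1) : Function.Bijective (mulForms ι (twist W δ hδ j) hn') := by
  have hl : ((1 : ℕ) : ℤ) = j + n' := by push_cast; omega
  constructor
  · rw [injective_iff_map_eq_zero]
    intro x hx
    obtain ⟨y, rfl⟩ := LinearMap.rTensor_surjective M
      (unitΓ_surjective h𝒜 hL h0 (δ := δ) (hδ := hδ) (W := W) hn) x
    let p := genericPt hL.exists_ne_zero
    have h1 := tsVal_globalMul_mulForms (δ := δ) (hδ := hδ) (W := W) h𝒜 ι hn hn' hl y p trivial
    rw [hx, map_zero] at h1
    have h2 := numMap_injective (W := W) p ((map_zero _).trans h1)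
    have h3 := Module.Flat.rTensor_preserves_injective_linearMap (M := W) ((𝒜 1).subtype ∘ₗ ι)
      (Subtype.val_injective.comp hι.1) ((map_zero _).trans h2)
    rw [eq_comm, LinearEquiv.map_eq_zero_iff] at h3
    rw [h3, map_zero]
  · intro z
    obtain ⟨c, hc, hs⟩ := exists_eq_numMap hL 1 (globalMul h𝒜 hl z)
    have : ∃ y : W ⊗[k] M, c = LinearMap.rTensor W ((𝒜 1).subtype ∘ₗ ι)
        (TensorProduct.comm k _ _ y) := by
      clear hs
      induction hc using Submodule.span_induction with
      | zero => exact ⟨0, by simp only [map_zero]⟩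
      | add x y _ _ hx hy =>
        obtain ⟨w, rfl⟩ := hx
        obtain ⟨w', rfl⟩ := hy
        exact ⟨w + w', by simp only [map_add]⟩
      | smul a x _ hx =>
        obtain ⟨w, rfl⟩ := hx
        exact ⟨a • w, by simp only [map_smul]⟩
      | mem x hx =>
        obtain ⟨a, ha, w, rfl⟩ := hx
        obtain ⟨f, hf⟩ := hι.2 ⟨a, ha⟩
        exact ⟨w ⊗ₜ f, by simp [hf]⟩
    obtain ⟨y, rfl⟩ := this
    refine ⟨LinearMap.rTensor _ (unitΓ h𝒜 δ hδ hn) y,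
      (globalMul h𝒜 hl).injective (ts_ext fun p hp => ?_)⟩
    rw [tsVal_globalMul_mulForms h𝒜 ι hn hn' hl]
    exact (hs p hp).symm

end Mul

omit [IsDomain A] in
theorem unitΓ_lie {j n : ℤ} (hn : (0 : ℤ) = j + n) (x : g₀) (w : W) :
    unitΓ h𝒜 δ hδ hn ⁅x, w⁆ = ⁅x, unitΓ h𝒜 δ hδ hn w⁆ := by
  refine (globalMul h𝒜 hn).injective (ts_ext fun p hp => ?_)
  rw [tsVal_globalMul_unitΓ, tsVal_globalMul_lie, tsVal_globalMul_unitΓ,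
    locAct, ← numMap_tensorAct, tensorAct_tmul, Derivation.map_one_eq_zero,
    TensorProduct.zero_tmul, zero_add]

omit [IsDomain A] in
/-- The map on global sections induced by `∑ᵢ cᵢ ⊗ fᵢ`. -/
theorem tsVal_globalMul_map_unitΓ {ι : Type*} [Fintype ι] {c : ι → A}
    {f : ι → W →ₗ[k] W'} {m : ℕ} (hc : ∀ i, c i ∈ 𝒜 m)
    {j j' n l' : ℤ} (hn : (0 : ℤ) = j + n) (hl' : l' = j' + n)
    (φ : twist W δ hδ j ⟶ twist W' δ hδ j') (hm : j' = j + m)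
    (hφ : EquivModule.Hom.hom φ = famHom c f m hc hm) (w : W) (p hp) :
    tsVal (globalMul h𝒜 hl' (TwistΓ.map φ n (unitΓ h𝒜 δ hδ hn w))) p hp =
      numMap 𝒜 W' p (∑ i, c i ⊗ₜ f i w) := by
  rw [tsVal_globalMul_map_fam h𝒜 hc hn hl' φ hm hφ, tsVal_globalMul_unitΓ, ← numMap_famMap,
    famMap_tmul]
  simp

end UnitΓ

/-! ### The symmetric algebra -/

section Sym
variable {k M : Type u} [Field k] [AddCommGroup M] [Module k M]

instance isDomain_symmetricAlgebra : IsDomain (SymmetricAlgebra k M) :=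
  (SymmetricAlgebra.equivMvPolynomial (Module.Basis.ofVectorSpace k M)).toMulEquiv.isDomain _

theorem symDeg_one : symDeg k M 1 = LinearMap.range (SymmetricAlgebra.ι k M) := by
  rw [symDeg, pow_one]

theorem ι_injective : Function.Injective (SymmetricAlgebra.ι k M) := by
  intro x y h
  rw [← sub_eq_zero, ← Module.forall_dual_apply_eq_zero_iff k]
  intro f
  have := congrArg (SymmetricAlgebra.lift f) h
  simp only [SymmetricAlgebra.lift_ι_apply] at this
  rw [map_sub, this, sub_self]

theorem mem_symDeg_zero {a : SymmetricAlgebra k M} (ha : a ∈ symDeg k M 0) :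
    ∃ c : k, a = algebraMap k _ c := by
  rw [symDeg, pow_zero] at ha
  obtain ⟨c, hc⟩ := Submodule.mem_one.1 ha
  exact ⟨c, hc.symm⟩

/-- The irrelevant ideal of `S(M)` is generated by the linear forms. -/
theorem coveredByLinear_symDeg : CoveredByLinear (symDeg k M) := by
  intro p
  by_contra! H
  have h1 : ∀ n, 0 < n → ∀ a ∈ symDeg k M n, a ∈ p.asHomogeneousIdeal := by
    intro n hn a ha
    obtain ⟨n, rfl⟩ := Nat.exists_eq_succ_of_ne_zero hn.ne'
    rw [symDeg, Nat.succ_eq_add_one, pow_succ'] at ha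
    induction ha using Submodule.mul_induction_on' with
    | mem_mul_mem x hx y hy =>
      exact p.asHomogeneousIdeal.toIdeal.mul_mem_right _ (H x (by rwa [symDeg_one]))
    | add x _ y _ hx hy => exact add_mem hx hy
  refine p.not_irrelevant_le fun z hz => ?_
  classical
  rw [← DirectSum.sum_support_decompose (symDeg k M) z]
  refine p.asHomogeneousIdeal.toIdeal.sum_mem fun n hn => ?_
  refine h1 n (Nat.pos_of_ne_zero fun h0 => ?_) _ (SetLike.coe_mem _)
  subst h0
  rw [DFinsupp.mem_support_iff] at hn
  exact hn (Subtype.ext (by rwa [HomogeneousIdeal.mem_irrelevant_iff, GradedRing.proj_apply] at hz))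

/-- Two distinct members of a basis of `M` are variables of a polynomial ring; if there are none,
then `M` is a line and `S(M)` is a polynomial ring in one variable. -/
theorem hasLinearForms_symDeg [Nontrivial M] : HasLinearForms (symDeg k M) := by
  let b := Module.Basis.ofVectorSpace k M
  have hι (m : M) : SymmetricAlgebra.ι k M m ∈ symDeg k M 1 := by
    rw [symDeg_one]; exact ⟨m, rfl⟩
  obtain ⟨i⟩ := b.index_nonempty
  by_cases h : ∃ l, l ≠ i
  · obtain ⟨l, hl⟩ := h
    refine Or.inl ⟨_, hι (b i), _, hι (b l), ?_, ?_⟩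
    · rw [← MulEquiv.prime_iff (SymmetricAlgebra.equivMvPolynomial b),
        SymmetricAlgebra.equivMvPolynomial_ι_apply]
      exact MvPolynomial.X_prime
    · intro hd
      have := map_dvd (SymmetricAlgebra.equivMvPolynomial b) hd
      rw [SymmetricAlgebra.equivMvPolynomial_ι_apply, SymmetricAlgebra.equivMvPolynomial_ι_apply,
        MvPolynomial.X_dvd_X] at this
      exact hl this.symm
  · push Not at h
    refine Or.inr ⟨_, hι (b i), ?_, fun n a ha => ?_⟩
    · rw [map_ne_zero_iff _ ι_injective]
      exact b.ne_zero i
    · have h1 : LinearMap.range (SymmetricAlgebra.ι k M) =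
          Submodule.span k {SymmetricAlgebra.ι k M (b i)} := by
        have h2 : Set.range b = {b i} := by
          ext x
          simp only [Set.mem_range, Set.mem_singleton_iff]
          exact ⟨fun ⟨l, hl⟩ => by rw [← hl, h l], fun hx => ⟨i, hx.symm⟩⟩
        rw [LinearMap.range_eq_map, ← b.span_eq, h2, Submodule.map_span, Set.image_singleton]
      rw [symDeg, h1, Submodule.span_pow, Set.singleton_pow, Submodule.mem_span_singleton] at ha
      obtain ⟨c, hc⟩ := ha
      exact ⟨c, hc.symm⟩

end Sym

/-! ### The symbol of a differential -/

section Values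
variable {k g₀ A : Type u} [Field k] [LieRing g₀] [LieAlgebra k g₀] [CommRing A] [Algebra k A]
  {𝒜 : ℕ → Submodule k A} [GradedAlgebra 𝒜]
  {δ : g₀ →ₗ⁅k⁆ Derivation k A A} {hδ : ∀ x n, ∀ a ∈ 𝒜 n, δ x a ∈ 𝒜 n}
  {W : Type u} [AddCommGroup W] [Module k W] [LieRingModule g₀ W] [LieModule k g₀ W]
  (h𝒜 : CoveredByLinear 𝒜)

theorem tsVal_globalMul_eq {j n l : ℤ} (hl : l = j + n) (s : TwistΓ (twist W δ hδ j) n) (p hp) :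
    tsVal (globalMul h𝒜 hl s) p hp = tsVal (globalMul h𝒜 rfl s) p hp := by
  subst hl
  rfl

variable (W) in
/-- The value at `p` of a section of `W ⊗ 𝒪(j) ⊗ 𝒪(n)`. -/
def valΓ (δ : g₀ →ₗ⁅k⁆ Derivation k A A) (hδ : ∀ x n, ∀ a ∈ 𝒜 n, δ x a ∈ 𝒜 n) (j n : ℤ)
    (p : ProjectiveSpectrum 𝒜) : TwistΓ (twist W δ hδ j) n →ₗ[k] Loc 𝒜 p ⊗[k] W :=
  tsEval W (j + n) p ∘ₗ (globalMul h𝒜 rfl).toLinearMap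

theorem valΓ_ext {j n : ℤ} {s t : TwistΓ (twist W δ hδ j) n}
    (h : ∀ p, valΓ W h𝒜 δ hδ j n p s = valΓ W h𝒜 δ hδ j n p t) : s = t :=
  (globalMul h𝒜 rfl).injective (ts_ext fun p _ => h p)

theorem valΓ_lie {j n : ℤ} (x : g₀) (s : TwistΓ (twist W δ hδ j) n) (p) :
    valΓ W h𝒜 δ hδ j n p ⁅x, s⁆ = locAct W δ x p (valΓ W h𝒜 δ hδ j n p s) :=
  tsVal_globalMul_lie h𝒜 rfl x s p trivial

theorem valΓ_mul {j n n' : ℤ} (hn : n' = n + 1) (a : 𝒜 1) (s : TwistΓ (twist W δ hδ j) n) (p) :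
    valΓ W h𝒜 δ hδ j n' p (TwistΓ.mul (twist W δ hδ j) hn a s) =
      algebraMap A (Loc 𝒜 p) a • valΓ W h𝒜 δ hδ j n p s :=
  tsVal_globalMul_mul h𝒜 rfl rfl hn a s p trivial

end Values

section Symbol
variable {k g₀ g₁ : Type u} [Field k] [LieRing g₀] [LieAlgebra k g₀] [AddCommGroup g₁] [Module k g₁]
  [LieRingModule g₀ g₁] [LieModule k g₀ g₁] [Nontrivial g₁]
  {W : Type u} [AddCommGroup W] [Module k W] [LieRingModule g₀ W] [LieModule k g₀ W]
  {W' : Type u} [AddCommGroup W'] [Module k W'] [LieRingModule g₀ W'] [LieModule k g₀ W']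
  {W'' : Type u} [AddCommGroup W''] [Module k W''] [LieRingModule g₀ W''] [LieModule k g₀ W'']

instance nontrivial_dual : Nontrivial (Module.Dual k g₁) :=
  (Module.nontrivial_dual_iff k).2 inferInstance

variable (k g₀ g₁ W) in
/-- The isomorphism `W ≅ Γ(W ⊗ 𝒪(j) ⊗ 𝒪(-j))`. -/
def projUnit (j : ℤ) : W ≃ₗ[k] TwistΓ (projTwist k g₀ g₁ W j) (-j) :=
  LinearEquiv.ofBijective
    (unitΓ coveredByLinear_symDeg (symLieAction g₀) symLieAction_mem (add_neg_cancel j).symm)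
    ⟨unitΓ_injective coveredByLinear_symDeg hasLinearForms_symDeg _,
      unitΓ_surjective coveredByLinear_symDeg hasLinearForms_symDeg (fun _ => mem_symDeg_zero) _⟩

theorem projUnit_lie (j : ℤ) (x : g₀) (w : W) :
    projUnit k g₀ g₁ W j ⁅x, w⁆ = ⁅x, projUnit k g₀ g₁ W j w⁆ :=
  unitΓ_lie coveredByLinear_symDeg _ x w

variable (k g₁) in
/-- The identification of `g₁*` with the forms of degree `1` in `S(g₁*)`. -/
def linearForm : Module.Dual k g₁ →ₗ[k] symDeg k (Module.Dual k g₁) 1 :=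
  (SymmetricAlgebra.ι k (Module.Dual k g₁)).codRestrict _ ι_mem_symDeg

omit [Nontrivial g₁] in
theorem linearForm_bijective : Function.Bijective (linearForm k g₁) := by
  constructor
  · intro f g h
    exact ι_injective (congrArg Subtype.val h)
  · rintro ⟨a, ha⟩
    have ha' := ha
    rw [symDeg_one] at ha'
    obtain ⟨f, hf⟩ := ha'
    exact ⟨f, Subtype.ext hf⟩

/-- The multiplication map `Γ(F(-j)) ⊗ g₁* → Γ(F(-j + 1))` is bijective for `F = W ⊗ 𝒪(j)`. -/
theorem mulDual_bijective {j n : ℤ} (hn : n = -j + 1) :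
    Function.Bijective (mulDual (projTwist k g₀ g₁ W j) hn) :=
  mulForms_bijective coveredByLinear_symDeg hasLinearForms_symDeg (fun _ => mem_symDeg_zero)
    (linearForm k g₁) linearForm_bijective (add_neg_cancel j).symm hn

variable (k g₁ W) in
/-- The map `w ⊗ f ↦ f ⊗ w` from `W ⊗ g₁*` to `S(g₁*) ⊗ W`. -/
def dualSym : W ⊗[k] Module.Dual k g₁ →ₗ[k] SymmetricAlgebra k (Module.Dual k g₁) ⊗[k] W :=
  LinearMap.rTensor W ((symDeg k (Module.Dual k g₁) 1).subtype ∘ₗ linearForm k g₁) ∘ₗ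
    (TensorProduct.comm k _ _).toLinearMap

omit [Nontrivial g₁] [LieRingModule g₀ g₁] [LieRingModule g₀ W] in
@[simp] theorem dualSym_tmul (w : W) (f : Module.Dual k g₁) :
    dualSym k g₁ W (w ⊗ₜ f) = SymmetricAlgebra.ι k _ f ⊗ₜ w := rfl

variable (k g₀ g₁ W) in
/-- The value at `p` of a section of `W ⊗ 𝒪(j) ⊗ 𝒪(n)` on `ℙ(g₁)`. -/
def projVal (j n : ℤ) (p : ProjectiveSpectrum (symDeg k (Module.Dual k g₁))) :
    TwistΓ (projTwist k g₀ g₁ W j) n →ₗ[k] Loc (symDeg k (Module.Dual k g₁)) p ⊗[k] W :=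
  valΓ W coveredByLinear_symDeg (symLieAction g₀) symLieAction_mem j n p

theorem projVal_ext {j n : ℤ} {s t : TwistΓ (projTwist k g₀ g₁ W j) n}
    (h : ∀ p, projVal k g₀ g₁ W j n p s = projVal k g₀ g₁ W j n p t) : s = t :=
  valΓ_ext coveredByLinear_symDeg h

theorem projVal_mul {j n n' : ℤ} (hn : n' = n + 1) (a : symDeg k (Module.Dual k g₁) 1)
    (s : TwistΓ (projTwist k g₀ g₁ W j) n) (p) :
    projVal k g₀ g₁ W j n' p (TwistΓ.mul (projTwist k g₀ g₁ W j) hn a s) =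
      algebraMap (SymmetricAlgebra k (Module.Dual k g₁)) (Loc _ p) a •
        projVal k g₀ g₁ W j n p s :=
  valΓ_mul coveredByLinear_symDeg hn a s p

theorem projVal_mulDual {j n : ℤ} (hn : n = -j + 1) (y : W ⊗[k] Module.Dual k g₁) (p) :
    projVal k g₀ g₁ W j n p (mulDual (projTwist k g₀ g₁ W j) hn
      (LinearMap.rTensor _ (projUnit k g₀ g₁ W j).toLinearMap y)) =
      numMap _ W p (dualSym k g₁ W y) :=
  tsVal_globalMul_mulForms coveredByLinear_symDeg (linearForm k g₁) (add_neg_cancel j).symm hn rfl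
    y p trivial

theorem projVal_map_fam {ι : Type*} [Fintype ι] {c : ι → SymmetricAlgebra k (Module.Dual k g₁)}
    {f : ι → W →ₗ[k] W'} {m : ℕ} (hc : ∀ i, c i ∈ symDeg k (Module.Dual k g₁) m)
    {j j' : ℤ} (φ : projTwist k g₀ g₁ W j ⟶ projTwist k g₀ g₁ W' j') (hm : j' = j + m)
    (hφ : EquivModule.Hom.hom φ = famHom c f m hc hm) (w : W) (p) :
    projVal k g₀ g₁ W' j' (-j) p (TwistΓ.map φ (-j) (projUnit k g₀ g₁ W j w)) =
      numMap _ W' p (∑ i, c i ⊗ₜ f i w) :=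
  tsVal_globalMul_map_unitΓ coveredByLinear_symDeg hc (add_neg_cancel j).symm rfl φ hm hφ w p
    trivial

theorem projVal_projUnit (j : ℤ) (w : W) (p) :
    projVal k g₀ g₁ W j (-j) p (projUnit k g₀ g₁ W j w) = numMap _ W p (1 ⊗ₜ w) := by
  refine Eq.trans ?_ (tsVal_globalMul_unitΓ coveredByLinear_symDeg (δ := symLieAction g₀)
    (hδ := symLieAction_mem) (add_neg_cancel j).symm w p trivial)
  exact (tsVal_globalMul_eq coveredByLinear_symDeg (add_neg_cancel j).symm
    (projUnit k g₀ g₁ W j w) p trivial).symm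

/-- A morphism between the `W ⊗ 𝒪(j)` is determined by the map on global sections it induces. -/
theorem projTwist_hom_ext {j j' : ℤ} {φ ψ : projTwist k g₀ g₁ W j ⟶ projTwist k g₀ g₁ W' j'}
    (h : ∀ w, TwistΓ.map φ (-j) (projUnit k g₀ g₁ W j w) =
      TwistΓ.map ψ (-j) (projUnit k g₀ g₁ W j w)) : φ = ψ :=
  twist_hom_ext_of_map coveredByLinear_symDeg (add_neg_cancel j).symm (LinearMap.ext fun s => by
    obtain ⟨w, rfl⟩ := (projUnit k g₀ g₁ W j).surjective s
    exact h w)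

omit [Nontrivial g₁] in
theorem hom_projTwistMap (f : W →ₗ[k] W') (hf : ∀ (x : g₀) w, f ⁅x, w⁆ = ⁅x, f w⁆) (j : ℤ) :
    EquivModule.Hom.hom (projTwistMap (g₁ := g₁) f hf j) =
      famHom (fun _ : Unit => 1) (fun _ => f) 0 (fun _ => SetLike.GradedOne.one_mem) (by simp) :=
  rfl

theorem map_projTwistMap (f : W →ₗ[k] W') (hf : ∀ (x : g₀) w, f ⁅x, w⁆ = ⁅x, f w⁆) (j : ℤ) (w : W) :
    TwistΓ.map (projTwistMap f hf j) (-j) (projUnit k g₀ g₁ W j w) =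
      projUnit k g₀ g₁ W' j (f w) := by
  apply projVal_ext
  intro p
  have h := projVal_map_fam (g₀ := g₀) (fun _ => SetLike.GradedOne.one_mem)
    (projTwistMap f hf j) (by simp) (hom_projTwistMap f hf j) w p
  rw [h, projVal_projUnit, Finset.univ_unique, Finset.sum_singleton]

/-- The symbol `W → W' ⊗ g₁*` of a morphism `W ⊗ 𝒪(j) → W' ⊗ 𝒪(j + 1)`. -/
def symbol {j : ℤ} (φ : projTwist k g₀ g₁ W j ⟶ projTwist k g₀ g₁ W' (j + 1)) :
    W →ₗ[k] W' ⊗[k] Module.Dual k g₁ :=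
  LinearMap.rTensor _ (projUnit k g₀ g₁ W' (j + 1)).symm.toLinearMap ∘ₗ
    linearInv (mulDual (projTwist k g₀ g₁ W' (j + 1)) (n' := -j) (by ring)) ∘ₗ
      TwistΓ.map φ (-j) ∘ₗ (projUnit k g₀ g₁ W j).toLinearMap

theorem rTensor_symbol {j : ℤ} (φ : projTwist k g₀ g₁ W j ⟶ projTwist k g₀ g₁ W' (j + 1)) (w : W) :
    LinearMap.rTensor _ (projUnit k g₀ g₁ W' (j + 1)).toLinearMap (symbol φ w) =
      linearInv (mulDual (projTwist k g₀ g₁ W' (j + 1)) (n' := -j) (by ring))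
        (TwistΓ.map φ (-j) (projUnit k g₀ g₁ W j w)) := by
  rw [symbol, LinearMap.comp_apply, ← LinearMap.comp_apply, ← LinearMap.rTensor_comp,
    LinearEquiv.comp_symm, LinearMap.rTensor_id]
  rfl

theorem map_projUnit {j : ℤ} (φ : projTwist k g₀ g₁ W j ⟶ projTwist k g₀ g₁ W' (j + 1)) (w : W) :
    TwistΓ.map φ (-j) (projUnit k g₀ g₁ W j w) =
      mulDual (projTwist k g₀ g₁ W' (j + 1)) (by ring)
        (LinearMap.rTensor _ (projUnit k g₀ g₁ W' (j + 1)).toLinearMap (symbol φ w)) := by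
  rw [rTensor_symbol, apply_linearInv_self (mulDual_bijective _)]

/-- A morphism `W ⊗ 𝒪(j) → W' ⊗ 𝒪(j + 1)` is determined by its symbol. -/
theorem hom_ext_symbol {j : ℤ} {φ ψ : projTwist k g₀ g₁ W j ⟶ projTwist k g₀ g₁ W' (j + 1)}
    (h : ∀ w, symbol φ w = symbol ψ w) : φ = ψ :=
  projTwist_hom_ext fun w => by rw [map_projUnit, map_projUnit, h]

theorem projVal_map_projUnit {j : ℤ}
    (φ : projTwist k g₀ g₁ W j ⟶ projTwist k g₀ g₁ W' (j + 1)) (w : W) (p) :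
    projVal k g₀ g₁ W' (j + 1) (-j) p (TwistΓ.map φ (-j) (projUnit k g₀ g₁ W j w)) =
      numMap _ W' p (dualSym k g₁ W' (symbol φ w)) := by
  rw [map_projUnit, projVal_mulDual]

omit [Nontrivial g₁] in
theorem dualSym_injective : Function.Injective (dualSym k g₁ W) :=
  (Module.Flat.rTensor_preserves_injective_linearMap (M := W)
    ((symDeg k (Module.Dual k g₁) 1).subtype ∘ₗ linearForm k g₁)
    (Subtype.val_injective.comp linearForm_bijective.1)).comp
    (TensorProduct.comm k W (Module.Dual k g₁)).injective

/-- The symbol of `∑ᵢ fᵢ ⊗ cᵢ`. -/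
theorem symbol_fam {ι : Type*} [Fintype ι] (c : ι → Module.Dual k g₁) {f : ι → W →ₗ[k] W'} {j : ℤ}
    (φ : projTwist k g₀ g₁ W j ⟶ projTwist k g₀ g₁ W' (j + 1))
    (hφ : EquivModule.Hom.hom φ = famHom (fun i => SymmetricAlgebra.ι k _ (c i)) f 1
      (fun i => ι_mem_symDeg (c i)) (by simp)) (w : W) :
    symbol φ w = ∑ i, f i w ⊗ₜ c i := by
  let p := genericPt (hasLinearForms_symDeg (k := k) (M := Module.Dual k g₁)).exists_ne_zero
  have h1 := (projVal_map_projUnit φ w p).symm.trans (projVal_map_fam _ φ _ hφ w p)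
  apply dualSym_injective
  rw [numMap_injective p h1, map_sum]
  rfl

end Symbol

section ZeroHom
variable {k g₀ A : Type u} [Field k] [LieRing g₀] [LieAlgebra k g₀] [CommRing A] [Algebra k A]
  {𝒜 : ℕ → Submodule k A} [GradedAlgebra 𝒜]
  {δ : g₀ →ₗ⁅k⁆ Derivation k A A} {hδ : ∀ x n, ∀ a ∈ 𝒜 n, δ x a ∈ 𝒜 n}

theorem map_zeroHom (F G : EquivModule (projAction δ hδ)) (n : ℤ) :
    TwistΓ.map (0 : F ⟶ G) n = 0 := by
  have h : tensorPresheafMap (projAction δ hδ) (EquivModule.Hom.hom (0 : F ⟶ G))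
      (𝟙 (lineBundle δ hδ n).sheaf) = (0 : k) • tensorPresheafMap (projAction δ hδ)
        (EquivModule.Hom.hom (0 : F ⟶ G)) (𝟙 (lineBundle δ hδ n).sheaf) :=
    tensorPresheaf_hom_ext _ fun U m s => by
      rw [zero_smul]
      exact TensorSec.zero_tmul _
  rw [TwistΓ.map, TensorΓ.map, h, sheafifyΓ_smul, zero_smul]

end ZeroHom

/-! ### Symbols, equivariance and composition -/

section SymbolProperties
variable {k g₀ g₁ : Type u} [Field k] [LieRing g₀] [LieAlgebra k g₀] [AddCommGroup g₁] [Module k g₁]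
  [LieRingModule g₀ g₁] [LieModule k g₀ g₁] [Nontrivial g₁]
  {W : Type u} [AddCommGroup W] [Module k W] [LieRingModule g₀ W] [LieModule k g₀ W]
  {W' : Type u} [AddCommGroup W'] [Module k W'] [LieRingModule g₀ W'] [LieModule k g₀ W']
  {W'' : Type u} [AddCommGroup W''] [Module k W''] [LieRingModule g₀ W''] [LieModule k g₀ W'']

/-- The symbol is determined by the values of the section of `W' ⊗ 𝒪(1)` that it represents. -/
theorem symbol_eq_of_numMap {j : ℤ} (φ : projTwist k g₀ g₁ W j ⟶ projTwist k g₀ g₁ W' (j + 1))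
    (w : W) (t : W' ⊗[k] Module.Dual k g₁)
    (h : ∀ p, projVal k g₀ g₁ W' (j + 1) (-j) p (TwistΓ.map φ (-j) (projUnit k g₀ g₁ W j w)) =
      numMap _ W' p (dualSym k g₁ W' t)) : symbol φ w = t := by
  let p := genericPt (hasLinearForms_symDeg (k := k) (M := Module.Dual k g₁)).exists_ne_zero
  exact dualSym_injective (numMap_injective p ((projVal_map_projUnit φ w p).symm.trans (h p)))

omit [Nontrivial g₁] in
theorem tensorAct_dualSym (x : g₀) (t : W ⊗[k] Module.Dual k g₁) :
    tensorAct (symLieAction (k := k) (M := Module.Dual k g₁) g₀ x) x (dualSym k g₁ W t) =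
      dualSym k g₁ W ⁅x, t⁆ := by
  induction t with
  | zero => simp
  | add s t hs ht => simp only [map_add, lie_add, hs, ht]
  | tmul w f =>
    rw [TensorProduct.LieModule.lie_tmul_right, map_add, dualSym_tmul, dualSym_tmul, dualSym_tmul,
      tensorAct_tmul, add_comm]
    congr 2
    exact symDerivation_ι _ _

theorem projVal_lie {j n : ℤ} (x : g₀) (s : TwistΓ (projTwist k g₀ g₁ W j) n) (p) :
    projVal k g₀ g₁ W j n p ⁅x, s⁆ = locAct W (symLieAction g₀) x p (projVal k g₀ g₁ W j n p s) :=
  valΓ_lie coveredByLinear_symDeg x s p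

/-- The symbol of an equivariant morphism is equivariant. -/
theorem symbol_lie {j : ℤ} (φ : projTwist k g₀ g₁ W j ⟶ projTwist k g₀ g₁ W' (j + 1)) (x : g₀)
    (w : W) : symbol φ ⁅x, w⁆ = ⁅x, symbol φ w⁆ := by
  refine symbol_eq_of_numMap φ _ _ fun p => ?_
  rw [projUnit_lie, TwistΓ.map_lie, projVal_lie, projVal_map_projUnit, ← tensorAct_dualSym,
    numMap_tensorAct]
  rfl

omit [Nontrivial g₁] in
theorem evalDual_lie (x : g₀) (y : g₁) (t : W ⊗[k] Module.Dual k g₁) :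
    evalDual g₁ W ⁅x, y⁆ t = ⁅x, evalDual g₁ W y t⁆ - evalDual g₁ W y ⁅x, t⁆ := by
  induction t with
  | zero => simp
  | add s t hs ht => simp only [map_add, lie_add, hs, ht]; abel
  | tmul w f =>
    rw [TensorProduct.LieModule.lie_tmul_right, map_add, evalDual_tmul, evalDual_tmul,
      evalDual_tmul, evalDual_tmul, Module.Dual.lie_apply, lie_smul,
      neg_smul]
    abel

variable (k W) in
/-- The evaluation `S(g₁*) ⊗ W → W` at a point `y` of `g₁`. -/
def evalSym (y : g₁) : SymmetricAlgebra k (Module.Dual k g₁) ⊗[k] W →ₗ[k] W :=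
  (TensorProduct.lid k W).toLinearMap ∘ₗ LinearMap.rTensor W
    (SymmetricAlgebra.lift (Module.Dual.eval k g₁ y)).toLinearMap

omit [Nontrivial g₁] in
theorem evalSym_tmul (y : g₁) (a : SymmetricAlgebra k (Module.Dual k g₁)) (w : W) :
    evalSym k W y (a ⊗ₜ w) = SymmetricAlgebra.lift (Module.Dual.eval k g₁ y) a • w := rfl

omit [Nontrivial g₁] in
theorem evalSym_ι_smul (y : g₁) (f : Module.Dual k g₁)
    (z : SymmetricAlgebra k (Module.Dual k g₁) ⊗[k] W) :
    evalSym k W y (SymmetricAlgebra.ι k _ f • z) = f y • evalSym k W y z := by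
  induction z with
  | zero => simp
  | add s t hs ht => simp only [map_add, smul_add, hs, ht]
  | tmul a w =>
    rw [TensorProduct.smul_tmul', evalSym_tmul, evalSym_tmul, smul_eq_mul, map_mul,
      SymmetricAlgebra.lift_ι_apply, mul_smul]
    rfl

omit [Nontrivial g₁] in
theorem evalSym_dualSym (y : g₁) (t : W ⊗[k] Module.Dual k g₁) :
    evalSym k W y (dualSym k g₁ W t) = evalDual g₁ W y t := by
  induction t with
  | zero => simp
  | add s t hs ht => simp only [map_add, hs, ht]
  | tmul w f =>
    rw [dualSym_tmul, evalSym_tmul, SymmetricAlgebra.lift_ι_apply, evalDual_tmul]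
    rfl

/-- The image under `φ` of the section of `W' ⊗ 𝒪(1)` represented by `t` is an element `c` of
`S(g₁*) ⊗ W''` of degree `2`, which is a quadratic map on `g₁`: at `y` it is obtained from `t` by
evaluating at `y`, taking the symbol of `φ`, and evaluating at `y` again. -/
theorem exists_symbol_comp {j : ℤ}
    (φ : projTwist k g₀ g₁ W' (j + 1) ⟶ projTwist k g₀ g₁ W'' (j + 1 + 1))
    (t : W' ⊗[k] Module.Dual k g₁) :
    ∃ c : SymmetricAlgebra k (Module.Dual k g₁) ⊗[k] W'',
      (∀ p, projVal k g₀ g₁ W'' (j + 1 + 1) (-j) p (TwistΓ.map φ (-j)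
        (mulDual (projTwist k g₀ g₁ W' (j + 1)) (by ring)
          (LinearMap.rTensor _ (projUnit k g₀ g₁ W' (j + 1)).toLinearMap t))) =
        numMap _ W'' p c) ∧
      ∀ y, evalSym k W'' y c = evalDual g₁ W'' y (symbol φ (evalDual g₁ W' y t)) := by
  induction t with
  | zero => exact ⟨0, fun p => by simp only [map_zero], fun y => by simp only [map_zero]⟩
  | add s t hs ht =>
    obtain ⟨c, hc, hc'⟩ := hs
    obtain ⟨d, hd, hd'⟩ := ht
    exact ⟨c + d, fun p => by simp only [map_add, hc, hd], fun y => by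
      simp only [map_add, hc', hd']⟩
  | tmul w f =>
    refine ⟨SymmetricAlgebra.ι k _ f • dualSym k g₁ W'' (symbol φ w), fun p => ?_, fun y => ?_⟩
    · rw [LinearMap.rTensor_tmul]
      have h1 : TwistΓ.map φ (-j) (mulDual (projTwist k g₀ g₁ W' (j + 1)) (by ring)
          (projUnit k g₀ g₁ W' (j + 1) w ⊗ₜ f)) =
          TwistΓ.mul (projTwist k g₀ g₁ W'' (j + 1 + 1)) (by ring) (linearForm k g₁ f)
            (TwistΓ.map φ (-(j + 1)) (projUnit k g₀ g₁ W' (j + 1) w)) :=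
        TwistΓ.mul_map φ _ _ _
      refine (congrArg _ h1).trans ?_
      rw [projVal_mul, projVal_map_projUnit, numMap_smul]
      rfl
    · rw [evalSym_ι_smul, evalSym_dualSym, evalDual_tmul, map_smul, map_smul]

/-- If two consecutive differentials compose to zero, then the operator that `y` defines by their
symbols has square zero. -/
theorem evalDual_symbol_self {j : ℤ} {φ : projTwist k g₀ g₁ W j ⟶ projTwist k g₀ g₁ W' (j + 1)}
    {φ' : projTwist k g₀ g₁ W' (j + 1) ⟶ projTwist k g₀ g₁ W'' (j + 1 + 1)} (h : φ ≫ φ' = 0)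
    (y : g₁) (w : W) :
    evalDual g₁ W'' y (symbol φ' (evalDual g₁ W' y (symbol φ w))) = 0 := by
  obtain ⟨c, hc, hc'⟩ := exists_symbol_comp φ' (symbol φ w)
  let p := genericPt (hasLinearForms_symDeg (k := k) (M := Module.Dual k g₁)).exists_ne_zero
  have h1 := hc p
  rw [← map_projUnit, ← LinearMap.comp_apply (TwistΓ.map φ' (-j)), ← TwistΓ.map_comp, h,
    map_zeroHom, LinearMap.zero_apply, map_zero] at h1
  rw [← hc', ← numMap_injective p ((map_zero _).trans h1), map_zero]

/-- If two consecutive differentials compose to zero, then the odd operators defined by their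
symbols anticommute. -/
theorem evalDual_symbol_symm {j : ℤ} {φ : projTwist k g₀ g₁ W j ⟶ projTwist k g₀ g₁ W' (j + 1)}
    {φ' : projTwist k g₀ g₁ W' (j + 1) ⟶ projTwist k g₀ g₁ W'' (j + 1 + 1)} (h : φ ≫ φ' = 0)
    (a b : g₁) (w : W) :
    evalDual g₁ W'' a (symbol φ' (evalDual g₁ W' b (symbol φ w))) +
      evalDual g₁ W'' b (symbol φ' (evalDual g₁ W' a (symbol φ w))) = 0 := by
  have h1 := evalDual_symbol_self h (a + b) w
  simp only [map_add, LinearMap.add_apply, evalDual_symbol_self h, zero_add, add_zero] at h1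
  rw [add_comm]
  exact h1

/-- The symbol of `φ` is the only tensor that multiplication maps to the sections induced by `φ`. -/
theorem symbol_unique {j : ℤ} (φ : projTwist k g₀ g₁ W j ⟶ projTwist k g₀ g₁ W' (j + 1)) (w : W)
    (t : W' ⊗[k] Module.Dual k g₁) (h : TwistΓ.map φ (-j) (projUnit k g₀ g₁ W j w) =
      mulDual (projTwist k g₀ g₁ W' (j + 1)) (by ring)
        (LinearMap.rTensor _ (projUnit k g₀ g₁ W' (j + 1)).toLinearMap t)) : symbol φ w = t :=
  symbol_eq_of_numMap φ w t fun p => by rw [h, projVal_mulDual]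

theorem symbol_projTwistMap_comp {j : ℤ}
    (φ : projTwist k g₀ g₁ W' j ⟶ projTwist k g₀ g₁ W'' (j + 1))
    (f : W →ₗ[k] W') (hf : ∀ (x : g₀) w, f ⁅x, w⁆ = ⁅x, f w⁆) (w : W) :
    symbol (projTwistMap f hf j ≫ φ) w = symbol φ (f w) := by
  refine symbol_unique _ _ _ ?_
  rw [TwistΓ.map_comp, LinearMap.comp_apply, map_projTwistMap, map_projUnit]

theorem symbol_comp_projTwistMap {j : ℤ}
    (φ : projTwist k g₀ g₁ W j ⟶ projTwist k g₀ g₁ W' (j + 1))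
    (f : W' →ₗ[k] W'') (hf : ∀ (x : g₀) w, f ⁅x, w⁆ = ⁅x, f w⁆) (w : W) :
    symbol (φ ≫ projTwistMap f hf (j + 1)) w = LinearMap.rTensor _ f (symbol φ w) := by
  refine symbol_unique _ _ _ ?_
  rw [TwistΓ.map_comp, LinearMap.comp_apply, map_projUnit, ← mulDual_natural,
    ← LinearMap.comp_apply (LinearMap.rTensor _ _), ← LinearMap.comp_apply (LinearMap.rTensor _ _),
    ← LinearMap.rTensor_comp, ← LinearMap.rTensor_comp]
  congr 3
  exact LinearMap.ext fun w => map_projTwistMap f hf (j + 1) w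

end SymbolProperties

/-! ### Section modules of isomorphic complexes -/

section Transport
variable {k g₀ g₁ : Type u} [Field k] [LieRing g₀] [LieAlgebra k g₀] [AddCommGroup g₁] [Module k g₁]
  [LieRingModule g₀ g₁] [LieModule k g₀ g₁]
  {S : LieSuperalgebra k g₀ g₁} {L L' : CochainComplex (GSheaf k g₀ g₁) ℤ}

/-- An isomorphism of equivariant sheaves induces an isomorphism `Γ(F(n)) ≃ Γ(G(n))`. -/
def twistΓEquiv {F G : GSheaf k g₀ g₁} (e : F ≅ G) (n : ℤ) : TwistΓ F n ≃ₗ[k] TwistΓ G n :=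
  LinearEquiv.ofLinearMap (TwistΓ.map e.hom n) (TwistΓ.map e.inv n)
    (by rw [← TwistΓ.map_comp, e.inv_hom_id, TwistΓ.map_id])
    (by rw [← TwistΓ.map_comp, e.hom_inv_id, TwistΓ.map_id])

theorem mulDual_bijective_of_iso {F G : GSheaf k g₀ g₁} (e : F ≅ G) {n n' : ℤ} (hn : n' = n + 1)
    (h : Function.Bijective (mulDual F hn)) : Function.Bijective (mulDual G hn) := by
  have h1 : mulDual G hn ∘ₗ (LinearEquiv.rTensor (Module.Dual k g₁) (twistΓEquiv e n)).toLinearMap =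
      (twistΓEquiv e n').toLinearMap ∘ₗ mulDual F hn :=
    LinearMap.ext fun t => mulDual_natural e.hom hn t
  have h2 : Function.Bijective (mulDual G hn ∘
      LinearEquiv.rTensor (Module.Dual k g₁) (twistΓEquiv e n)) := by
    change Function.Bijective ⇑(mulDual G hn ∘ₗ
      (LinearEquiv.rTensor (Module.Dual k g₁) (twistΓEquiv e n)).toLinearMap)
    rw [h1]
    exact (twistΓEquiv e n').bijective.comp h
  exact (Function.Bijective.of_comp_iff _ (LinearEquiv.bijective _)).1 h2

/-- As `[g₁, g₁] = 0`, the axiom for the odd bracket reduces to anticommutation. -/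
theorem hasSectionModule_of_symm (hS : ∀ a b : g₁, S.oddBracket a b = 0)
    (hb : ∀ j, Function.Bijective (sectionMul L j))
    (hl : ∀ (j : ℤ) (x : g₀) (y : g₁) (v : sectionPiece L j),
      sectionOdd L j ⁅x, y⁆ v = ⁅x, sectionOdd L j y v⁆ - sectionOdd L j y ⁅x, v⁆)
    (hs : ∀ (j : ℤ) (a b : g₁) (v : sectionPiece L j),
      sectionOdd L (j + 1) a (sectionOdd L j b v) +
        sectionOdd L (j + 1) b (sectionOdd L j a v) = 0) :
    HasSectionModule L S :=
  ⟨hb, hl, fun j a b v => by rw [hS, zero_lie, map_zero, hs, map_zero]⟩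

theorem HasSectionModule.symm (h : HasSectionModule L S) (hS : ∀ a b : g₁, S.oddBracket a b = 0)
    (j : ℤ) (a b : g₁) (v : sectionPiece L j) :
    sectionOdd L (j + 1) a (sectionOdd L j b v) + sectionOdd L (j + 1) b (sectionOdd L j a v) =
      0 := by
  have h1 := h.oddBracket_lie j a b v
  rw [hS, zero_lie, map_zero] at h1
  exact DirectSum.of_injective (β := sectionPiece L) _ (h1.symm.trans (map_zero _).symm)

theorem HasSectionModule.symm_of_iso (hS : ∀ a b : g₁, S.oddBracket a b = 0) (e : L ≅ L')
    (h : HasSectionModule L S) (hb : ∀ j, Function.Bijective (sectionMul L' j)) (j : ℤ) (a b : g₁)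
    (w : sectionPiece L j) :
    sectionOdd L' (j + 1) a (sectionOdd L' j b (TwistΓ.map (e.hom.f j) (-j) w)) +
      sectionOdd L' (j + 1) b (sectionOdd L' j a (TwistΓ.map (e.hom.f j) (-j) w)) = 0 := by
  have h1 (a b : g₁) : sectionOdd L' (j + 1) a
      (sectionOdd L' j b (TwistΓ.map (e.hom.f j) (-j) w)) =
      TwistΓ.map (e.hom.f (j + 1 + 1)) (-(j + 1 + 1))
        (sectionOdd L (j + 1) a (sectionOdd L j b w)) :=
    ((sectionOdd_natural e.hom (j + 1) (h.bijective _) (hb _) a (sectionOdd L j b w)).trans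
      (congrArg (sectionOdd L' (j + 1) a)
        (sectionOdd_natural e.hom j (h.bijective j) (hb j) b w))).symm
  refine (congrArg₂ (· + ·) (h1 a b) (h1 b a)).trans ?_
  refine (map_add (TwistΓ.map (e.hom.f (j + 1 + 1)) (-(j + 1 + 1))) _ _).symm.trans ?_
  exact (congrArg _ (h.symm hS j a b w)).trans (map_zero _)

/-- The sections of a complex form a graded module if this holds for an isomorphic complex. -/
theorem HasSectionModule.of_iso (hS : ∀ a b : g₁, S.oddBracket a b = 0) (e : L ≅ L')
    (h : HasSectionModule L S) : HasSectionModule L' S := by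
  have hb (j) : Function.Bijective (sectionMul L' j) :=
    mulDual_bijective_of_iso ((HomologicalComplex.eval _ _ (j + 1)).mapIso e) _ (h.bijective j)
  have hs (j) : Function.Surjective (TwistΓ.map (e.hom.f j) (-j)) :=
    (twistΓEquiv ((HomologicalComplex.eval _ _ j).mapIso e) (-j)).surjective
  have ho (j) (x : g₁) (v : sectionPiece L j) :=
    sectionOdd_natural e.hom j (h.bijective j) (hb j) x v
  refine hasSectionModule_of_symm hS hb (fun j x y => (hs j).forall.2 fun v => ?_)
    (fun j a b => (hs j).forall.2 fun v => h.symm_of_iso hS e hb j a b v)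
  rw [← ho, h.lie_odd, map_sub, TwistΓ.map_lie, ho, ho, TwistΓ.map_lie]

end Transport

/-! ### Rigid complexes come from graded modules -/

section ModuleOfRigidForm
variable {k g₀ g₁ : Type u} [Field k] [LieRing g₀] [LieAlgebra k g₀] [AddCommGroup g₁] [Module k g₁]
  [LieRingModule g₀ g₁] [LieModule k g₀ g₁] [Nontrivial g₁]
  {S : LieSuperalgebra k g₀ g₁}

/-- The graded module with pieces `Vʲ` attached to a complex with terms `Vʲ ⊗ 𝒪(j)`: the odd
elements act through the symbols of the differentials. -/
def RigidForm.toGrMod (hS : ∀ a b : g₁, S.oddBracket a b = 0) (R : RigidForm k g₀ g₁) :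
    GrMod S where
  piece := R.piece
  odd j := LinearMap.compl₂ (evalDual g₁ (R.piece (j + 1))) (symbol (R.d j))
  lie_odd j x y v := by
    simp only [LinearMap.compl₂_apply]
    rw [evalDual_lie, symbol_lie]
  oddBracket_lie j a b v := by
    simp only [LinearMap.compl₂_apply]
    rw [hS, zero_lie, map_zero, evalDual_symbol_symm (R.d_comp_d j), map_zero]

variable [Module.Finite k g₁]

theorem symbol_complexD (V : GrMod S) (j : ℤ) (v : V.piece j) :
    symbol (complexD V j) v =
      ∑ i, V.odd j (Module.finBasis k g₁ i) v ⊗ₜ[k] (Module.finBasis k g₁).coord i :=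
  symbol_fam (fun i => (Module.finBasis k g₁).coord i) (complexD V j) rfl v

theorem evalDual_symbol_complexD (V : GrMod S) (j : ℤ) (y : g₁) (v : V.piece j) :
    evalDual g₁ (V.piece (j + 1)) y (symbol (complexD V j) v) = V.odd j y v := by
  rw [symbol_complexD, map_sum]
  simp only [evalDual_tmul]
  conv_rhs => rw [← (Module.finBasis k g₁).sum_repr y]
  simp only [map_sum, map_smul, LinearMap.sum_apply, LinearMap.smul_apply]
  rfl

/-- A tensor in `M ⊗ g₁*` is recovered from its values on a basis of `g₁`. -/
theorem sum_evalDual_tmul {M : Type u} [AddCommGroup M] [Module k M]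
    (t : M ⊗[k] Module.Dual k g₁) :
    ∑ i, evalDual g₁ M (Module.finBasis k g₁ i) t ⊗ₜ[k] (Module.finBasis k g₁).coord i = t := by
  induction t with
  | zero => simp
  | add s t hs ht =>
    simp only [map_add, TensorProduct.add_tmul, Finset.sum_add_distrib, hs, ht]
  | tmul m f =>
    simp only [evalDual_tmul, TensorProduct.smul_tmul, ← TensorProduct.tmul_sum]
    congr 1
    refine (Module.finBasis k g₁).ext fun l => ?_
    simp

/-- The differential of `L(V)` has the same symbol as the given one, for the module `V` defined by
the given symbols. -/
theorem RigidForm.complexD_toGrMod (hS : ∀ a b : g₁, S.oddBracket a b = 0)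
    (R : RigidForm k g₀ g₁) (j : ℤ) : complexD (R.toGrMod hS) j = R.d j := by
  refine hom_ext_symbol fun w => ?_
  refine (symbol_complexD (R.toGrMod hS) j w).trans ?_
  exact sum_evalDual_tmul _

theorem cochainComplex_of_congr {V : Type*} [Category V] [Limits.HasZeroMorphisms V] {X : ℤ → V}
    {d d' : ∀ j, X j ⟶ X (j + 1)} (h : d = d') (hd : ∀ j, d j ≫ d (j + 1) = 0)
    (hd' : ∀ j, d' j ≫ d' (j + 1) = 0) : CochainComplex.of X d hd = CochainComplex.of X d' hd' := by
  subst h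
  rfl

variable [NeZero (2 : k)]

/-- A complex with terms `Vʲ ⊗ 𝒪(j)` is equal to `L(V)` for a graded module `V`. -/
theorem RigidForm.complexOf_toGrMod (hS : ∀ a b : g₁, S.oddBracket a b = 0)
    (R : RigidForm k g₀ g₁) : complexOf (R.toGrMod hS) = R.complex :=
  cochainComplex_of_congr (X := fun j => projTwist k g₀ g₁ (R.piece j) j)
    (funext fun j => R.complexD_toGrMod hS j) (complexD_comp (R.toGrMod hS)) R.d_comp_d

omit [Nontrivial g₁] in
theorem complexOf_d (V : GrMod S) (j : ℤ) : (complexOf V).d j (j + 1) = complexD V j := by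
  simp only [complexOf, CochainComplex.of_d]

/-- The canonical isomorphism from `Vʲ` to the `j`-th piece of `V(L(V))`. -/
def pieceUnit (V : GrMod S) (j : ℤ) : V.piece j ≃ₗ[k] sectionPiece (complexOf V) j :=
  projUnit k g₀ g₁ (V.piece j) j

theorem pieceUnit_lie (V : GrMod S) (j : ℤ) (x : g₀) (v : V.piece j) :
    pieceUnit V j ⁅x, v⁆ = ⁅x, pieceUnit V j v⁆ :=
  projUnit_lie j x v

theorem sectionMul_complexOf_bijective (V : GrMod S) (j : ℤ) :
    Function.Bijective (sectionMul (complexOf V) j) :=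
  mulDual_bijective (W := V.piece (j + 1)) _

/-- On `V(L(V))` the odd elements act as on `V` up to the sign `(-1)ʲ`. -/
theorem sectionOdd_pieceUnit (V : GrMod S) (j : ℤ) (y : g₁) (v : V.piece j) :
    sectionOdd (complexOf V) j y (pieceUnit V j v) =
      (-1 : k) ^ j • pieceUnit V (j + 1) (V.odd j y v) := by
  rw [sectionOdd_apply, complexOf_d]
  congr 1
  refine (congrArg (evalDual g₁ _ y) (rTensor_symbol (complexD V j) v).symm).trans ?_
  rw [evalDual_natural, evalDual_symbol_complexD]
  rfl

theorem sectionOdd_complexOf_lie (V : GrMod S) (j : ℤ) (x : g₀) (y : g₁)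
    (v : sectionPiece (complexOf V) j) :
    sectionOdd (complexOf V) j ⁅x, y⁆ v =
      ⁅x, sectionOdd (complexOf V) j y v⁆ - sectionOdd (complexOf V) j y ⁅x, v⁆ := by
  obtain ⟨v, rfl⟩ := (pieceUnit V j).surjective v
  rw [← pieceUnit_lie, sectionOdd_pieceUnit, sectionOdd_pieceUnit, sectionOdd_pieceUnit,
    V.lie_odd, lie_smul, ← pieceUnit_lie, map_sub, smul_sub]

theorem sectionOdd_complexOf_symm (V : GrMod S) (j : ℤ) (a b : g₁)
    (v : sectionPiece (complexOf V) j) :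
    sectionOdd (complexOf V) (j + 1) a (sectionOdd (complexOf V) j b v) +
      sectionOdd (complexOf V) (j + 1) b (sectionOdd (complexOf V) j a v) = 0 := by
  obtain ⟨v, rfl⟩ := (pieceUnit V j).surjective v
  rw [sectionOdd_pieceUnit, sectionOdd_pieceUnit, map_smul, map_smul,
    sectionOdd_pieceUnit, sectionOdd_pieceUnit, ← smul_add, ← smul_add, ← map_add, V.odd_odd,
    map_zero, smul_zero, smul_zero]

theorem hasSectionModule_complexOf (hS : ∀ a b : g₁, S.oddBracket a b = 0) (V : GrMod S) :
    HasSectionModule (complexOf V) S :=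
  hasSectionModule_of_symm hS (sectionMul_complexOf_bijective V) (sectionOdd_complexOf_lie V)
    (sectionOdd_complexOf_symm V)

end ModuleOfRigidForm

/-! ### The equivalence of categories -/

section EquivalenceOfCategories
variable {k g₀ g₁ : Type u} [Field k] [LieRing g₀] [LieAlgebra k g₀] [AddCommGroup g₁] [Module k g₁]
  [LieRingModule g₀ g₁] [LieModule k g₀ g₁] [Nontrivial g₁] [Module.Finite k g₁] [NeZero (2 : k)]
  {S : LieSuperalgebra k g₀ g₁}

/-- Every rigid complex is isomorphic to `L(V)` for a graded module `V`. -/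
theorem IsRigid.exists_iso_complexOf (hS : ∀ a b : g₁, S.oddBracket a b = 0)
    {L : CochainComplex (GSheaf k g₀ g₁) ℤ} (h : IsRigid k g₀ g₁ L) :
    ∃ V : GrMod S, Nonempty (L ≅ complexOf V) := by
  obtain ⟨R, hR⟩ := h.2
  refine ⟨R.toGrMod hS, ?_⟩
  rw [R.complexOf_toGrMod hS]
  exact hR

/-- For a rigid complex `L` the multiplication maps are bijective and `V(L)` is a graded module. -/
theorem isRigid_le_hasSectionModule (hS : ∀ a b : g₁, S.oddBracket a b = 0) :
    IsRigid k g₀ g₁ ≤ hasSectionModule S := fun _ h => by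
  obtain ⟨V, ⟨e⟩⟩ := h.exists_iso_complexOf hS
  exact HasSectionModule.of_iso hS e.symm (hasSectionModule_complexOf hS V)

theorem map_complexFunctor_map {V W : GrMod S} (φ : V ⟶ W) (j : ℤ) (v : V.piece j) :
    TwistΓ.map (((complexFunctor S).map φ).f j) (-j) (pieceUnit V j v) =
      pieceUnit W j (GrMod.Hom.map φ j v) :=
  map_projTwistMap _ (GrMod.Hom.map_lie φ j) j v

instance : (complexFunctor S).Faithful where
  map_injective {V W φ ψ} h := GrMod.hom_ext fun j => LinearMap.ext fun v =>
    (pieceUnit W j).injective (by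
      rw [← map_complexFunctor_map, ← map_complexFunctor_map, h])

/-- The linear map `Vʲ → Wʲ` induced by a morphism `Vʲ ⊗ 𝒪(j) → Wʲ ⊗ 𝒪(j)`. -/
def pieceMap {V W : GrMod S} (η : complexOf V ⟶ complexOf W) (j : ℤ) :
    V.piece j →ₗ[k] W.piece j :=
  (pieceUnit W j).symm.toLinearMap ∘ₗ TwistΓ.map (η.f j) (-j) ∘ₗ (pieceUnit V j).toLinearMap

theorem pieceUnit_pieceMap {V W : GrMod S} (η : complexOf V ⟶ complexOf W) (j : ℤ)
    (v : V.piece j) :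
    pieceUnit W j (pieceMap η j v) = TwistΓ.map (η.f j) (-j) (pieceUnit V j v) :=
  (pieceUnit W j).apply_symm_apply _

theorem pieceMap_lie {V W : GrMod S} (η : complexOf V ⟶ complexOf W) (j : ℤ) (x : g₀)
    (v : V.piece j) : pieceMap η j ⁅x, v⁆ = ⁅x, pieceMap η j v⁆ :=
  (pieceUnit W j).injective (by
    rw [pieceUnit_pieceMap, pieceUnit_lie, pieceUnit_lie, pieceUnit_pieceMap, TwistΓ.map_lie])

/-- A morphism `L(V) → L(W)` is in each degree of the form `f ⊗ id`. -/
theorem projTwistMap_pieceMap {V W : GrMod S} (η : complexOf V ⟶ complexOf W) (j : ℤ) :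
    projTwistMap (pieceMap η j) (pieceMap_lie η j) j = η.f j :=
  projTwist_hom_ext fun w =>
    (map_projTwistMap _ (pieceMap_lie η j) j w).trans (pieceUnit_pieceMap η j w)

/-- The maps induced on the pieces commute with the odd operators, by comparing the symbols of the
two sides of the equation that the morphism commutes with the differentials. -/
theorem pieceMap_odd {V W : GrMod S} (η : complexOf V ⟶ complexOf W) (j : ℤ) (y : g₁)
    (v : V.piece j) : pieceMap η (j + 1) (V.odd j y v) = W.odd j y (pieceMap η j v) := by
  have h1 : projTwistMap (pieceMap η j) (pieceMap_lie η j) j ≫ complexD W j =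
      complexD V j ≫ projTwistMap (pieceMap η (j + 1)) (pieceMap_lie η (j + 1)) (j + 1) := by
    rw [projTwistMap_pieceMap, projTwistMap_pieceMap, ← complexOf_d, ← complexOf_d]
    exact η.comm j (j + 1)
  rw [← evalDual_symbol_complexD V, ← evalDual_symbol_complexD W, ← symbol_projTwistMap_comp _ _
    (pieceMap_lie η j), h1, symbol_comp_projTwistMap, evalDual_natural]

instance : (complexFunctor S).Full where
  map_surjective {V W} η := ⟨GrMod.Hom.mk (pieceMap η) (pieceMap_lie η) (pieceMap_odd η),
    HomologicalComplex.hom_ext _ _ fun j => projTwistMap_pieceMap η j⟩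

/-- The isomorphism of graded modules given by linear isomorphisms of the pieces. -/
def GrMod.isoMk {V W : GrMod S} (f : ∀ j, V.piece j ≃ₗ[k] W.piece j)
    (hl : ∀ j (x : g₀) v, f j ⁅x, v⁆ = ⁅x, f j v⁆)
    (ho : ∀ j (y : g₁) v, f (j + 1) (V.odd j y v) = W.odd j y (f j v)) : V ≅ W where
  hom := GrMod.Hom.mk (fun j => (f j).toLinearMap) hl ho
  inv := GrMod.Hom.mk (fun j => (f j).symm.toLinearMap)
    (fun j x v => (f j).injective (by simp [hl]))
    (fun j y v => (f (j + 1)).injective (by simp [ho]))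
  hom_inv_id := GrMod.hom_ext fun j => (f j).symm_comp
  inv_hom_id := GrMod.hom_ext fun j => (f j).comp_symm

variable (k) in
/-- The signs `(-1)^(j(j-1)/2)`, which satisfy `s_(j+1) = (-1)ʲ s_j`. -/
def triangularSign (j : ℤ) : kˣ := (-1) ^ (j * (j - 1) / 2)

omit [NeZero (2 : k)] in
theorem triangularSign_add_one (j : ℤ) :
    (triangularSign k (j + 1) : k) = triangularSign k j * (-1) ^ j := by
  have h : (j + 1) * (j + 1 - 1) / 2 = j * (j - 1) / 2 + j := by
    rw [← Int.add_mul_ediv_right _ _ two_ne_zero]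
    congr 1
    ring
  rw [triangularSign, triangularSign, h, zpow_add]
  simp

/-- The isomorphism `V ≅ V(L(V))`: the signs `s_j` absorb the sign `(-1)ʲ` in the odd action. -/
def sectionModuleIso (V : GrMod S) (h : HasSectionModule (complexOf V) S) :
    V ≅ sectionModule h :=
  GrMod.isoMk (W := sectionModule h)
    (fun j => (pieceUnit V j).trans
      (LinearEquiv.smulOfUnit (R := k) (M := sectionPiece (complexOf V) j) (triangularSign k j)))
    (fun j x v => by
      change triangularSign k j • pieceUnit V j ⁅x, v⁆ = ⁅x, triangularSign k j • pieceUnit V j v⁆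
      rw [pieceUnit_lie, Units.smul_def, Units.smul_def, lie_smul])
    (fun j y v => by
      change triangularSign k (j + 1) • pieceUnit V (j + 1) (V.odd j y v) =
        sectionOdd (complexOf V) j y (triangularSign k j • pieceUnit V j v)
      rw [Units.smul_def, Units.smul_def, map_smul, sectionOdd_pieceUnit, smul_smul,
        triangularSign_add_one])

variable (hL : ∀ V : GrMod S, IsRigid k g₀ g₁ ((complexFunctor S).obj V))

include hL in
theorem essSurj_lift (hS : ∀ a b : g₁, S.oddBracket a b = 0) :
    ((IsRigid k g₀ g₁).lift (complexFunctor S) hL).EssSurj where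
  mem_essImage L := by
    obtain ⟨V, ⟨e⟩⟩ := L.property.exists_iso_complexOf hS
    exact ⟨V, ⟨(IsRigid k g₀ g₁).isoMk e.symm⟩⟩

/-- The natural isomorphism `V(L(-)) ≅ id`. -/
def liftCompSectionIso (hV : IsRigid k g₀ g₁ ≤ hasSectionModule S) :
    (IsRigid k g₀ g₁).lift (complexFunctor S) hL ⋙ ObjectProperty.ιOfLE hV ⋙ sectionFunctor S ≅
      𝟭 (GrMod S) :=
  (NatIso.ofComponents (fun V => sectionModuleIso V (hV _ (hL V))) fun {V W} φ =>
    GrMod.hom_ext fun j => LinearMap.ext fun v => by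
      change (triangularSign k j : k) • pieceUnit W j (GrMod.Hom.map φ j v) =
        TwistΓ.map (((complexFunctor S).map φ).f j) (-j)
          ((triangularSign k j : k) • pieceUnit V j v)
      exact ((LinearMap.map_smul (TwistΓ.map (((complexFunctor S).map φ).f j) (-j)) _ _).trans
        (congrArg _ (map_complexFunctor_map φ j v))).symm).symm

/-- The equivalence between graded modules and rigid complexes, with the prescribed functors. -/
def rigidEquivalence (hS : ∀ a b : g₁, S.oddBracket a b = 0)
    (hV : IsRigid k g₀ g₁ ≤ hasSectionModule S) :
    GrMod S ≌ (IsRigid k g₀ g₁).FullSubcategory :=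
  haveI := essSurj_lift hL hS
  haveI : ((IsRigid k g₀ g₁).lift (complexFunctor S) hL).IsEquivalence := {}
  let e := ((IsRigid k g₀ g₁).lift (complexFunctor S) hL).asEquivalence
  e.changeInverse (e.inverse.rightUnitor.symm ≪≫
    Functor.isoWhiskerLeft e.inverse (liftCompSectionIso hL hV).symm ≪≫
    (Functor.associator _ _ _).symm ≪≫
    Functor.isoWhiskerRight e.counitIso (ObjectProperty.ιOfLE hV ⋙ sectionFunctor S) ≪≫
    Functor.leftUnitor _)

end EquivalenceOfCategories

/-! ### Quasi-coherence -/

section FreeOfBasis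
variable {C : Type*} [Category C]

/-- The linear maps on sections defined on compatible bases. -/
def basisMap {R : Cᵒᵖ ⥤ RingCat.{u}} {M N : PresheafOfModules.{u} R} {I : Type u}
    (b : ∀ X, Module.Basis I (R.obj X) (M.obj X)) (t : I → N.sections) (X : Cᵒᵖ) :
    M.obj X →ₗ[R.obj X] N.obj X := (b X).constr ℕ fun i => (t i).eval X

theorem basisMap_basis {R : Cᵒᵖ ⥤ RingCat.{u}} {M N : PresheafOfModules.{u} R} {I : Type u}
    (b : ∀ X, Module.Basis I (R.obj X) (M.obj X)) (t : I → N.sections) (X : Cᵒᵖ) (i : I) :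
    basisMap b t X (b X i) = (t i).eval X := (b X).constr_basis ℕ _ i

/-- The morphism of presheaves of modules defined on compatible bases of the sections. -/
def basisHom {R : Cᵒᵖ ⥤ RingCat.{u}} {M N : PresheafOfModules.{u} R} {I : Type u}
    (b : ∀ X, Module.Basis I (R.obj X) (M.obj X))
    (hb : ∀ ⦃X Y : Cᵒᵖ⦄ (f : X ⟶ Y) i, M.map f (b X i) = b Y i) (t : I → N.sections) : M ⟶ N where
  app X := ModuleCat.ofHom (basisMap b t X)
  naturality {X Y} f := by
    ext m
    change basisMap b t Y (M.map f m) = N.map f (basisMap b t X m)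
    have hm : m ∈ Submodule.span (R.obj X) (Set.range (b X)) := (b X).mem_span m
    induction hm using Submodule.span_induction with
    | zero =>
      rw [map_zero, map_zero]
      exact (map_zero _).trans (map_zero _).symm
    | add x y _ _ hx hy =>
      rw [map_add, map_add, map_add]
      exact (map_add _ _ _).trans (congrArg₂ _ hx hy)
    | smul r x _ hx =>
      have h1 := PresheafOfModules.map_smul _ f r x
      have h2 := PresheafOfModules.map_smul _ f r (basisMap b t X x)
      exact ((congrArg _ h1).trans (map_smul (basisMap b t Y) _ _)).trans
        ((congrArg (R.map f r • ·) hx).trans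
          (h2.symm.trans (congrArg (N.map f) (map_smul (basisMap b t X) r x).symm)))
    | mem x hx =>
      obtain ⟨i, rfl⟩ := hx
      rw [hb, basisMap_basis, basisMap_basis]
      exact ((t i).2 f).symm

/-- A sheaf of modules is free if some of its global sections restrict to a basis of the sections
over every object. The inverse is defined on presheaves, so that no infinite direct sum of sheaves
has to be computed. -/
theorem isIso_of_basis {J : GrothendieckTopology C} {R : Sheaf J RingCat.{u}}
    [HasWeakSheafify J AddCommGrpCat.{u}] [J.WEqualsLocallyBijective AddCommGrpCat.{u}]
    {M : SheafOfModules.{u} R} {I : Type u} (s : I → M.sections)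
    (b : ∀ X, Module.Basis I (R.obj.obj X) (M.val.obj X)) (hb : ∀ X i, b X i = (s i).eval X) :
    IsIso (M.freeHomEquiv.symm s) := by
  let ψ : M ⟶ SheafOfModules.free I :=
    ⟨basisHom b (fun X Y f i => by
      rw [hb, hb]; exact PresheafOfModules.sections_property _ f) SheafOfModules.freeSection⟩
  refine ⟨ψ, ?_, ?_⟩
  · apply (SheafOfModules.freeHomEquiv _).injective
    funext i
    rw [SheafOfModules.freeHomEquiv_comp_apply, Equiv.apply_symm_apply]
    apply PresheafOfModules.sections_ext
    intro X
    have h := basisMap_basis (N := (SheafOfModules.free (R := R) I).val) b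
      SheafOfModules.freeSection X i
    rw [hb] at h
    exact h
  · apply SheafOfModules.hom_ext
    apply PresheafOfModules.hom_ext
    intro X
    apply ModuleCat.hom_ext
    refine (b X).ext fun i => ?_
    change (M.freeHomEquiv.symm s).val.app X (basisMap b _ X (b X i)) = b X i
    rw [basisMap_basis, hb]
    exact congrArg (fun t : M.sections => t.1 X) (congrFun (M.freeHomEquiv.apply_symm_apply s) i)

end FreeOfBasis

section QuasicoherentOfBasis
variable {X : Scheme.{u}} {M : X.Modules}

/-- A sheaf of modules is quasi-coherent if it has on each member of an open covering sections that
restrict to bases over all smaller open subsets. -/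
theorem isQuasicoherent_of_basis {κ : Type u} (U : κ → X.Opens) (hU : ∀ x, ∃ i, x ∈ U i)
    {I : Type u} (s : ∀ i, I → Γ(M, U i))
    (b : ∀ (i : κ) (V : X.Opens), V ≤ U i → Module.Basis I Γ(X, V) Γ(M, V))
    (hb : ∀ i V (h : V ≤ U i) l, b i V h l = M.presheaf.map (homOfLE h).op (s i l)) :
    M.IsQuasicoherent := by
  let σ (i : κ) (l : I) : (SheafOfModules.over (R := X.ringCatSheaf) M (U i)).sections :=
    PresheafOfModules.sectionsMk (fun V => M.presheaf.map V.unop.hom.op (s i l)) fun V W f => by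
      exact congrArg (fun t => t.hom (s i l))
        (M.presheaf.map_comp V.unop.hom.op f.unop.left.op).symm
  have hσ (i : κ) : IsIso (SheafOfModules.freeHomEquiv _ |>.symm (σ i)) :=
    isIso_of_basis (σ i) (fun V => b i V.unop.left (leOfHom V.unop.hom))
      (fun V l => hb i V.unop.left (leOfHom V.unop.hom) l)
  let q : SheafOfModules.LocalGeneratorsData (R := X.ringCatSheaf) M :=
    { I := κ
      X := U
      coversTop := (Opens.coversTop_iff _ _).2
        (TopologicalSpace.Opens.ext (by ext x; simpa using hU x))
      generators := fun i => ⟨I, σ i, inferInstance⟩ }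
  have : q.IsLocallyFreeData := by constructor; exact hσ
  exact q.quasiCoherentData.isQuasicoherent

end QuasicoherentOfBasis

section BasisOfTwist
variable {k A : Type u} [Field k] [CommRing A] [Algebra k A] [IsDomain A]
  {𝒜 : ℕ → Submodule k A} [GradedAlgebra 𝒜]
  {W : Type u} [AddCommGroup W] [Module k W] {ι : Type*} (w : Module.Basis ι k W)
  {f : A} (hf : f ∈ 𝒜 1) (j : ℤ) {U : (Proj 𝒜).Opens}
  (hU : U ≤ ProjectiveSpectrum.basicOpen 𝒜 f)

omit [IsDomain A] in
theorem coordAt_smul_powTmul (r : Γ(Proj 𝒜, U)) (i l : ι) (p : ProjectiveSpectrum 𝒜) (hp : p ∈ U) :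
    coordAt w (Loc 𝒜 p) i (twVal (r • powTmul hf j hU (w l)) p hp) =
      w.coord i (w l) • ((secVal 𝒜 r p hp).val * powAt f j p) := by
  rw [twVal_smul, twVal_powTmul, map_smul, coordAt_tmul, smul_eq_mul, mul_smul_comm]

omit [IsDomain A] in
theorem coordAt_linearCombination (g : ι →₀ Γ(Proj 𝒜, U)) (i : ι) (p : ProjectiveSpectrum 𝒜)
    (hp : p ∈ U) :
    coordAt w (Loc 𝒜 p) i (twVal (W := W) (Finsupp.linearCombination Γ(Proj 𝒜, U)
      (fun l => powTmul hf j hU (w l)) g) p hp) = (secVal 𝒜 (g i) p hp).val * powAt f j p := by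
  induction g using Finsupp.induction_linear with
  | zero =>
    rw [map_zero]
    refine (map_zero (coordAt w (Loc 𝒜 p) i)).trans ?_
    exact (((congrArg (· * powAt f j p) HomogeneousLocalization.val_zero)).trans (zero_mul _)).symm
  | add g g' hg hg' =>
    rw [map_add, twVal_add, map_add, hg, hg', Finsupp.add_apply, secVal_add, add_mul]
  | single l r =>
    classical
    rw [Finsupp.linearCombination_single, coordAt_smul_powTmul, Module.Basis.coord_apply,
      Module.Basis.repr_self, Finsupp.single_apply, Finsupp.single_apply]
    split_ifs
    · rw [one_smul]
    · rw [zero_smul]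
      exact (((congrArg (· * powAt f j p) HomogeneousLocalization.val_zero)).trans
        (zero_mul _)).symm

/-- The sections `fʲ wᵢ` form a basis of the sections of `W ⊗ 𝒪(j)` over an open subset on which the
linear form `f` does not vanish, for a basis `wᵢ` of `W`. The integrality of `Proj 𝒜` makes the
coordinates of a section finitely supported, over arbitrary open subsets. -/
def twistBasis (h : ∃ f ∈ 𝒜 1, f ≠ 0) :
    Module.Basis ι Γ(Proj 𝒜, U) Γ(twistSheaf 𝒜 W j, U) :=
  Module.Basis.mk (v := fun i => powTmul hf j hU (w i))
    (by
      rw [linearIndependent_iff]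
      intro g hg
      ext i
      refine sec_ext 𝒜 fun p hp => ?_
      have h1 := coordAt_linearCombination w hf j hU g i p hp
      rw [hg] at h1
      have h2 := congrArg (· * powAt f (-j) p) ((map_zero (coordAt w (Loc 𝒜 p) i)).symm.trans h1)
      simp only [zero_mul, mul_assoc, powAt_mul_neg, mul_one] at h2
      exact h2.symm.trans HomogeneousLocalization.val_zero.symm)
    (by
      rintro s -
      rw [Finsupp.mem_span_range_iff_exists_finsupp]
      have h0 (i) : IsScalarSec 𝒜 0 U
          (fun p => coordAt w (Loc 𝒜 p.1) i (twVal s p.1 p.2) * powAt f (-j) p.1) :=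
        IsScalarSec.mul (by ring) (isScalarSec_coordAt w s.2 i) (isScalarSec_powAt hf (-j) hU)
      choose r hr using fun i => (h0 i).exists_sec
      have hfin : {i | ∃ p hp, coordAt w (Loc 𝒜 p) i (twVal s p hp) ≠ 0}.Finite := by
        by_cases hne : ∃ p, p ∈ U
        · obtain ⟨q, hq⟩ := hne
          refine (finite_coordAt w (twVal s _ (genericPt_mem h hq))).subset fun i hi => ?_
          obtain ⟨p, hp, hi⟩ := hi
          exact fun h1 => hi (coordAt_eq_zero w h s i p hp h1)
        · convert Set.finite_empty
          ext i
          simp only [Set.mem_ofPred_eq, Set.mem_empty_iff_false, iff_false]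
          rintro ⟨p, hp, -⟩
          exact hne ⟨p, hp⟩
      have hr0 (i) (hi : ¬ ∃ p hp, coordAt w (Loc 𝒜 p) i (twVal s p hp) ≠ 0) : r i = 0 :=
        sec_ext 𝒜 fun p hp => by
          push Not at hi
          rw [hr, hi, zero_mul]
          exact HomogeneousLocalization.val_zero.symm
      let g : ι →₀ Γ(Proj 𝒜, U) := Finsupp.ofSupportFinite r (hfin.subset fun i hi => by
        by_contra hi'
        exact hi (hr0 i hi'))
      refine ⟨g, ?_⟩
      refine tw_ext fun p hp => coordAt_ext w fun i => ?_
      refine (coordAt_linearCombination w hf j hU g i p hp).trans ?_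
      change (secVal 𝒜 (r i) p hp).val * _ = _
      rw [hr, mul_assoc, powAt_neg_mul, mul_one])

theorem twistBasis_apply (h : ∃ f ∈ 𝒜 1, f ≠ 0) (i : ι) :
    twistBasis w hf j hU h i = powTmul hf j hU (w i) := Module.Basis.mk_apply _ _ _

theorem isQuasicoherent_twistSheaf (h𝒜 : CoveredByLinear 𝒜) (h : ∃ f ∈ 𝒜 1, f ≠ 0)
    (W : Type u) [AddCommGroup W] [Module k W] (j : ℤ) : (twistSheaf 𝒜 W j).IsQuasicoherent :=
  isQuasicoherent_of_basis (κ := 𝒜 1) (fun f => ProjectiveSpectrum.basicOpen 𝒜 (f : A))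
    (fun p => by
      obtain ⟨f, hf, hp⟩ := h𝒜 p
      exact ⟨⟨f, hf⟩, hp⟩)
    (fun f i => powTmul f.2 j le_rfl (Module.Basis.ofVectorSpace k W i))
    (fun f U hU => twistBasis (Module.Basis.ofVectorSpace k W) f.2 j hU h)
    (fun f U hU i => twistBasis_apply _ f.2 j hU h i)

end BasisOfTwist

section RigidOfModule
variable {k g₀ g₁ : Type u} [Field k] [LieRing g₀] [LieAlgebra k g₀] [AddCommGroup g₁] [Module k g₁]
  [LieRingModule g₀ g₁] [LieModule k g₀ g₁] [Nontrivial g₁]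

theorem isQuasicoherent_projTwist (W : Type u) [AddCommGroup W] [Module k W] [LieRingModule g₀ W]
    [LieModule k g₀ W] (j : ℤ) : (projTwist k g₀ g₁ W j).sheaf.IsQuasicoherent :=
  isQuasicoherent_twistSheaf coveredByLinear_symDeg hasLinearForms_symDeg.exists_ne_zero W j

variable [Module.Finite k g₁] [NeZero (2 : k)] {S : LieSuperalgebra k g₀ g₁}

/-- The rigid form underlying `L(V)`. -/
def GrMod.rigidForm (V : GrMod S) : RigidForm k g₀ g₁ where
  piece := V.piece
  d := complexD V
  d_comp_d := complexD_comp V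

theorem isRigid_complexOf (V : GrMod S) : IsRigid k g₀ g₁ (complexOf V) :=
  ⟨fun j => isQuasicoherent_projTwist (V.piece j) j, V.rigidForm, ⟨Iso.refl _⟩⟩

end RigidOfModule

/-! ### Finitely generated sections over affine open subsets -/

section AffineSections

/-- A quasi-coherent sheaf without nonzero sections over an affine open subset vanishes on it. -/
theorem subsingleton_sections_of_le {X : Scheme.{u}} (M : X.Modules) [M.IsQuasicoherent]
    {U V : X.Opens} (hU : IsAffineOpen U) (h : Subsingleton Γ(M, U)) (hV : V ≤ U) :
    Subsingleton Γ(M, V) := by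
  let N := M.restrict hU.fromSpec
  have h1 : Subsingleton Γ(N, ⊤) := by
    change Subsingleton Γ(M, hU.fromSpec ''ᵁ ⊤)
    rwa [Scheme.Hom.image_top_eq_opensRange, hU.opensRange_fromSpec]
  have h2 : Limits.IsZero (moduleSpecΓFunctor.obj N) :=
    @ModuleCat.isZero_of_subsingleton _ _ (moduleSpecΓFunctor.obj N) h1
  have h3 : Limits.IsZero N :=
    ((tilde.functor _).map_isZero h2).of_iso (asIso N.fromTildeΓ).symm
  have h4 : Subsingleton Γ(N, hU.fromSpec ⁻¹ᵁ V) := subsingleton_of_forall_eq 0 fun s =>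
    congrArg (fun φ : N ⟶ N => φ.app (hU.fromSpec ⁻¹ᵁ V) s) (h3.eq_of_src (𝟙 N) 0)
  change Subsingleton Γ(M, hU.fromSpec ''ᵁ (hU.fromSpec ⁻¹ᵁ V)) at h4
  rwa [Scheme.Hom.image_preimage_eq_opensRange_inf, hU.opensRange_fromSpec,
    inf_eq_right.2 hV] at h4

end AffineSections

section FiniteSections
variable {k A : Type u} [Field k] [CommRing A] [Algebra k A] [IsDomain A]
  {𝒜 : ℕ → Submodule k A} [GradedAlgebra 𝒜]
  {W : Type u} [AddCommGroup W] [Module k W]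

/-- Over a nonempty affine open subset, `𝒪(j)` has a section that does not vanish at the generic
point. -/
theorem exists_isScalarSec_ne_zero (h𝒜 : CoveredByLinear 𝒜) (h : ∃ f ∈ 𝒜 1, f ≠ 0) (j : ℤ)
    {U : (Proj 𝒜).Opens} (hU : IsAffineOpen U) (hη : genericPt h ∈ U) :
    ∃ c, IsScalarSec 𝒜 j U c ∧ c ⟨genericPt h, hη⟩ ≠ 0 := by
  let w := Module.Basis.singleton PUnit.{1} k
  by_contra! H
  have h0 : Subsingleton Γ(twistSheaf 𝒜 k j, U) := ⟨fun s t => by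
    have key (s : Γ(twistSheaf 𝒜 k j, U)) (p) (hp) : twVal s p hp = 0 :=
      coordAt_ext w fun i => by
        rw [map_zero]
        exact coordAt_eq_zero w h s i p hp (H _ (isScalarSec_coordAt w s.2 i))
    exact tw_ext fun p hp => (key s p hp).trans (key t p hp).symm⟩
  obtain ⟨f, hf, hf'⟩ := h𝒜 (genericPt h)
  have hV : genericPt h ∈ U ⊓ ProjectiveSpectrum.basicOpen 𝒜 f := ⟨hη, hf'⟩
  have := isQuasicoherent_twistSheaf h𝒜 h k j
  have h1 := subsingleton_sections_of_le (twistSheaf 𝒜 k j) hU h0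
    (inf_le_left : U ⊓ ProjectiveSpectrum.basicOpen 𝒜 f ≤ U)
  have h2 : powTmul (W := k) hf j (inf_le_right : U ⊓ ProjectiveSpectrum.basicOpen 𝒜 f ≤ _) 1 = 0 :=
    h1.elim _ _
  have h3 := congrArg (fun s => coordAt w _ PUnit.unit (twVal s (genericPt h) hV)) h2
  have h4 : powAt f j (genericPt h) = 0 := by
    refine Eq.trans ?_ (h3.trans (map_zero _))
    rw [twVal_powTmul, coordAt_tmul]
    simp [w]
  have h5 := powAt_mul_neg f j (genericPt h)
  rw [h4, zero_mul] at h5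
  exact zero_ne_one h5

theorem finite_sections_of_finite (h : ∃ f ∈ 𝒜 1, f ≠ 0) [Module.Finite k W] {f : A}
    (hf : f ∈ 𝒜 1) (j : ℤ) {U : (Proj 𝒜).Opens} (hU : U ≤ ProjectiveSpectrum.basicOpen 𝒜 f) :
    Module.Finite Γ(Proj 𝒜, U) Γ(twistSheaf 𝒜 W j, U) :=
  Module.Finite.of_basis (twistBasis (Module.finBasis k W) hf j hU h)

/-- If the sections of `W ⊗ 𝒪(j)` over a nonempty affine open subset are finitely generated, then
`W` is finite-dimensional: the coordinates of the generators at the generic point involve only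
finitely many basis vectors of `W`. -/
theorem finite_of_finite_sections (h𝒜 : CoveredByLinear 𝒜) (h : ∃ f ∈ 𝒜 1, f ≠ 0) {j : ℤ}
    {U : (Proj 𝒜).Opens} (hU : IsAffineOpen U) (hη : genericPt h ∈ U)
    (hfin : Module.Finite Γ(Proj 𝒜, U) Γ(twistSheaf 𝒜 W j, U)) : Module.Finite k W := by
  let w := Module.Basis.ofVectorSpace k W
  obtain ⟨c, hc, hc0⟩ := exists_isScalarSec_ne_zero h𝒜 h j hU hη
  obtain ⟨T, hT⟩ := hfin.fg_top
  let B : Set (Module.Basis.ofVectorSpaceIndex k W) :=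
    ⋃ t ∈ T, {i | coordAt w (Loc 𝒜 (genericPt h)) i (twVal t _ hη) ≠ 0}
  have hB : B.Finite := T.finite_toSet.biUnion fun t _ => finite_coordAt w (twVal t _ hη)
  have key (i) (hi : i ∉ B) (s : Γ(twistSheaf 𝒜 W j, U)) :
      coordAt w (Loc 𝒜 (genericPt h)) i (twVal s _ hη) = 0 := by
    have hs : s ∈ Submodule.span Γ(Proj 𝒜, U) (T : Set Γ(twistSheaf 𝒜 W j, U)) :=
      hT ▸ Submodule.mem_top
    induction hs using Submodule.span_induction with
    | zero => exact map_zero _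
    | add x y _ _ hx hy => rw [twVal_add, map_add, hx, hy, add_zero]
    | smul r x _ hx => rw [twVal_smul, map_smul, hx, smul_zero]
    | mem x hx =>
      by_contra hne
      exact hi (Set.mem_biUnion hx hne)
  have huniv : B = Set.univ := by
    by_contra hne
    obtain ⟨i, hi⟩ := (Set.ne_univ_iff_exists_notMem B).1 hne
    have h1 := key i hi ⟨_, hc.tmul_mem (w i)⟩
    change coordAt w (Loc 𝒜 (genericPt h)) i (c ⟨genericPt h, hη⟩ ⊗ₜ w i) = 0 at h1
    rw [coordAt_tmul, Module.Basis.coord_apply, Module.Basis.repr_self, Finsupp.single_eq_same,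
      one_smul] at h1
    exact hc0 h1
  have : Finite (Module.Basis.ofVectorSpaceIndex k W) :=
    Set.finite_univ_iff.1 (huniv ▸ hB)
  exact Module.Finite.of_basis w

end FiniteSections

/-! ### Finite-dimensional modules and finite rigid complexes -/

section GradedFinite
variable {k : Type u} [Field k] {M : ℤ → Type u} [∀ j, AddCommGroup (M j)] [∀ j, Module k (M j)]

/-- A graded vector space is finite-dimensional if and only if its pieces are and only finitely many
of them are nonzero. -/
theorem finite_directSum_iff : Module.Finite k (DirectSum ℤ M) ↔
    (∀ j, Module.Finite k (M j)) ∧ ∃ a b : ℤ, ∀ j, j < a ∨ b < j → Subsingleton (M j) := by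
  classical
  have hsurj (j) : Function.Surjective (DirectSum.component k ℤ M j) := fun m =>
    ⟨DirectSum.lof k ℤ M j m, DirectSum.component.lof_self k j m⟩
  constructor
  · intro h
    refine ⟨fun j => Module.Finite.of_surjective _ (hsurj j), ?_⟩
    obtain ⟨T, hT⟩ := h.fg_top
    let F : Finset ℤ := T.biUnion fun t => DFinsupp.support t
    have key (j) (hj : j ∉ F) : Subsingleton (M j) := by
      have h1 : DirectSum.component k ℤ M j = 0 := by
        refine LinearMap.ext_on (s := (T : Set (DirectSum ℤ M))) hT fun t ht => ?_
        by_contra hne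
        exact hj (Finset.mem_biUnion.2 ⟨t, ht, DFinsupp.mem_support_iff.2 hne⟩)
      refine subsingleton_of_forall_eq 0 fun m => ?_
      obtain ⟨x, rfl⟩ := hsurj j m
      rw [h1, LinearMap.zero_apply]
    obtain ⟨a, ha⟩ := F.bddBelow
    obtain ⟨b, hb⟩ := F.bddAbove
    refine ⟨a, b, fun j hj => key j fun hjF => ?_⟩
    have := ha hjF
    have := hb hjF
    omega
  · rintro ⟨hfin, a, b, hab⟩
    let f : (∀ j : Finset.Icc a b, M j) →ₗ[k] DirectSum ℤ M :=
      ∑ j : Finset.Icc a b, DirectSum.lof k ℤ M j ∘ₗ LinearMap.proj j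
    refine Module.Finite.of_surjective f fun x => ⟨fun j => x j, ?_⟩
    have h1 : ∀ j ∈ DFinsupp.support x, j ∈ Finset.Icc a b := fun j hj => by
      by_contra hj'
      rw [Finset.mem_Icc] at hj'
      have := hab j (by omega)
      exact DFinsupp.mem_support_iff.1 hj (Subsingleton.elim _ _)
    simp only [f, LinearMap.sum_apply, LinearMap.comp_apply, LinearMap.proj_apply]
    rw [Finset.sum_coe_sort (Finset.Icc a b) fun j => DirectSum.lof k ℤ M j (x j)]
    conv_rhs => rw [← DirectSum.sum_support_of x]
    refine (Finset.sum_subset h1 fun j _ hj => ?_).symm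
    rw [DFinsupp.notMem_support_iff.1 hj, map_zero]

end GradedFinite

section FiniteRigid
variable {k g₀ g₁ : Type u} [Field k] [LieRing g₀] [LieAlgebra k g₀] [AddCommGroup g₁] [Module k g₁]
  [LieRingModule g₀ g₁] [LieModule k g₀ g₁] [Nontrivial g₁]

theorem isZero_projTwist_iff {W : Type u} [AddCommGroup W] [Module k W] [LieRingModule g₀ W]
    [LieModule k g₀ W] (j : ℤ) : Limits.IsZero (projTwist k g₀ g₁ W j) ↔ Subsingleton W := by
  rw [Limits.IsZero.iff_id_eq_zero]
  constructor
  · intro h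
    refine subsingleton_of_forall_eq 0 fun w => (projUnit k g₀ g₁ W j).injective ?_
    have h1 := congrArg (fun φ => TwistΓ.map φ (-j) (projUnit k g₀ g₁ W j w)) h
    simp only [TwistΓ.map_id, map_zeroHom] at h1
    exact h1.trans (map_zero _).symm
  · intro h
    exact projTwist_hom_ext fun w => by
      rw [Subsingleton.elim w 0, map_zero, map_zero, map_zero]

variable {L : CochainComplex (GSheaf k g₀ g₁) ℤ}

/-- The isomorphism between the terms of isomorphic complexes. -/
abbrev termIso {L L' : CochainComplex (GSheaf k g₀ g₁) ℤ} (e : L ≅ L') (j : ℤ) : L.X j ≅ L'.X j :=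
  (HomologicalComplex.eval _ _ j).mapIso e

/-- For `L` isomorphic to a complex with terms `Vʲ ⊗ 𝒪(j)`, the space `V(L)ʲ` is `Vʲ`. -/
def RigidForm.pieceEquiv (R : RigidForm k g₀ g₁) (e : L ≅ R.complex) (j : ℤ) :
    R.piece j ≃ₗ[k] sectionPiece L j :=
  (projUnit k g₀ g₁ (R.piece j) j).trans (twistΓEquiv (termIso e j) (-j)).symm

theorem RigidForm.isZero_iff (R : RigidForm k g₀ g₁) (e : L ≅ R.complex) (j : ℤ) :
    Limits.IsZero (L.X j) ↔ Subsingleton (R.piece j) :=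
  (termIso e j).isZero_iff.trans (isZero_projTwist_iff j)

/-- A rigid complex `L` is finite if and only if the pieces of `V(L)` are finite-dimensional and
only finitely many of them are nonzero. -/
theorem IsRigid.isFiniteRigid_iff (h : IsRigid k g₀ g₁ L) :
    IsFiniteRigid L ↔ (∀ j, Module.Finite k (sectionPiece L j)) ∧
      ∃ a b : ℤ, ∀ j, j < a ∨ b < j → Subsingleton (sectionPiece L j) := by
  constructor
  · rintro ⟨-, ⟨a, b, hab⟩, R, ⟨e⟩, hR⟩
    refine ⟨fun j => ?_, a, b, fun j hj => ?_⟩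
    · have := hR j
      exact Module.Finite.equiv (R.pieceEquiv e j)
    · have := (R.isZero_iff e j).1 (hab j hj)
      exact (R.pieceEquiv e j).symm.injective.subsingleton
  · rintro ⟨hfin, a, b, hab⟩
    obtain ⟨hq, R, ⟨e⟩⟩ := h
    refine ⟨hq, ⟨a, b, fun j hj => ?_⟩, R, ⟨e⟩, fun j => ?_⟩
    · have := hab j hj
      exact (R.isZero_iff e j).2 (R.pieceEquiv e j).injective.subsingleton
    · have := hfin j
      exact Module.Finite.equiv (R.pieceEquiv e j).symm

/-- The linear isomorphism between the sections of isomorphic sheaves. -/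
def sectionsEquiv {X : Scheme.{u}} {M N : X.Modules} (e : M ≅ N) (U : X.Opens) :
    Γ(M, U) ≃ₗ[Γ(X, U)] Γ(N, U) where
  toFun := e.hom.app U
  invFun := e.inv.app U
  map_add' := map_add _
  map_smul' r s := Scheme.Modules.Hom.app_smul _ _ _
  left_inv s := congrArg (fun φ : M ⟶ M => φ.app U s) e.hom_inv_id
  right_inv s := congrArg (fun φ : N ⟶ N => φ.app U s) e.inv_hom_id

/-- The isomorphism of sheaves underlying an isomorphism of equivariant sheaves. -/
def sheafIso {F G : GSheaf k g₀ g₁} (e : F ≅ G) : F.sheaf ≅ G.sheaf where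
  hom := EquivModule.Hom.hom e.hom
  inv := EquivModule.Hom.hom e.inv
  hom_inv_id := congrArg EquivModule.Hom.hom e.hom_inv_id
  inv_hom_id := congrArg EquivModule.Hom.hom e.inv_hom_id

theorem finite_sections_of_iso {F G : GSheaf k g₀ g₁} (e : F ≅ G) {U : (ProjSpace k g₁).Opens}
    (h : Module.Finite Γ(ProjSpace k g₁, U) Γ(F.sheaf, U)) :
    Module.Finite Γ(ProjSpace k g₁, U) Γ(G.sheaf, U) :=
  Module.Finite.equiv (sectionsEquiv (sheafIso e) U)

theorem exists_finite_sections_projTwist {W : Type u} [AddCommGroup W] [Module k W]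
    [LieRingModule g₀ W] [LieModule k g₀ W] [Module.Finite k W] (j : ℤ) (x : ProjSpace k g₁) :
    ∃ U : (ProjSpace k g₁).Opens, x ∈ U ∧ IsAffineOpen U ∧
      Module.Finite Γ(ProjSpace k g₁, U) Γ((projTwist k g₀ g₁ W j).sheaf, U) := by
  obtain ⟨f, hf, hx⟩ := coveredByLinear_symDeg (k := k) (M := Module.Dual k g₁) x
  refine ⟨ProjectiveSpectrum.basicOpen _ f, hx, Proj.isAffineOpen_basicOpen _ f hf one_pos, ?_⟩
  exact finite_sections_of_finite
    (hasLinearForms_symDeg (k := k) (M := Module.Dual k g₁)).exists_ne_zero hf j le_rfl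

theorem IsFiniteRigid.isCoherentSheaf (h : IsFiniteRigid L) (j : ℤ) : IsCoherentSheaf (L.X j) := by
  obtain ⟨hq, -, R, ⟨e⟩, hR⟩ := h
  refine ⟨hq j, fun x => ?_⟩
  have := hR j
  obtain ⟨U, hx, hU, hfin⟩ := exists_finite_sections_projTwist (g₀ := g₀) (W := R.piece j) j x
  exact ⟨U, hx, hU, finite_sections_of_iso (termIso e j).symm hfin⟩

omit [Nontrivial g₁] in
/-- Generators over the structure sheaf also generate under the joint action with `g₀`. -/
theorem IsCoherentSheaf.isCoherentEquiv {F : GSheaf k g₀ g₁} (h : IsCoherentSheaf F) :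
    IsCoherentEquiv F := by
  refine ⟨h.1, fun x => ?_⟩
  obtain ⟨U, hx, hU, hfin⟩ := h.2 x
  obtain ⟨T, hT⟩ := hfin.fg_top
  exact ⟨U, hx, hU, T, fun N _ hN => top_le_iff.1 (hT ▸ Submodule.span_le.2 hN)⟩

/-- If `W ⊗ 𝒪(j)` is coherent, then `W` is finite-dimensional. -/
theorem finite_of_isCoherentSheaf {W : Type u} [AddCommGroup W] [Module k W]
    [LieRingModule g₀ W] [LieModule k g₀ W] {j : ℤ} {F : GSheaf k g₀ g₁}
    (e : F ≅ projTwist k g₀ g₁ W j) (h : IsCoherentSheaf F) : Module.Finite k W := by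
  obtain ⟨U, hx, hU, hfin⟩ := h.2 (genericPt
    (hasLinearForms_symDeg (k := k) (M := Module.Dual k g₁)).exists_ne_zero)
  exact finite_of_finite_sections coveredByLinear_symDeg _ hU hx (finite_sections_of_iso e hfin)

theorem IsRigid.isFiniteRigid_of_isCoherentSheaf (h : IsRigid k g₀ g₁ L)
    (hb : IsBoundedComplex L) (hc : ∀ j, IsCoherentSheaf (L.X j)) : IsFiniteRigid L := by
  obtain ⟨hq, R, ⟨e⟩⟩ := h
  exact ⟨hq, hb, R, ⟨e⟩, fun j => finite_of_isCoherentSheaf (termIso e j) (hc j)⟩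

variable {S : LieSuperalgebra k g₀ g₁}

theorem isFiniteDimensional_sectionModule_iff (h : IsRigid k g₀ g₁ L) (hL : HasSectionModule L S) :
    (sectionModule hL).IsFiniteDimensional ↔ IsFiniteRigid L :=
  finite_directSum_iff.trans h.isFiniteRigid_iff.symm

theorem isFiniteDimensional_iff [Module.Finite k g₁] [NeZero (2 : k)] (V : GrMod S) :
    V.IsFiniteDimensional ↔ IsFiniteRigid (complexOf V) := by
  rw [(isRigid_complexOf V).isFiniteRigid_iff]
  refine finite_directSum_iff.trans (and_congr (forall_congr' fun j => ?_)
    (exists_congr fun a => exists_congr fun b => forall_congr' fun j =>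
      imp_congr_right fun _ => ?_))
  · exact Module.Finite.equiv_iff (pieceUnit V j)
  · exact (pieceUnit V j).toEquiv.subsingleton_congr

end FiniteRigid

end GZeroGeometry
end

theorem mainTheorem4 {k g₀ g₁ : Type u} [Field k] [NeZero (2 : k)]
    [LieRing g₀] [LieAlgebra k g₀] [Module.Finite k g₀]
    [AddCommGroup g₁] [Module k g₁] [LieRingModule g₀ g₁] [LieModule k g₀ g₁] [Module.Finite k g₁]
    [Nontrivial g₁]
    (S : GZeroGeometry.LieSuperalgebra k g₀ g₁) (hS : ∀ a b : g₁, S.oddBracket a b = 0) :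
    ∃ (hL : ∀ V : GZeroGeometry.GrMod S,
        GZeroGeometry.IsRigid k g₀ g₁ ((GZeroGeometry.complexFunctor S).obj V))
      (hV : GZeroGeometry.IsRigid k g₀ g₁ ≤ GZeroGeometry.hasSectionModule S)
      (e : CategoryTheory.Equivalence (GZeroGeometry.GrMod S)
        (GZeroGeometry.IsRigid k g₀ g₁).FullSubcategory),
      e.functor = (GZeroGeometry.IsRigid k g₀ g₁).lift (GZeroGeometry.complexFunctor S) hL ∧
      e.inverse = (CategoryTheory.ObjectProperty.ιOfLE hV).comp
        (GZeroGeometry.sectionFunctor S) ∧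
      (∀ V : GZeroGeometry.GrMod S, V.IsFiniteDimensional ↔
        GZeroGeometry.IsFiniteRigid ((GZeroGeometry.complexFunctor S).obj V)) ∧
      (∀ (L : CochainComplex (GZeroGeometry.GSheaf k g₀ g₁) ℤ)
        (h : GZeroGeometry.IsRigid k g₀ g₁ L),
        (GZeroGeometry.sectionModule (hV L h)).IsFiniteDimensional ↔
          GZeroGeometry.IsFiniteRigid L) ∧
      (∀ L : CochainComplex (GZeroGeometry.GSheaf k g₀ g₁) ℤ, GZeroGeometry.IsFiniteRigid L →
        ∀ j, GZeroGeometry.IsCoherentEquiv (L.X j)) ∧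
      (∀ L : CochainComplex (GZeroGeometry.GSheaf k g₀ g₁) ℤ, GZeroGeometry.IsRigid k g₀ g₁ L →
        (GZeroGeometry.IsFiniteRigid L ↔ GZeroGeometry.IsBoundedComplex L ∧
          ∀ j, GZeroGeometry.IsCoherentSheaf (L.X j))) := by
  refine ⟨fun V => GZeroGeometry.isRigid_complexOf V,
    GZeroGeometry.isRigid_le_hasSectionModule hS,
    GZeroGeometry.rigidEquivalence _ hS _, rfl, rfl,
    fun V => GZeroGeometry.isFiniteDimensional_iff V,
    fun L h => GZeroGeometry.isFiniteDimensional_sectionModule_iff h _,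
    fun L h j => (h.isCoherentSheaf j).isCoherentEquiv,
    fun L h => ⟨fun hf => ⟨hf.2.1, hf.isCoherentSheaf⟩,
      fun hc => h.isFiniteRigid_of_isCoherentSheaf hc.1 hc.2⟩⟩
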